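/- A Steiner triple system of order $v$ is a pair $(V,\mathcal B)$, where $V$ is a set of $v$ points and $\mathcal B$ is a set of $3$-subsets of $V$ (blocks) such that any two distinct points lie in exactly one block. A Kirkman triple system of order $v$, KTS$(v)$, is a Steiner triple system of order $v$ together with a resolution, that is, a partition of $\mathcal B$ into classes each of which is a partition of $V$. An automorphism of a KTS is a permutation of its points leaving the resolution invariant. A KTS is $3$-pyramidal if it admits a group of automorphisms that fixes three points and acts sharply transitively on the remaining ones. **Theorem.** Let $v>3$. If a $3$-pyramidal KTS$(v)$ exists, then, for some integer $n\ge 0$, one of the following holds: $v=24n+9$; or $v=24n+15$; or $v=48n+3$ and $n=4^e m$ for some integer $e\ge 0$ and some odd positive integer $m$. Conversely, for every integer $n\ge 0$: (i) if $4n+1$ is a sum of two squares of integers, then there exists a $3$-pyramidal KTS$(24n+9)$; (ii) if $2n+1$ is divisible by $3$, or if no prime $p\equiv 11\pmod{12}$ divides the square-free part of $2n+1$ (the product of the primes that occur with odd exponent in the prime factorization of $2n+1$), then there exists a $3$-pyramidal KTS$(24n+15)$; (iii) if $n=4^e m$ with $e\ge 0$ and $m$ odd, then there exists a $3$-pyramidal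 KTS$(48n+3)$. -/

import Mathlib

/-- A Steiner triple system on the point set `V`: a set of 3-subsets of `V` (the blocks) such that
any two distinct points are contained in exactly one block. -/
structure SteinerTripleSystem (V : Type*) where
  blocks : Set (Finset V)
  card_eq_three : ∀ b ∈ blocks, b.card = 3
  existsUnique_block : ∀ x y : V, x ≠ y → ∃! b : Finset V, b ∈ blocks ∧ x ∈ b ∧ y ∈ b

/-- A Kirkman triple system on the point set `V`: a Steiner triple system together with a
resolution, i.e. a partition of its set of blocks into (nonempty) classes, each of which is a
partition of the point set. (The blocks in a class are nonempty since they have size 3.) -/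
structure KirkmanTripleSystem (V : Type*) extends SteinerTripleSystem V where
  resolution : Set (Set (Finset V))
  nonempty_of_mem : ∀ P ∈ resolution, P.Nonempty
  subset_blocks : ∀ P ∈ resolution, P ⊆ blocks
  existsUnique_class : ∀ b ∈ blocks, ∃! P : Set (Finset V), P ∈ resolution ∧ b ∈ P
  parallel : ∀ P ∈ resolution, ∀ x : V, ∃! b : Finset V, b ∈ P ∧ x ∈ b

namespace KirkmanTripleSystem

/-- The image of a set of blocks under a permutation of the points. -/
def mapClass {V : Type*} (σ : Equiv.Perm V) (P : Set (Finset V)) : Set (Finset V) :=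
  (fun b : Finset V => b.map σ.toEmbedding) '' P

/-- An automorphism of a Kirkman triple system: a permutation of the points leaving the resolution
invariant. -/
def IsAutomorphism {V : Type*} (K : KirkmanTripleSystem V) (σ : Equiv.Perm V) : Prop :=
  mapClass σ '' K.resolution = K.resolution

/-- A Kirkman triple system is `f`-pyramidal if it admits a group `G` of automorphisms which fixes
`f` points and acts sharply transitively on the others. -/
def IsPyramidal {V : Type*} (K : KirkmanTripleSystem V) (f : ℕ) : Prop :=
  ∃ G : Subgroup (Equiv.Perm V), (∀ σ ∈ G, K.IsAutomorphism σ) ∧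
    ∃ F : Finset V, F.card = f ∧ (∀ σ ∈ G, ∀ x ∈ F, σ x = x) ∧
      ∀ x y : V, x ∉ F → y ∉ F → ∃! σ : Equiv.Perm V, σ ∈ G ∧ σ x = y

end KirkmanTripleSystem

/-- There exists an `f`-pyramidal Kirkman triple system of order `v`. -/
def ExistsPyramidalKTS (f v : ℕ) : Prop :=
  ∃ (V : Type) (_ : Fintype V) (K : KirkmanTripleSystem V), Fintype.card V = v ∧ K.IsPyramidal f

/-- The square-free part of a positive integer: the product of the primes that occur with an odd
exponent in its prime factorization. -/
def squarefreePart (k : ℕ) : ℕ :=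
  ∏ p ∈ k.primeFactors with Odd (k.factorization p), p

/-!
Let a group `G` act on a 3-pyramidal Kirkman triple system, sharply transitively off the three fixed
points, so that `v = |G| + 3`.

*Necessity.* Each block through exactly one fixed point is `{i, x, σ x}` with an involution `σ`.
Hence `G` has exactly three involutions, and the invariance of the classes of the resolution makes
them conjugate (`IsPyramidal.exists_group`). The group acts on its involutions by conjugation.

* If the involutions do not commute, each acts as a transposition of the other two, so the sign of
  the action is a homomorphism for which they are odd. The odd elements of `G` other than the three
  involutions come in quadruples of differences of blocks with points of both signs. This gives
  `|G| = 8 k + 6` (`card_of_ne_one`), and `3 ∣ v` does the rest.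
* If they commute, they form with `1` a normal Klein four-group, and no involution normalizes a
  `3`-group that permutes the involutions cyclically. Two applications of the Frattini argument show
  that `G` permutes its involutions evenly (`sign_eq_one_of_comm`), and that a Sylow `2`-subgroup is
  normalized by an element of `3`-power order that fixes only `1`, so that its order is `1` modulo
  `3`, hence a power of `4` (`card_of_eq_one`).

*Sufficiency.* A `Starter` in `G` is a family of base triples whose differences and points cover `G`
suitably; its translates form a 3-pyramidal Kirkman triple system
(`Starter.existsPyramidalKTS`). Only covering has to be verified, as the numbers fit.
Starters are built in groups `H × R`, where `H` is the dihedral group of order six or a semidirect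
product `ℤ[ω]/(2ᶠ) ⋊ U` with `U = ℤ/3`, `ℤ/9` or `ℤ/9 × ℤ/3` acting through the cube root of unity
`ω`, and where `R` is a product of finite fields `F`. One more factor `F` requires a `RelFamily`
over `H` and `F` (`Starter.step`, `reach_of_factorization`). These come from finite tables:

* if `-1` is a square in `F`, triples with Gaussian integers as coefficients are multiplied by a
  transversal of the fourth roots of unity (`relFamily_of_root`); this covers the fields of order
  `p²` as well, so that only primes with odd exponent matter;
* if `F` contains a primitive sixth root of unity, this root takes the role of `i`
  (`relFamily_of_sixth_root`);
* if `-1` is not a square, there are `x`, `y`, `z` of prescribed quadratic characters, not all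
  equal, for which `x - y`, `y - z` and `z - x` are squares; they are attached to triples in `H`,
  and multiplied by all squares (`SignedFamily.relFamily`).

The groups `ℤ[ω]/(2ᶠ) ⋊ U` for large `f` are reached by lifting families from small quotients: a
triple is twisted by `(n, ω n, ω² n)` for all `n`, and the covering of points is restored by shifts
depending on `n` (`Split`, `Covers.lift`) or by a choice of representatives invariant under `ω`
(`exists_representatives`, `SignedFamily.lift`).
-/

/-! ### Starter families and the Kirkman triple systems they generate -/

/-- `Covers j D P n`: there is a family of `n` ordered base triples of the group `G` such that every
element of `D` is a left difference `b k * (b l)⁻¹` (`k ≠ l`) of one of them, and every element of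
`P` is a point of one of them up to right multiplication by the involution `j`. Only covering is
demanded; when the sizes fit, exactness follows by counting. -/
def Covers {G : Type} [Group G] (j : G) (D P : Set G) (n : ℕ) : Prop :=
  ∃ (ι : Type) (_ : Fintype ι) (b : ι → Fin 3 → G), Fintype.card ι = n ∧
    (∀ d ∈ D, ∃ i k l, k ≠ l ∧ b i k * (b i l)⁻¹ = d) ∧
    (∀ p ∈ P, ∃ i k, b i k = p ∨ b i k * j = p)

/-- A starter in the finite group `G` with distinguished involution `j`: all involutions of `G` are
the three conjugates `x l * j * (x l)⁻¹`, there is an element `a` of order three, and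
`(|G| - 6) / 6` base triples cover all differences outside `⟨a⟩` and the involutions, and all points
outside the cosets `x l * {1, j}`. -/
def Starter (G : Type) [Group G] (j : G) : Prop :=
  Finite G ∧ j * j = 1 ∧ j ≠ 1 ∧ ∃ (a : G) (x : Fin 3 → G) (n : ℕ), a * a * a = 1 ∧ a ≠ 1 ∧
    (Function.Injective fun l => x l * j * (x l)⁻¹) ∧
    (∀ g : G, g * g = 1 → g ≠ 1 → ∃ l, g = x l * j * (x l)⁻¹) ∧
    Nat.card G = 6 * n + 6 ∧
    Covers j {g | g ≠ a ∧ g ≠ a * a ∧ g * g ≠ 1} {g | ∀ l, g ≠ x l ∧ g ≠ x l * j} n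

/-- A map from a set with at most `|S|` elements that reaches all of `S` is a bijection onto `S`. -/
theorem injective_and_forall_of_card_le {α β : Type} [Fintype α] (f : α → β) (S : Finset β)
    (hS : Fintype.card α ≤ S.card) (h : ∀ s ∈ S, ∃ x, f x = s) :
    Function.Injective f ∧ ∀ x, f x ∈ S := by
  classical
  have h1 : S ⊆ Finset.univ.image f := fun s hs => by
    obtain ⟨x, hx⟩ := h s hs
    exact Finset.mem_image.2 ⟨x, Finset.mem_univ _, hx⟩
  have h2 : (Finset.univ.image f).card ≤ Fintype.card α := Finset.card_image_le
  have h3 : S = Finset.univ.image f := Finset.eq_of_subset_of_card_le h1 (h2.trans hS)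
  refine ⟨?_, fun x => h3 ▸ Finset.mem_image_of_mem f (Finset.mem_univ x)⟩
  have h4 : (Finset.univ.image f).card = (Finset.univ : Finset α).card :=
    le_antisymm h2 (by rw [← h3]; exact hS)
  intro x y hxy
  exact Finset.card_image_iff.1 h4 (Finset.mem_coe.2 (Finset.mem_univ x))
    (Finset.mem_coe.2 (Finset.mem_univ y)) hxy

/-- The data of a starter with the counting carried out: differences and points occur exactly
once. -/
structure ExactStarter (G : Type) [Group G] where
  j : G
  a : G
  x : Fin 3 → G
  ι : Type
  b : ι → Fin 3 → G
  jj : j * j = 1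
  j_ne : j ≠ 1
  aaa : a * a * a = 1
  a_ne : a ≠ 1
  x_inj : Function.Injective fun l => x l * j * (x l)⁻¹
  inv_eq : ∀ g : G, g * g = 1 → g ≠ 1 → ∃ l, g = x l * j * (x l)⁻¹
  diff_inj : ∀ i k l i' k' l', k ≠ l → k' ≠ l' →
    b i k * (b i l)⁻¹ = b i' k' * (b i' l')⁻¹ → i = i' ∧ k = k' ∧ l = l'
  diff_not : ∀ i k l, k ≠ l → b i k * (b i l)⁻¹ ≠ a ∧ b i k * (b i l)⁻¹ ≠ a * a ∧
    b i k * (b i l)⁻¹ * (b i k * (b i l)⁻¹) ≠ 1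
  diff_cov : ∀ d, d ≠ a → d ≠ a * a → d * d ≠ 1 → ∃ i k l, k ≠ l ∧ b i k * (b i l)⁻¹ = d
  pt_inj : ∀ i k i' k' (e e' : Fin 2), b i k * j ^ (e : ℕ) = b i' k' * j ^ (e' : ℕ) →
    i = i' ∧ k = k' ∧ e = e'
  pt_not : ∀ i k (e : Fin 2) l, b i k * j ^ (e : ℕ) ≠ x l ∧ b i k * j ^ (e : ℕ) ≠ x l * j
  pt_cov : ∀ p, (∀ l, p ≠ x l ∧ p ≠ x l * j) → ∃ i k, ∃ e : Fin 2, b i k * j ^ (e : ℕ) = p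

/-- The family of a starter has just enough triples to cover what it has to, so nothing is covered
twice and nothing else is covered. -/
theorem Starter.exact {G : Type} [Group G] {j : G} (h : Starter G j) :
    Nonempty (ExactStarter G) := by
  classical
  obtain ⟨hfin, jj, j_ne, a, x, n, aaa, a_ne, x_inj, inv_eq, hcard, ι, _, b, hι, hD, hP⟩ := h
  have := Fintype.ofFinite G
  rw [Nat.card_eq_fintype_card] at hcard
  have hji : j⁻¹ = j := inv_eq_of_mul_eq_one_left jj
  -- both coverings are surjections from a set with `6 n` elements onto one with at least `6 n`
  have hcomp : ∀ (L : List G) (S : Finset G), L.length ≤ 6 → (∀ g, g ∉ S → g ∈ L) →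
      6 * n ≤ S.card := by
    intro L S hL hS
    have h1 : Sᶜ ⊆ L.toFinset := fun g hg => by
      rw [List.mem_toFinset]; exact hS g (Finset.mem_compl.1 hg)
    have h2 := (Finset.card_le_card h1).trans L.toFinset_card_le
    rw [Finset.card_compl, hcard] at h2
    omega
  have c1 : 6 * n ≤ (Finset.univ.filter fun g : G => g ≠ a ∧ g ≠ a * a ∧ g * g ≠ 1).card := by
    refine hcomp [1, a, a * a, x 0 * j * (x 0)⁻¹, x 1 * j * (x 1)⁻¹, x 2 * j * (x 2)⁻¹] _
      (by simp) ?_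
    intro g hg
    simp only [Finset.mem_filter, Finset.mem_univ, true_and] at hg
    simp only [List.mem_cons, List.not_mem_nil, or_false]
    by_cases h1 : g = 1
    · exact Or.inl h1
    by_cases h2 : g = a
    · tauto
    by_cases h3 : g = a * a
    · tauto
    have h4 : g * g = 1 := by tauto
    obtain ⟨l, hl⟩ := inv_eq g h4 h1
    fin_cases l <;> simp at hl <;> tauto
  have c2 : 6 * n ≤ (Finset.univ.filter fun g : G => ∀ l, g ≠ x l ∧ g ≠ x l * j).card := by
    refine hcomp [x 0, x 1, x 2, x 0 * j, x 1 * j, x 2 * j] _ (by simp) ?_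
    intro g hg
    simp only [Finset.mem_filter, Finset.mem_univ, true_and, not_forall, not_and_or,
      not_not] at hg
    obtain ⟨l, hl⟩ := hg
    simp only [List.mem_cons, List.not_mem_nil, or_false]
    fin_cases l <;> simp at hl <;> tauto
  let X1 := ι × {p : Fin 3 × Fin 3 // p.1 ≠ p.2}
  let X2 := ι × Fin 3 × Fin 2
  have d1 : Fintype.card X1 = 6 * n := by
    rw [Fintype.card_prod, hι, mul_comm]; congr 1
  have d2 : Fintype.card X2 = 6 * n := by
    rw [Fintype.card_prod, hι, mul_comm]; congr 1
  obtain ⟨i1, r1⟩ := injective_and_forall_of_card_le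
    (fun p : X1 => b p.1 p.2.1.1 * (b p.1 p.2.1.2)⁻¹) _ (d1.le.trans c1) (by
      intro s hs
      obtain ⟨i, k, l, hkl, e⟩ := hD s (by simpa using hs)
      exact ⟨(i, ⟨(k, l), hkl⟩), e⟩)
  obtain ⟨i2, r2⟩ := injective_and_forall_of_card_le
    (fun p : X2 => b p.1 p.2.1 * j ^ (p.2.2 : ℕ)) _ (d2.le.trans c2) (by
      intro s hs
      obtain ⟨i, k, e⟩ := hP s (by simpa using hs)
      rcases e with e | e
      · exact ⟨(i, k, 0), by simpa using e⟩
      · exact ⟨(i, k, 1), by simpa using e⟩)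
  refine ⟨⟨j, a, x, ι, b, jj, j_ne, aaa, a_ne, x_inj, inv_eq, ?_, ?_, ?_, ?_, ?_, ?_⟩⟩
  · intro i k l i' k' l' h h' e
    have h1 := @i1 (i, ⟨(k, l), h⟩) (i', ⟨(k', l'), h'⟩) e
    exact ⟨congrArg (fun p : X1 => p.1) h1, congrArg (fun p : X1 => p.2.1.1) h1,
      congrArg (fun p : X1 => p.2.1.2) h1⟩
  · intro i k l h
    have := r1 (i, ⟨(k, l), h⟩)
    simpa using this
  · intro d h1 h2 h3
    exact hD d ⟨h1, h2, h3⟩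
  · intro i k i' k' e e' h
    have h1 := @i2 (i, k, e) (i', k', e') h
    exact ⟨congrArg (fun p : X2 => p.1) h1, congrArg (fun p : X2 => p.2.1) h1,
      congrArg (fun p : X2 => p.2.2) h1⟩
  · intro i k e
    have := r2 (i, k, e)
    simpa using this
  · intro p hp
    obtain ⟨i, k, e⟩ := hP p hp
    rcases e with e | e
    · exact ⟨i, k, 0, by simpa using e⟩
    · exact ⟨i, k, 1, by simpa using e⟩

namespace ExactStarter

variable {G : Type} [Group G] (S : ExactStarter G)

/-- The involutions of `G`; `x l` conjugates `j` to `c l`. -/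
def c (l : Fin 3) : G := S.x l * S.j * (S.x l)⁻¹

/-- Labels for the blocks generated by a starter. The points are the elements of `G` and three
points at infinity. -/
inductive Idx (S : ExactStarter G) : Type
  | F : Idx S
  | A (g : G) : Idx S
  | I (l : Fin 3) (g : G) : Idx S
  | B (i : S.ι) (g : G) : Idx S

open Classical in
/-- The block with a given label: the block at infinity, the translates of the subgroup of order
three, the blocks through one point at infinity, and the translates of the base triples. -/
noncomputable def blk : Idx S → Finset (G ⊕ Fin 3)
  | .F => {Sum.inr 0, Sum.inr 1, Sum.inr 2}
  | .A g => {Sum.inl g, Sum.inl (S.a * g), Sum.inl (S.a * S.a * g)}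
  | .I l g => {Sum.inr l, Sum.inl g, Sum.inl (S.c l * g)}
  | .B i g => {Sum.inl (S.b i 0 * g), Sum.inl (S.b i 1 * g), Sum.inl (S.b i 2 * g)}

@[simp] theorem inr_mem_F (m : Fin 3) : Sum.inr m ∈ S.blk .F := by
  fin_cases m <;> simp [blk]

@[simp] theorem inl_mem_F (z : G) : Sum.inl z ∈ S.blk .F ↔ False := by simp [blk]

@[simp] theorem inr_mem_A (m : Fin 3) (g : G) : Sum.inr m ∈ S.blk (.A g) ↔ False := by
  simp [blk]

@[simp] theorem inl_mem_A (z g : G) :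
    Sum.inl z ∈ S.blk (.A g) ↔ z = g ∨ z = S.a * g ∨ z = S.a * S.a * g := by
  simp [blk]

@[simp] theorem inr_mem_I (m l : Fin 3) (g : G) : Sum.inr m ∈ S.blk (.I l g) ↔ m = l := by
  simp [blk]

@[simp] theorem inl_mem_I (z : G) (l : Fin 3) (g : G) :
    Sum.inl z ∈ S.blk (.I l g) ↔ z = g ∨ z = S.c l * g := by
  simp [blk]

@[simp] theorem inr_mem_B (m : Fin 3) (i : S.ι) (g : G) :
    Sum.inr m ∈ S.blk (.B i g) ↔ False := by
  simp [blk]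

@[simp] theorem inl_mem_B (z : G) (i : S.ι) (g : G) :
    Sum.inl z ∈ S.blk (.B i g) ↔ ∃ k, z = S.b i k * g := by
  simp [blk, Fin.exists_fin_succ]

theorem c_mul_c (l : Fin 3) : S.c l * S.c l = 1 := by
  have h : S.c l * S.c l = S.x l * (S.j * S.j) * (S.x l)⁻¹ := by unfold c; group
  rw [h, S.jj]; group

theorem c_ne (l : Fin 3) : S.c l ≠ 1 := by
  intro h
  apply S.j_ne
  have h2 : S.j = (S.x l)⁻¹ * S.c l * S.x l := by unfold c; group
  rw [h2, h]; group

theorem aa_ne : S.a * S.a ≠ 1 := fun h => S.a_ne (by simpa [h] using S.aaa)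

theorem c_ne_a (l : Fin 3) : S.c l ≠ S.a ∧ S.c l ≠ S.a * S.a := by
  constructor <;> intro h <;> have h1 := S.c_mul_c l <;> rw [h] at h1
  · exact S.aa_ne h1
  · apply S.a_ne
    rw [← mul_assoc, S.aaa, one_mul] at h1
    exact h1

theorem b_inj {i : S.ι} {k l : Fin 3} (h : S.b i k = S.b i l) : k = l := by
  by_contra hkl
  exact (S.diff_not i k l hkl).2.2 (by simp [h])

theorem A_eq {z g : G} (h : Sum.inl z ∈ S.blk (.A g)) : S.blk (.A g) = S.blk (.A z) := by
  have e : S.a * (S.a * (S.a * g)) = g := by rw [← mul_assoc, ← mul_assoc, S.aaa, one_mul]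
  rcases (S.inl_mem_A z g).1 h with rfl | rfl | rfl
  · rfl
  · ext v
    rcases v with v | m <;> simp [mul_assoc, e]; tauto
  · ext v
    rcases v with v | m <;> simp [mul_assoc, e]; tauto

theorem I_eq {z g : G} {l : Fin 3} (h : Sum.inl z ∈ S.blk (.I l g)) :
    S.blk (.I l g) = S.blk (.I l z) := by
  rcases (S.inl_mem_I z l g).1 h with rfl | rfl
  · rfl
  · ext v
    rcases v with v | m <;> simp [← mul_assoc, S.c_mul_c]; tauto

/-- The ratio of two points of a block that lie in `G` shows the type of the block; `I_ratio` and
`B_ratio` are the corresponding facts for the other types. -/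
theorem A_ratio {z w g : G} (hzw : z ≠ w) (hz : Sum.inl z ∈ S.blk (.A g))
    (hw : Sum.inl w ∈ S.blk (.A g)) : z * w⁻¹ = S.a ∨ z * w⁻¹ = S.a * S.a := by
  rw [S.A_eq hw, S.inl_mem_A] at hz
  rcases hz with h | h | h
  · exact absurd h hzw
  · left; rw [h]; group
  · right; rw [h]; group

theorem I_ratio {z w g : G} {l : Fin 3} (hzw : z ≠ w) (hz : Sum.inl z ∈ S.blk (.I l g))
    (hw : Sum.inl w ∈ S.blk (.I l g)) : z * w⁻¹ = S.c l := by
  rw [S.I_eq hw, S.inl_mem_I] at hz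
  rcases hz with h | h
  · exact absurd h hzw
  · rw [h]; group

theorem B_ratio {z w g : G} {i : S.ι} (hzw : z ≠ w) (hz : Sum.inl z ∈ S.blk (.B i g))
    (hw : Sum.inl w ∈ S.blk (.B i g)) :
    ∃ k l, k ≠ l ∧ z * w⁻¹ = S.b i k * (S.b i l)⁻¹ ∧ g = (S.b i l)⁻¹ * w := by
  obtain ⟨k, rfl⟩ := (S.inl_mem_B z i g).1 hz
  obtain ⟨l, rfl⟩ := (S.inl_mem_B w i g).1 hw
  refine ⟨k, l, ?_, by group, by group⟩
  rintro rfl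
  exact hzw rfl

theorem A_ne_B (g : G) (i : S.ι) (h : G) : S.blk (.A g) ≠ S.blk (.B i h) := by
  intro e
  have hne : S.a * g ≠ g := fun h => S.a_ne (by simpa using h)
  obtain ⟨k, l, hkl, e1, -⟩ := S.B_ratio (z := S.a * g) (w := g) (i := i) (g := h) hne
    (by rw [← e]; simp) (by rw [← e]; simp)
  exact (S.diff_not i k l hkl).1 (by rw [← e1]; group)

theorem B_inj {i i' : S.ι} {g g' : G} (e : S.blk (.B i g) = S.blk (.B i' g')) :
    i = i' ∧ g = g' := by
  have h0 : S.b i 0 * g ≠ S.b i 1 * g := fun h => by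
    have := S.b_inj (mul_right_cancel h); simp at this
  obtain ⟨k, l, hkl, e1, e2⟩ := S.B_ratio (i := i') (g := g') h0
    (by rw [← e]; simp) (by rw [← e]; simp)
  obtain ⟨rfl, rfl, rfl⟩ := S.diff_inj i 0 1 i' k l (by simp) hkl (by rw [← e1]; group)
  exact ⟨rfl, by rw [e2]; group⟩

/-- A block is determined by two of its points in `G`. -/
theorem eq_block_of_mem {z w : G} (hzw : z ≠ w) (X : S.Idx) (hz : Sum.inl z ∈ S.blk X)
    (hw : Sum.inl w ∈ S.blk X) :
    ((z * w⁻¹ = S.a ∨ z * w⁻¹ = S.a * S.a) ∧ S.blk X = S.blk (.A w)) ∨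
    (∃ l, z * w⁻¹ = S.c l ∧ S.blk X = S.blk (.I l w)) ∨
    (∃ i k l, k ≠ l ∧ z * w⁻¹ = S.b i k * (S.b i l)⁻¹ ∧
      S.blk X = S.blk (.B i ((S.b i l)⁻¹ * w))) := by
  cases X with
  | F => simp at hz
  | A g => exact Or.inl ⟨S.A_ratio hzw hz hw, S.A_eq hw⟩
  | I l g => exact Or.inr (Or.inl ⟨l, S.I_ratio hzw hz hw, S.I_eq hw⟩)
  | B i g =>
    obtain ⟨k, l, h1, h2, h3⟩ := S.B_ratio hzw hz hw
    exact Or.inr (Or.inr ⟨i, k, l, h1, h2, by rw [h3]⟩)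

theorem exists_block (z w : G) (hzw : z ≠ w) :
    ∃ X : S.Idx, Sum.inl z ∈ S.blk X ∧ Sum.inl w ∈ S.blk X := by
  have hz : z = z * w⁻¹ * w := by group
  by_cases h1 : z * w⁻¹ = S.a
  · exact ⟨.A w, by rw [hz, h1]; simp, by simp⟩
  by_cases h2 : z * w⁻¹ = S.a * S.a
  · exact ⟨.A w, by rw [hz, h2]; simp, by simp⟩
  by_cases h3 : z * w⁻¹ * (z * w⁻¹) = 1
  · obtain ⟨l, hl⟩ := S.inv_eq _ h3 (fun h => hzw (mul_inv_eq_one.1 h))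
    exact ⟨.I l w, by rw [hz, hl]; simp [c], by simp⟩
  · obtain ⟨i, k, l, -, e⟩ := S.diff_cov _ h1 h2 h3
    refine ⟨.B i ((S.b i l)⁻¹ * w), (S.inl_mem_B _ _ _).2 ⟨k, ?_⟩,
      (S.inl_mem_B _ _ _).2 ⟨l, by group⟩⟩
    rw [← mul_assoc, e]; group

theorem block_unique {z w : G} (hzw : z ≠ w) (X Y : S.Idx) (hz : Sum.inl z ∈ S.blk X)
    (hw : Sum.inl w ∈ S.blk X) (hz' : Sum.inl z ∈ S.blk Y) (hw' : Sum.inl w ∈ S.blk Y) :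
    S.blk X = S.blk Y := by
  have key : ∀ i k l, k ≠ l → z * w⁻¹ = S.b i k * (S.b i l)⁻¹ →
      z * w⁻¹ ≠ S.a ∧ z * w⁻¹ ≠ S.a * S.a ∧ ∀ l, z * w⁻¹ ≠ S.c l := by
    intro i k l hkl e
    obtain ⟨h1, h2, h3⟩ := S.diff_not i k l hkl
    rw [← e] at h1 h2 h3
    exact ⟨h1, h2, fun l h => h3 (by rw [h, S.c_mul_c])⟩
  rcases S.eq_block_of_mem hzw X hz hw with ⟨h1, e1⟩ | ⟨l, h1, e1⟩ | ⟨i, k, l, hkl, h1, e1⟩ <;>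
  rcases S.eq_block_of_mem hzw Y hz' hw' with
    ⟨h2, e2⟩ | ⟨l', h2, e2⟩ | ⟨i', k', l', hkl', h2, e2⟩
  · rw [e1, e2]
  · have := S.c_ne_a l'; rw [← h2] at this; tauto
  · have := key i' k' l' hkl' h2; tauto
  · have := S.c_ne_a l; rw [← h1] at this; tauto
  · have := S.x_inj (h1.symm.trans h2)
    rw [e1, e2, this]
  · have := key i' k' l' hkl' h2; exact absurd h1 (this.2.2 l)
  · have := key i k l hkl h1; tauto
  · have := key i k l hkl h1; exact absurd h2 (this.2.2 l')
  · obtain ⟨rfl, rfl, rfl⟩ := S.diff_inj i k l i' k' l' hkl hkl' (h1.symm.trans h2)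
    rw [e1, e2]

open Classical in
/-- The Steiner triple system generated by a starter. -/
noncomputable def sts : SteinerTripleSystem (G ⊕ Fin 3) where
  blocks := Set.range S.blk
  card_eq_three := by
    rintro _ ⟨X, rfl⟩
    rw [Finset.card_eq_three]
    cases X with
    | F => exact ⟨_, _, _, by simp, by simp, by simp, rfl⟩
    | A g =>
      refine ⟨_, _, _, ?_, ?_, ?_, rfl⟩
      · simpa using S.a_ne
      · simpa using S.aa_ne
      · simpa using S.a_ne
    | I l g =>
      refine ⟨_, _, _, by simp, by simp, ?_, rfl⟩
      simpa using S.c_ne l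
    | B i g =>
      refine ⟨_, _, _, ?_, ?_, ?_, rfl⟩ <;>
      · simp only [ne_eq, Sum.inl.injEq, mul_left_inj]
        intro h
        have := S.b_inj h
        simp at this
  existsUnique_block := by
    rintro (z | m) (w | m') hne
    · have hzw : z ≠ w := fun h => hne (by rw [h])
      obtain ⟨X, h1, h2⟩ := S.exists_block z w hzw
      refine ⟨_, ⟨⟨X, rfl⟩, h1, h2⟩, ?_⟩
      rintro _ ⟨⟨Y, rfl⟩, h3, h4⟩
      exact S.block_unique hzw Y X h3 h4 h1 h2
    · refine ⟨S.blk (.I m' z), ⟨⟨_, rfl⟩, by simp, by simp⟩, ?_⟩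
      rintro _ ⟨⟨Y, rfl⟩, h3, h4⟩
      cases Y with
      | I l g => rw [S.I_eq h3, (S.inr_mem_I _ _ _).1 h4]
      | _ => simp at h3 h4
    · refine ⟨S.blk (.I m w), ⟨⟨_, rfl⟩, by simp, by simp⟩, ?_⟩
      rintro _ ⟨⟨Y, rfl⟩, h3, h4⟩
      cases Y with
      | I l g => rw [S.I_eq h4, (S.inr_mem_I _ _ _).1 h3]
      | _ => simp at h3 h4
    · refine ⟨S.blk .F, ⟨⟨_, rfl⟩, by simp, by simp⟩, ?_⟩
      rintro _ ⟨⟨Y, rfl⟩, h3, h4⟩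
      cases Y with
      | F => rfl
      | I l g =>
        rw [inr_mem_I] at h3 h4
        exact absurd (by rw [h3, h4]) hne
      | _ => simp at h3

/-- The parallel class of the block at infinity. -/
def cls0 : Set (Finset (G ⊕ Fin 3)) := {X | X = S.blk .F ∨ ∃ g, X = S.blk (.A g)}

/-- The parallel class through the translates by `g` of the base triples. -/
def cls (g : G) : Set (Finset (G ⊕ Fin 3)) :=
  {X | (∃ l, X = S.blk (.I l (S.x l * g))) ∨ ∃ i, ∃ e : Fin 2, X = S.blk (.B i (S.j ^ (e : ℕ) * g))}

theorem cls_j (g : G) : S.cls (S.j * g) = S.cls g := by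
  have h1 : ∀ l, S.blk (.I l (S.x l * (S.j * g))) = S.blk (.I l (S.x l * g)) := fun l =>
    (S.I_eq (by simp [c, mul_assoc])).symm
  ext X
  simp only [cls, Set.mem_ofPred_eq, h1, Fin.exists_fin_two]
  simp only [Fin.isValue, Fin.val_zero, pow_zero, one_mul, Fin.val_one, pow_one, ← mul_assoc, S.jj]
  refine or_congr Iff.rfl (exists_congr fun i => or_comm)

theorem cls_pow (g : G) (e : Fin 2) : S.cls (S.j ^ (e : ℕ) * g) = S.cls g := by
  fin_cases e
  · simp
  · simpa using S.cls_j g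

theorem eq_of_mem_coset {l m : Fin 3} {g : G} (h : g = S.x l ∨ g = S.x l * S.j)
    (h' : g = S.x m ∨ g = S.x m * S.j) : l = m := by
  have key : ∀ l, (g = S.x l ∨ g = S.x l * S.j) → g * S.j * g⁻¹ = S.x l * S.j * (S.x l)⁻¹ := by
    rintro l (rfl | rfl)
    · rfl
    · group
  exact S.x_inj ((key l h).symm.trans (key m h'))

/-- The Kirkman triple system generated by a starter. -/
noncomputable def kts : KirkmanTripleSystem (G ⊕ Fin 3) where
  toSteinerTripleSystem := S.sts
  resolution := insert S.cls0 (Set.range S.cls)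
  nonempty_of_mem := by
    rintro P (rfl | ⟨g, rfl⟩)
    · exact ⟨_, Or.inl rfl⟩
    · exact ⟨_, Or.inl ⟨0, rfl⟩⟩
  subset_blocks := by
    rintro P (rfl | ⟨g, rfl⟩)
    · rintro X (rfl | ⟨g, rfl⟩) <;> exact ⟨_, rfl⟩
    · rintro X (⟨l, rfl⟩ | ⟨i, e, rfl⟩) <;> exact ⟨_, rfl⟩
  existsUnique_class := by
    rintro _ ⟨X, rfl⟩
    have hIF : ∀ l g Y, S.blk (.I l g) = S.blk Y → Sum.inr l ∈ S.blk Y ∧ Sum.inl g ∈ S.blk Y :=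
      fun l g Y h => by rw [← h]; simp
    have hBm : ∀ i g Y, S.blk (.B i g) = S.blk Y →
        Sum.inl (S.b i 0 * g) ∈ S.blk Y ∧ ∀ m, Sum.inr m ∉ S.blk Y :=
      fun i g Y h => by rw [← h]; simp
    cases X with
    | F =>
      refine ⟨S.cls0, ⟨Or.inl rfl, Or.inl rfl⟩, ?_⟩
      rintro P ⟨rfl | ⟨g, rfl⟩, h1⟩
      · rfl
      rcases h1 with ⟨l, e⟩ | ⟨i, e', e⟩
      · have := hIF _ _ _ e.symm; simp at this
      · have := hBm _ _ _ e.symm; simp at this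
    | A h =>
      refine ⟨S.cls0, ⟨Or.inl rfl, Or.inr ⟨h, rfl⟩⟩, ?_⟩
      rintro P ⟨rfl | ⟨g, rfl⟩, h1⟩
      · rfl
      rcases h1 with ⟨l, e⟩ | ⟨i, e', e⟩
      · have := hIF _ _ _ e.symm; simp at this
      · exact absurd e (S.A_ne_B _ _ _)
    | I l h =>
      refine ⟨S.cls ((S.x l)⁻¹ * h), ⟨Or.inr ⟨_, rfl⟩, Or.inl ⟨l, by group⟩⟩, ?_⟩
      rintro P ⟨rfl | ⟨g, rfl⟩, e | e⟩
      · have := hIF _ _ _ e; simp at this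
      · obtain ⟨g, e⟩ := e
        have := hIF _ _ _ e; simp at this
      · obtain ⟨l', e⟩ := e
        obtain ⟨h1, h2⟩ := hIF _ _ _ e
        rw [inr_mem_I] at h1
        subst h1
        rcases (S.inl_mem_I _ _ _).1 h2 with h3 | h3
        · rw [h3]; congr 1; group
        · have : (S.x l)⁻¹ * h = S.j * g := by rw [h3, c]; group
          rw [this, S.cls_j]
      · obtain ⟨i, e', e⟩ := e
        have := hIF _ _ _ e; simp at this
    | B i h =>
      refine ⟨S.cls h, ⟨Or.inr ⟨_, rfl⟩, Or.inr ⟨i, 0, by simp⟩⟩, ?_⟩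
      rintro P ⟨rfl | ⟨g, rfl⟩, e | e⟩
      · have := hBm _ _ _ e; simp at this
      · obtain ⟨g, e⟩ := e
        exact absurd e.symm (S.A_ne_B _ _ _)
      · obtain ⟨l, e⟩ := e
        exact absurd (by simp) ((hBm _ _ _ e).2 l)
      · obtain ⟨i', e', e⟩ := e
        rw [(S.B_inj e).2, S.cls_pow]
  parallel := by
    rintro P (rfl | ⟨g, rfl⟩) (z | m)
    · refine ⟨S.blk (.A z), ⟨Or.inr ⟨z, rfl⟩, by simp⟩, ?_⟩
      rintro X ⟨rfl | ⟨g, rfl⟩, h⟩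
      · simp at h
      · exact S.A_eq h
    · refine ⟨S.blk .F, ⟨Or.inl rfl, by simp⟩, ?_⟩
      rintro X ⟨rfl | ⟨g, rfl⟩, h⟩
      · rfl
      · simp at h
    · have hz : ∀ w, z = w * g ↔ z * g⁻¹ = w := fun w => by rw [mul_inv_eq_iff_eq_mul]
      have hI : ∀ l, Sum.inl z ∈ S.blk (.I l (S.x l * g)) ↔
          z * g⁻¹ = S.x l ∨ z * g⁻¹ = S.x l * S.j := fun l => by
        rw [inl_mem_I, ← hz, ← hz, c]
        simp [mul_assoc]
      have hB : ∀ i (e : Fin 2), Sum.inl z ∈ S.blk (.B i (S.j ^ (e : ℕ) * g)) ↔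
          ∃ k, z * g⁻¹ = S.b i k * S.j ^ (e : ℕ) := fun i e => by
        rw [inl_mem_B]
        exact exists_congr fun k => by rw [← mul_assoc, hz]
      by_cases hx : ∃ l, z * g⁻¹ = S.x l ∨ z * g⁻¹ = S.x l * S.j
      · obtain ⟨l, hl⟩ := hx
        refine ⟨_, ⟨Or.inl ⟨l, rfl⟩, (hI l).2 hl⟩, ?_⟩
        rintro X ⟨⟨l', rfl⟩ | ⟨i, e, rfl⟩, h⟩
        · rw [S.eq_of_mem_coset hl ((hI l').1 h)]
        · obtain ⟨k, hk⟩ := (hB i e).1 h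
          rw [hk] at hl
          have := S.pt_not i k e l
          tauto
      · simp only [not_exists, not_or] at hx
        obtain ⟨i, k, e, h1⟩ := S.pt_cov _ hx
        refine ⟨_, ⟨Or.inr ⟨i, e, rfl⟩, (hB i e).2 ⟨k, h1.symm⟩⟩, ?_⟩
        rintro X ⟨⟨l', rfl⟩ | ⟨i', e', rfl⟩, h⟩
        · have := (hI l').1 h
          have := hx l'
          tauto
        · obtain ⟨k', hk⟩ := (hB i' e').1 h
          obtain ⟨rfl, -, rfl⟩ := S.pt_inj i k i' k' e e' (h1.trans hk)
          rfl
    · refine ⟨S.blk (.I m (S.x m * g)), ⟨Or.inl ⟨m, rfl⟩, by simp⟩, ?_⟩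
      rintro X ⟨⟨l', rfl⟩ | ⟨i', e', rfl⟩, h⟩
      · rw [inr_mem_I] at h; rw [h]
      · simp at h

/-- Right translation by `g⁻¹`, fixing the points at infinity. -/
def trans : G →* Equiv.Perm (G ⊕ Fin 3) where
  toFun g := Equiv.sumCongr (Equiv.mulRight g⁻¹) (Equiv.refl _)
  map_one' := by ext (z | m) <;> simp
  map_mul' g h := by ext (z | m) <;> simp

/-- The action of a right translation on block labels. -/
def shift (g : G) : S.Idx → S.Idx
  | .F => .F
  | .A h => .A (h * g⁻¹)
  | .I l h => .I l (h * g⁻¹)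
  | .B i h => .B i (h * g⁻¹)

theorem map_blk (g : G) (X : S.Idx) :
    (S.blk X).map (trans g).toEmbedding = S.blk (S.shift g X) := by
  classical
  cases X <;> simp [blk, shift, trans, mul_assoc, Finset.map_insert]

theorem mapClass_mem (g : G) {P : Set (Finset (G ⊕ Fin 3))} (hP : P ∈ S.kts.resolution) :
    KirkmanTripleSystem.mapClass (trans g) P ∈ S.kts.resolution := by
  rcases hP with rfl | ⟨h, rfl⟩
  · left
    ext X
    simp only [KirkmanTripleSystem.mapClass, Set.mem_image]
    constructor
    · rintro ⟨_, rfl | ⟨k, rfl⟩, rfl⟩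
      · exact Or.inl (S.map_blk g .F)
      · exact Or.inr ⟨_, S.map_blk g (.A k)⟩
    · rintro (rfl | ⟨k, rfl⟩)
      · exact ⟨_, Or.inl rfl, S.map_blk g .F⟩
      · exact ⟨_, Or.inr ⟨k * g, rfl⟩, by rw [S.map_blk]; simp [shift]⟩
  · right
    refine ⟨h * g⁻¹, ?_⟩
    ext X
    simp only [KirkmanTripleSystem.mapClass, Set.mem_image]
    constructor
    · rintro (⟨l, rfl⟩ | ⟨i, e, rfl⟩)
      · exact ⟨_, Or.inl ⟨l, rfl⟩, by rw [S.map_blk]; simp [shift, mul_assoc]⟩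
      · exact ⟨_, Or.inr ⟨i, e, rfl⟩, by rw [S.map_blk]; simp [shift, mul_assoc]⟩
    · rintro ⟨_, ⟨l, rfl⟩ | ⟨i, e, rfl⟩, rfl⟩
      · exact Or.inl ⟨l, by rw [S.map_blk]; simp [shift, mul_assoc]⟩
      · exact Or.inr ⟨i, e, by rw [S.map_blk]; simp [shift, mul_assoc]⟩

theorem isAutomorphism (g : G) : S.kts.IsAutomorphism (trans g) := by
  apply Set.Subset.antisymm
  · rintro _ ⟨P, hP, rfl⟩
    exact S.mapClass_mem g hP
  · intro P hP
    refine ⟨_, S.mapClass_mem g⁻¹ hP, ?_⟩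
    unfold KirkmanTripleSystem.mapClass
    rw [Set.image_image]
    conv_rhs => rw [← Set.image_id P]
    refine Set.image_congr fun X _ => ?_
    ext v
    simp only [Finset.mem_map_equiv, id]
    rw [map_inv]
    simp [Equiv.Perm.inv_def]

theorem isPyramidal : S.kts.IsPyramidal 3 := by
  classical
  refine ⟨(trans (G := G)).range, ?_, Finset.univ.map ⟨Sum.inr, Sum.inr_injective⟩, by simp, ?_, ?_⟩
  · rintro _ ⟨g, rfl⟩
    exact S.isAutomorphism g
  · rintro _ ⟨g, rfl⟩ v hv
    obtain ⟨m, -, rfl⟩ := Finset.mem_map.1 hv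
    simp [trans]
  · rintro (z | m) (w | m') h1 h2
    · refine ⟨trans (w⁻¹ * z), ⟨⟨_, rfl⟩, by simp [trans]⟩, ?_⟩
      rintro _ ⟨⟨g, rfl⟩, hg⟩
      have h3 : z * g⁻¹ = w := by simpa [trans] using hg
      congr 1
      rw [← h3]; group
    all_goals simp at h1 h2

end ExactStarter

/-- A starter in `G` generates a 3-pyramidal Kirkman triple system with `|G| + 3` points. -/
theorem Starter.existsPyramidalKTS {G : Type} [Group G] {j : G} (h : Starter G j) :
    ExistsPyramidalKTS 3 (Nat.card G + 3) := by
  obtain ⟨S⟩ := h.exact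
  have := h.1
  have := Fintype.ofFinite G
  exact ⟨G ⊕ Fin 3, inferInstance, S.kts, by simp, S.isPyramidal⟩

/-! ### Building starters from smaller ones -/

theorem Covers.mono {G : Type} [Group G] {j : G} {D D' P P' : Set G} {n : ℕ}
    (h : Covers j D P n) (hD : D' ⊆ D) (hP : P' ⊆ P) : Covers j D' P' n := by
  obtain ⟨ι, _, b, h1, h2, h3⟩ := h
  exact ⟨ι, inferInstance, b, h1, fun d hd => h2 d (hD hd), fun p hp => h3 p (hP hp)⟩

theorem Covers.union {G : Type} [Group G] {j : G} {D D' P P' : Set G} {n n' : ℕ}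
    (h : Covers j D P n) (h' : Covers j D' P' n') : Covers j (D ∪ D') (P ∪ P') (n + n') := by
  obtain ⟨ι, _, b, h1, h2, h3⟩ := h
  obtain ⟨ι', _, b', h1', h2', h3'⟩ := h'
  refine ⟨ι ⊕ ι', inferInstance, Sum.elim b b', by simp [h1, h1'], ?_, ?_⟩
  · rintro d (hd | hd)
    · obtain ⟨i, h⟩ := h2 d hd
      exact ⟨Sum.inl i, h⟩
    · obtain ⟨i, h⟩ := h2' d hd
      exact ⟨Sum.inr i, h⟩
  · rintro p (hp | hp)
    · obtain ⟨i, h⟩ := h3 p hp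
      exact ⟨Sum.inl i, h⟩
    · obtain ⟨i, h⟩ := h3' p hp
      exact ⟨Sum.inr i, h⟩

theorem Covers.map {G G' : Type} [Group G] [Group G'] {j : G} {D P : Set G} {n : ℕ}
    (h : Covers j D P n) (φ : G →* G') : Covers (φ j) (φ '' D) (φ '' P) n := by
  obtain ⟨ι, _, b, h1, h2, h3⟩ := h
  refine ⟨ι, inferInstance, fun i k => φ (b i k), h1, ?_, ?_⟩
  · rintro _ ⟨d, hd, rfl⟩
    obtain ⟨i, k, l, hkl, e⟩ := h2 d hd
    exact ⟨i, k, l, hkl, by rw [← e]; simp⟩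
  · rintro _ ⟨p, hp, rfl⟩
    obtain ⟨i, k, e⟩ := h3 p hp
    refine ⟨i, k, e.imp (fun e => congrArg φ e) fun e => by rw [← e]; simp⟩

/-- A starter extends from a subgroup containing all involutions if the complement of the subgroup
is covered. -/
theorem Starter.extend {G G' : Type} [Group G] [Group G'] [Finite G'] {j : G} (h : Starter G j)
    (φ : G →* G') (hφ : Function.Injective φ) (hinv : ∀ g : G', g * g = 1 → g ∈ Set.range φ)
    {n : ℕ} (hn : Nat.card G' = Nat.card G + 6 * n)
    (hc : Covers (φ j) (Set.range φ)ᶜ (Set.range φ)ᶜ n) : Starter G' (φ j) := by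
  obtain ⟨hfin, jj, j_ne, a, x, m, aaa, a_ne, x_inj, inv_eq, hcard, hcov⟩ := h
  have e1 : ∀ g, φ g = 1 ↔ g = 1 := fun g => map_eq_one_iff φ hφ
  refine ⟨inferInstance, by rw [← map_mul, jj, map_one], by rwa [ne_eq, e1],
    φ a, fun l => φ (x l), m + n, by simp only [← map_mul, aaa, map_one], by rwa [ne_eq, e1],
    ?_, ?_, by rw [hn, hcard]; ring, ?_⟩
  · intro l l' hl
    simp only [← map_mul, ← map_inv] at hl
    exact x_inj (hφ hl)
  · intro g hg hg1
    obtain ⟨g, rfl⟩ := hinv g hg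
    rw [← map_mul, e1] at hg
    obtain ⟨l, rfl⟩ := inv_eq g hg (by rwa [ne_eq, e1] at hg1)
    exact ⟨l, by simp⟩
  · refine ((hcov.map φ).union hc).mono ?_ ?_
    · rintro g ⟨h1, h2, h3⟩
      by_cases hg : g ∈ Set.range φ
      · obtain ⟨g, rfl⟩ := hg
        refine Or.inl ⟨g, ⟨?_, ?_, ?_⟩, rfl⟩
        · rintro rfl; exact h1 rfl
        · rintro rfl; exact h2 (map_mul _ _ _)
        · intro h; exact h3 (by rw [← map_mul, h, map_one])
      · exact Or.inr hg
    · intro g h1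
      by_cases hg : g ∈ Set.range φ
      · obtain ⟨g, rfl⟩ := hg
        refine Or.inl ⟨g, fun l => ⟨?_, ?_⟩, rfl⟩
        · rintro rfl; exact (h1 l).1 rfl
        · rintro rfl; exact (h1 l).2 (map_mul _ _ _)
      · exact Or.inr hg

/-- A relative family over `H` and the field (or ring) `F`: it covers all of `H × F` outside
`H × {0}`, with the number of triples that makes the covering exact. -/
def RelFamily (H : Type) [Group H] (j : H) (F : Type) [Ring F] : Prop :=
  ∃ n, 6 * n + Nat.card H = Nat.card H * Nat.card F ∧
    Covers (G := H × Multiplicative F) (j, 1) {g | g.2 ≠ 1} {g | g.2 ≠ 1} n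

/-- Three units with unit differences, the multipliers of the recursive step. -/
def HasTriple (R : Type) [Ring R] : Prop :=
  ∃ a : Fin 3 → R, (∀ k, IsUnit (a k)) ∧ ∀ k l, k ≠ l → IsUnit (a k - a l)

theorem HasTriple.of_field {F : Type} [Field F] [Finite F] (h : 4 ≤ Nat.card F) :
    HasTriple F := by
  classical
  have := Fintype.ofFinite F
  have h1 : 3 ≤ (Finset.univ.erase (0 : F)).card := by
    rw [Finset.card_erase_of_mem (Finset.mem_univ _), Finset.card_univ,
      ← Nat.card_eq_fintype_card]
    omega
  obtain ⟨s, hs, hc⟩ := Finset.exists_subset_card_eq h1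
  obtain ⟨x, y, z, hxy, hxz, hyz, rfl⟩ := Finset.card_eq_three.1 hc
  have h0 : ∀ w ∈ ({x, y, z} : Finset F), w ≠ 0 := fun w hw => (Finset.mem_erase.1 (hs hw)).1
  simp only [Finset.mem_insert, Finset.mem_singleton, forall_eq_or_imp, forall_eq] at h0
  refine ⟨![x, y, z], ?_, ?_⟩
  · simp [Fin.forall_fin_succ, isUnit_iff_ne_zero, h0]
  · simp [Fin.forall_fin_succ, isUnit_iff_ne_zero, sub_eq_zero, hxy, hxz, hyz, hxy.symm,
      hxz.symm, hyz.symm]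

theorem HasTriple.prod {R F : Type} [Ring R] [Ring F] (h : HasTriple R) (h' : HasTriple F) :
    HasTriple (R × F) := by
  obtain ⟨a, h1, h2⟩ := h
  obtain ⟨a', h1', h2'⟩ := h'
  exact ⟨fun k => (a k, a' k), fun k => Prod.isUnit_iff.2 ⟨h1 k, h1' k⟩,
    fun k l hkl => Prod.isUnit_iff.2 ⟨h2 k l hkl, h2' k l hkl⟩⟩

/-- A starter in `H × R` extends to `H × (R × F)`: the triples of a relative family over `F` are
repeated for every `r` in `R`, with `a k * r` as the coordinate in `R` of the `k`-th point. As the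
`a k` and their differences are units, every element of `R` occurs as often as it should. -/
theorem Starter.step {H R F : Type} [Group H] [Ring R] [Ring F] [Finite R] [Finite F] {j : H}
    (h : Starter (H × Multiplicative R) (j, 1)) (hR : HasTriple R) (hF : RelFamily H j F)
    (h2 : ∀ y : F, y + y = 0 → y = 0) : Starter (H × Multiplicative (R × F)) (j, 1) := by
  have : Finite H := by
    have := h.1
    exact Finite.of_surjective (Prod.fst : H × Multiplicative R → H) Prod.fst_surjective
  obtain ⟨n, hn, ι, _, b, hι, hD, hP⟩ := hF
  obtain ⟨a, ha, haa⟩ := hR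
  have := Fintype.ofFinite R
  let φ : H × Multiplicative R →* H × Multiplicative (R × F) :=
    MonoidHom.prodMap (MonoidHom.id H) (AddMonoidHom.inl R F).toMultiplicative
  have hφ : ∀ g : H × Multiplicative R, φ g = (g.1, Multiplicative.ofAdd (g.2.toAdd, 0)) :=
    fun g => rfl
  have hr : ∀ g : H × Multiplicative (R × F), g ∉ Set.range φ → g.2.toAdd.2 ≠ 0 := by
    intro g hg h0
    exact hg ⟨(g.1, Multiplicative.ofAdd g.2.toAdd.1), by rw [hφ]; simp [← h0]⟩
  have e : φ (j, 1) = (j, 1) := rfl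
  rw [← e]
  have c2 : Nat.card (Multiplicative R) = Nat.card R := rfl
  have c3 : Nat.card (Multiplicative (R × F)) = Nat.card R * Nat.card F := Nat.card_prod R F
  refine h.extend φ ?_ ?_ (n := n * Nat.card R) ?_ ?_
  · intro g g' hg
    simp only [hφ, Prod.mk.injEq] at hg
    have h3 := congrArg (fun y => (Multiplicative.toAdd y).1) hg.2
    exact Prod.ext hg.1 h3
  · intro g hg
    by_contra hg'
    apply hr g hg'
    apply h2
    have h3 := congrArg (fun y => (Multiplicative.toAdd (Prod.snd y)).2) hg
    exact h3
  · rw [Nat.card_prod, Nat.card_prod, c2, c3]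
    have := congrArg (· * Nat.card R) hn
    simp only [add_mul] at this
    linarith
  · refine ⟨ι × R, inferInstance, fun i k => ((b i.1 k).1,
      Multiplicative.ofAdd (a k * i.2, (b i.1 k).2.toAdd)), by
        rw [Fintype.card_prod, hι, Nat.card_eq_fintype_card], ?_, ?_⟩
    · intro d hd
      obtain ⟨i, k, l, hkl, e⟩ := hD (d.1, Multiplicative.ofAdd d.2.toAdd.2) (hr d hd)
      obtain ⟨u, hu⟩ := haa k l hkl
      refine ⟨(i, ↑u⁻¹ * d.2.toAdd.1), k, l, hkl, ?_⟩
      have e1 := congrArg Prod.fst e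
      have e2 := congrArg (fun y => (Multiplicative.toAdd (Prod.snd y))) e
      refine Prod.ext e1 (Prod.ext ?_ e2)
      change a k * (↑u⁻¹ * d.2.toAdd.1) + -(a l * (↑u⁻¹ * d.2.toAdd.1)) = d.2.toAdd.1
      rw [← sub_eq_add_neg, ← sub_mul, ← hu, Units.mul_inv_cancel_left]
    · intro p hp
      obtain ⟨i, k, e⟩ := hP (p.1, Multiplicative.ofAdd p.2.toAdd.2) (hr p hp)
      obtain ⟨u, hu⟩ := ha k
      refine ⟨(i, ↑u⁻¹ * p.2.toAdd.1), k, ?_⟩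
      refine e.imp (fun e => ?_) fun e => ?_
      · have e1 := congrArg Prod.fst e
        have e2 := congrArg (fun y => (Multiplicative.toAdd (Prod.snd y))) e
        refine Prod.ext e1 (Prod.ext ?_ e2)
        change a k * (↑u⁻¹ * p.2.toAdd.1) = p.2.toAdd.1
        rw [← hu, Units.mul_inv_cancel_left]
      · have e1 := congrArg Prod.fst e
        have e2 := congrArg (fun y => (Multiplicative.toAdd (Prod.snd y))) e
        refine Prod.ext e1 (Prod.ext ?_ e2)
        change a k * (↑u⁻¹ * p.2.toAdd.1) + 0 = p.2.toAdd.1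
        rw [← hu, Units.mul_inv_cancel_left, add_zero]

/-- There is a ring `R` of order `N` such that `H × R` has a starter which can be extended
further. -/
def Reach (H : Type) [Group H] (j : H) (N : ℕ) : Prop :=
  ∃ (R : Type) (_ : CommRing R), Finite R ∧ Nat.card R = N ∧ HasTriple R ∧
    Starter (H × Multiplicative R) (j, 1)

theorem Reach.existsPyramidalKTS {H : Type} [Group H] {j : H} {N : ℕ} (h : Reach H j N) :
    ExistsPyramidalKTS 3 (Nat.card H * N + 3) := by
  obtain ⟨R, _, _, rfl, -, h⟩ := h
  have := h.existsPyramidalKTS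
  rwa [Nat.card_prod] at this

theorem Starter.reach_one {H : Type} [Group H] {j : H} (h : Starter H j) : Reach H j 1 := by
  have := h.1
  refine ⟨PUnit, inferInstance, inferInstance, by simp, ⟨0, ?_⟩, ?_⟩
  · exact ⟨fun _ => isUnit_of_subsingleton _, fun _ _ _ => isUnit_of_subsingleton _⟩
  · have hr : ∀ g : H × Multiplicative PUnit,
        g ∈ Set.range (MonoidHom.inl H (Multiplicative PUnit)) :=
      fun g => ⟨g.1, rfl⟩
    refine h.extend (MonoidHom.inl H (Multiplicative PUnit)) (fun g g' h => congrArg Prod.fst h)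
      (fun g _ => hr g) (n := 0) ?_ ⟨Empty, inferInstance, Empty.elim, rfl, ?_, ?_⟩
    · rw [Nat.card_prod]
      have : Nat.card (Multiplicative PUnit) = 1 := Nat.card_unique
      rw [this]; ring
    · intro d hd; exact absurd (hr d) hd
    · intro d hd; exact absurd (hr d) hd

theorem Reach.mul_field {H F : Type} [Group H] {j : H} {N : ℕ} (h : Reach H j N) [Field F]
    [Finite F] (h4 : 4 ≤ Nat.card F) (h2 : (2 : F) ≠ 0) (hF : RelFamily H j F) :
    Reach H j (N * Nat.card F) := by
  obtain ⟨R, _, _, rfl, h3, h⟩ := h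
  refine ⟨R × F, inferInstance, inferInstance, Nat.card_prod R F,
    h3.prod (HasTriple.of_field h4), h.step h3 hF fun y hy => ?_⟩
  rw [← two_mul] at hy
  exact (mul_eq_zero.1 hy).resolve_left h2

/-- Relative families exist over all finite fields of odd characteristic containing a square root
of `-1`. -/
def HasI (H : Type) [Group H] (j : H) : Prop :=
  ∀ (F : Type) [Field F] [Finite F] (i : F), i * i = -1 → (2 : F) ≠ 0 → RelFamily H j F

theorem two_ne_zero_of_card {F : Type} [Field F] [Finite F] (h : Odd (Nat.card F)) :
    (2 : F) ≠ 0 := by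
  have := Fintype.ofFinite F
  intro h0
  have h1 : ringChar F = 2 := by
    have h2 : ringChar F ∣ 2 := (ringChar.spec F 2).1 (by exact_mod_cast h0)
    rcases (Nat.dvd_prime Nat.prime_two).1 h2 with h3 | h3
    · exact absurd h3 (CharP.ringChar_ne_one)
    · exact h3
  have h3 := FiniteField.even_card_of_char_two h1
  rw [Nat.card_eq_fintype_card, Nat.odd_iff] at h
  omega

/-- In a field of order `1` modulo `4` the element `-1` is a square. -/
theorem HasI.rel {H : Type} [Group H] {j : H} (h : HasI H j) {F : Type} [Field F] [Finite F]
    (hF : Nat.card F % 4 = 1) : RelFamily H j F := by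
  have := Fintype.ofFinite F
  have h1 : IsSquare (-1 : F) := by
    rw [FiniteField.isSquare_neg_one_iff, ← Nat.card_eq_fintype_card]; omega
  obtain ⟨i, hi⟩ := h1
  exact h F i hi.symm (two_ne_zero_of_card (by rw [Nat.odd_iff]; omega))

/-- Multiplying up primes from `OK` and squares of odd primes reaches every odd number all of whose
odd-exponent primes are in `OK`. -/
theorem reach_of_factorization {H : Type} [Group H] {j : H} (h1 : Starter H j) (hI : HasI H j)
    (OK : ℕ → Prop) (hOK : ∀ p [Fact p.Prime], OK p → 5 ≤ p ∧ RelFamily H j (ZMod p))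
    (N : ℕ) (hN : Odd N)
    (hp : ∀ p, p.Prime → Odd (N.factorization p) → OK p) : Reach H j N := by
  induction N using Nat.strong_induction_on with
  | _ N ih =>
    by_cases hN1 : N = 1
    · subst hN1; exact h1.reach_one
    have hN0 : N ≠ 0 := by rintro rfl; simp at hN
    have hpr := Nat.minFac_prime hN1
    obtain ⟨p, hpdef⟩ : ∃ p, p = N.minFac := ⟨_, rfl⟩
    rw [← hpdef] at hpr
    have hF : Fact p.Prime := ⟨hpr⟩
    have hpodd : Odd p := hN.of_dvd_nat (hpdef ▸ Nat.minFac_dvd N)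
    have hp3 : 3 ≤ p := by
      have := hpr.two_le
      rcases hpodd with ⟨k, hk⟩
      omega
    by_cases h2 : p * p ∣ N
    · obtain ⟨M, rfl⟩ := h2
      have hM0 : M ≠ 0 := by rintro rfl; simp at hN0
      have hM : Reach H j M := by
        refine ih M ?_ (Nat.odd_mul.1 hN).2 fun q hq hodd => hp q hq ?_
        · exact lt_mul_of_one_lt_left (Nat.pos_of_ne_zero hM0) (by nlinarith)
        · rw [Nat.factorization_mul (by positivity) hM0,
            Nat.factorization_mul hpr.ne_zero hpr.ne_zero]
          simp only [Finsupp.add_apply]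
          exact Even.add_odd ⟨_, rfl⟩ hodd
      have hcard : Nat.card (GaloisField p 2) = p * p := by
        rw [GaloisField.card p 2 (by norm_num), sq]
      have hodd2 : p * p % 4 = 1 := by
        rcases hpodd with ⟨k, hk⟩
        rw [hk, show (2 * k + 1) * (2 * k + 1) = 4 * (k * k + k) + 1 by ring]
        omega
      have := hM.mul_field (F := GaloisField p 2) (by rw [hcard]; nlinarith)
        (two_ne_zero_of_card (by rw [hcard]; exact hpodd.mul hpodd))
        (hI.rel (by rw [hcard]; exact hodd2))
      rwa [hcard, mul_comm] at this
    · obtain ⟨M, hM⟩ := Nat.minFac_dvd N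
      rw [← hpdef] at hM
      have hM0 : M ≠ 0 := by rintro rfl; simp at hM; omega
      have hf : ∀ q, N.factorization q = p.factorization q + M.factorization q := by
        intro q
        conv_lhs => rw [hM]
        rw [Nat.factorization_mul hpr.ne_zero hM0]; rfl
      have hpM : ¬ p ∣ M := by
        rintro ⟨M', rfl⟩
        exact h2 ⟨M', by rw [hM]; ring⟩
      have hMp : M.factorization p = 0 := Nat.factorization_eq_zero_of_not_dvd hpM
      have hr : Reach H j M := by
        refine ih M ?_ (by rw [hM] at hN; exact (Nat.odd_mul.1 hN).2) fun q hq hodd => hp q hq ?_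
        · nlinarith [Nat.pos_of_ne_zero hM0]
        · have hqp : q ≠ p := by rintro rfl; rw [hMp] at hodd; simp at hodd
          rw [hf, Nat.Prime.factorization hpr, Finsupp.single_eq_of_ne hqp, zero_add]
          exact hodd
      obtain ⟨h5, hrel⟩ := hOK p (hp p hpr (by
        rw [hf, hMp, Nat.Prime.factorization hpr]; simp))
      have hcard : Nat.card (ZMod p) = p := Nat.card_zmod p
      have := hr.mul_field (F := ZMod p) (by rw [hcard]; omega)
        (two_ne_zero_of_card (by rwa [hcard])) hrel
      rwa [hcard, mul_comm, ← hM] at this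

/-! ### The semidirect products `ℤ[ω]/(q) ⋊ U` -/

/-- Multiplication by `ω` on `A[ω] = A ⊕ A ω`, where `ω² + ω + 1 = 0` and the pair `(a, b)` stands
for `a + b ω`. -/
def rot {A : Type} [AddCommGroup A] (t : A × A) : A × A := (-t.2, t.1 - t.2)

/-- Multiplication by `ω ^ k` on `A[ω]`. -/
def rotn {A : Type} [AddCommGroup A] (k : ZMod 3) (t : A × A) : A × A :=
  if k = 0 then t else if k = 1 then rot t else rot (rot t)

section rotn

variable {A : Type} [AddCommGroup A]

theorem rot_add (t t' : A × A) : rot (t + t') = rot t + rot t' := by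
  ext <;> simp [rot] <;> abel

theorem rot_rot_rot (t : A × A) : rot (rot (rot t)) = t := by
  ext <;> simp only [rot] <;> abel

@[simp] theorem rotn_zero (t : A × A) : rotn 0 t = t := by simp [rotn]

theorem rotn_one (t : A × A) : rotn 1 t = rot t := by
  have h : (1 : ZMod 3) ≠ 0 := by decide
  simp [rotn, h]

theorem rotn_add (k : ZMod 3) (t t' : A × A) : rotn k (t + t') = rotn k t + rotn k t' := by
  unfold rotn
  split_ifs <;> simp only [rot_add]

theorem rotn_rotn (k l : ZMod 3) (t : A × A) : rotn k (rotn l t) = rotn (k + l) t := by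
  have h : ∀ k : ZMod 3, k = 0 ∨ k = 1 ∨ k = 2 := by decide
  have e1 : (1 : ZMod 3) ≠ 0 := by decide
  have e2 : (2 : ZMod 3) ≠ 0 := by decide
  have e3 : (2 : ZMod 3) ≠ 1 := by decide
  have e4 : (1 + 1 : ZMod 3) = 2 := by decide
  have e5 : (1 + 2 : ZMod 3) = 0 := by decide
  have e6 : (2 + 1 : ZMod 3) = 0 := by decide
  have e7 : (2 + 2 : ZMod 3) = 1 := by decide
  rcases h k with rfl | rfl | rfl <;> rcases h l with rfl | rfl | rfl <;>
    simp only [rotn, e1, e2, e3, e4, e5, e6, e7, add_zero, zero_add, if_true, if_false,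
      rot_rot_rot]

@[simp] theorem rotn_apply_zero (k : ZMod 3) : rotn k (0 : A × A) = 0 := by
  have := rotn_add k (0 : A × A) 0
  simpa using this

theorem rotn_neg (k : ZMod 3) (t : A × A) : rotn k (-t) = -rotn k t := by
  rw [eq_neg_iff_add_eq_zero, ← rotn_add]; simp

theorem rotn_sub (k : ZMod 3) (t t' : A × A) : rotn k (t - t') = rotn k t - rotn k t' := by
  rw [sub_eq_add_neg, rotn_add, rotn_neg, ← sub_eq_add_neg]

theorem rotn_prodMap {B : Type} [AddCommGroup B] (f : A →+ B) (k : ZMod 3) (t : A × A) :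
    rotn k (Prod.map f f t) = Prod.map f f (rotn k t) := by
  unfold rotn rot
  split_ifs <;> simp

end rotn

/-- A homomorphism `lev` to `ℤ/3`, through which `U` acts on `ℤ[ω]/(q)`: `u` acts as multiplication
by `ω ^ lev u`. -/
class Level (U : Type) [AddCommGroup U] where
  lev : U →+ ZMod 3

/-- The semidirect product of `A[ω]` and `U`, where `u` acts as multiplication by `ω ^ lev u`. -/
@[ext] structure Sd (A U : Type) where
  t : A × A
  u : U

namespace Sd

variable {A U : Type} [AddCommGroup A] [AddCommGroup U] [Level U]

instance : Mul (Sd A U) := ⟨fun x y => ⟨x.t + rotn (Level.lev x.u) y.t, x.u + y.u⟩⟩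
instance : One (Sd A U) := ⟨⟨0, 0⟩⟩
instance : Inv (Sd A U) := ⟨fun x => ⟨-rotn (-Level.lev x.u) x.t, -x.u⟩⟩

@[simp] theorem mul_t (x y : Sd A U) : (x * y).t = x.t + rotn (Level.lev x.u) y.t := rfl
@[simp] theorem mul_u (x y : Sd A U) : (x * y).u = x.u + y.u := rfl
omit [Level U] in
@[simp] theorem one_t : (1 : Sd A U).t = 0 := rfl
omit [Level U] in
@[simp] theorem one_u : (1 : Sd A U).u = 0 := rfl
@[simp] theorem inv_t (x : Sd A U) : x⁻¹.t = -rotn (-Level.lev x.u) x.t := rfl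
@[simp] theorem inv_u (x : Sd A U) : x⁻¹.u = -x.u := rfl

instance : Group (Sd A U) :=
  Group.ofLeftAxioms
    (fun x y z => by
      apply Sd.ext
      · simp [rotn_add, rotn_rotn, add_assoc]
      · simp [add_assoc])
    (fun x => by
      apply Sd.ext <;> simp)
    (fun x => by
      apply Sd.ext <;> simp)

/-- The underlying set of the semidirect product. -/
def equivProd : Sd A U ≃ (A × A) × U where
  toFun x := (x.t, x.u)
  invFun x := ⟨x.1, x.2⟩
  left_inv _ := rfl
  right_inv _ := rfl

instance [DecidableEq A] [DecidableEq U] : DecidableEq (Sd A U) := equivProd.decidableEq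

instance [Fintype A] [Fintype U] : Fintype (Sd A U) := Fintype.ofEquiv _ equivProd.symm

end Sd

instance {m m' : ℕ} [h : Fact (3 ∣ m)] : Level (ZMod m × ZMod m') :=
  ⟨(ZMod.castHom h.1 (ZMod 3)).toAddMonoidHom.comp (AddMonoidHom.fst _ _)⟩

instance : Fact (3 ∣ 3) := ⟨dvd_rfl⟩
instance : Fact (3 ∣ 9) := ⟨⟨3, rfl⟩⟩

/-! ### Verifying coverings by computation -/

/-- An injective numbering of a finite type by numbers below `size`. -/
class Coded (α : Type) where
  size : ℕ
  code : α → ℕ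
  code_lt : ∀ a, code a < size
  code_inj : Function.Injective code

instance {n : ℕ} [NeZero n] : Coded (ZMod n) := ⟨n, ZMod.val, ZMod.val_lt, ZMod.val_injective n⟩

instance : Coded Bool := ⟨2, Bool.toNat, Bool.toNat_lt, by decide⟩

/-- A numbering of a product from a numbering of the first factor and an injective function on
the second. -/
def pairCode {α β : Type} [Coded α] (f : β → ℕ) (x : α × β) : ℕ :=
  Coded.code x.1 + Coded.size α * f x.2

theorem pairCode_inj {α β : Type} [Coded α] {f : β → ℕ} (hf : Function.Injective f) :
    Function.Injective (pairCode (α := α) f) := by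
  rintro ⟨a, b⟩ ⟨a', b'⟩ h
  have h1 := Coded.code_lt a
  have h2 := Coded.code_lt a'
  have h0 : 0 < Coded.size α := by omega
  simp only [pairCode] at h
  have h3 := congrArg (· % Coded.size α) h
  have h4 := congrArg (· / Coded.size α) h
  simp only [Nat.add_mul_mod_self_left, Nat.mod_eq_of_lt, h1, h2] at h3
  simp only [Nat.add_mul_div_left _ _ h0, Nat.div_eq_of_lt, h1, h2, zero_add] at h4
  rw [Coded.code_inj h3, hf h4]

instance {α β : Type} [Coded α] [Coded β] : Coded (α × β) where
  size := Coded.size α * Coded.size β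
  code := pairCode Coded.code
  code_lt x := by
    have h1 := Coded.code_lt x.1
    have h2 := Coded.code_lt x.2
    simp only [pairCode]
    nlinarith
  code_inj := pairCode_inj Coded.code_inj

instance {A U : Type} [Coded A] [Coded U] : Coded (Sd A U) where
  size := Coded.size ((A × A) × U)
  code x := Coded.code (x.t, x.u)
  code_lt x := Coded.code_lt (x.t, x.u)
  code_inj x y h := by
    have := Coded.code_inj h
    simp only [Prod.mk.injEq] at this
    exact Sd.ext this.1 this.2

/-- The set of codes of the members of a list, as the binary digits of a number. -/
def mask {α : Type} (f : α → ℕ) : List α → ℕ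
  | [] => 0
  | x :: l => mask f l ||| 2 ^ f x

/-- Membership in a list can be read off from the bit mask of the codes of its entries. -/
theorem mem_of_testBit_mask {α : Type} {f : α → ℕ} (hf : Function.Injective f) {l : List α} {x : α}
    (h : (mask f l).testBit (f x) = true) : x ∈ l := by
  induction l with
  | nil => simp [mask] at h
  | cons y l ih =>
    simp only [mask, Nat.testBit_or, Bool.or_eq_true, Nat.testBit_two_pow, decide_eq_true_eq] at h
    rcases h with h | h
    · exact List.mem_cons_of_mem _ (ih h)
    · rw [hf h]; exact List.mem_cons_self

/-- The differences of a list of triples with respect to a difference function `d`. -/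
def diffs {α β : Type} (d : α → α → β) : List (α × α × α) → List β
  | [] => []
  | (x, y, z) :: l => d x y :: d y z :: d z x :: d y x :: d z y :: d x z :: diffs d l

/-- The points of a list of triples. -/
def points {α : Type} : List (α × α × α) → List α
  | [] => []
  | (x, y, z) :: l => x :: y :: z :: points l

/-- The entries of a triple. -/
def nth {α : Type} (b : α × α × α) (k : Fin 3) : α := ![b.1, b.2.1, b.2.2] k

theorem exists_of_mem_diffs {α β : Type} {d : α → α → β} {L : List (α × α × α)} {v : β}
    (h : v ∈ diffs d L) : ∃ i : Fin L.length, ∃ k l, k ≠ l ∧ d (nth L[i] k) (nth L[i] l) = v := by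
  induction L with
  | nil => simp [diffs] at h
  | cons b L ih =>
    obtain ⟨x, y, z⟩ := b
    simp only [diffs, List.mem_cons] at h
    rcases h with rfl | rfl | rfl | rfl | rfl | rfl | h
    · exact ⟨⟨0, by simp⟩, 0, 1, by decide, rfl⟩
    · exact ⟨⟨0, by simp⟩, 1, 2, by decide, rfl⟩
    · exact ⟨⟨0, by simp⟩, 2, 0, by decide, rfl⟩
    · exact ⟨⟨0, by simp⟩, 1, 0, by decide, rfl⟩
    · exact ⟨⟨0, by simp⟩, 2, 1, by decide, rfl⟩
    · exact ⟨⟨0, by simp⟩, 0, 2, by decide, rfl⟩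
    · obtain ⟨i, k, l, hkl, e⟩ := ih h
      exact ⟨⟨i + 1, by simp⟩, k, l, hkl, by simpa using e⟩

theorem exists_of_mem_points {α : Type} {L : List (α × α × α)} {v : α}
    (h : v ∈ points L) : ∃ i : Fin L.length, ∃ k, nth L[i] k = v := by
  induction L with
  | nil => simp [points] at h
  | cons b L ih =>
    obtain ⟨x, y, z⟩ := b
    simp only [points, List.mem_cons] at h
    rcases h with rfl | rfl | rfl | h
    · exact ⟨⟨0, by simp⟩, 0, rfl⟩
    · exact ⟨⟨0, by simp⟩, 1, rfl⟩
    · exact ⟨⟨0, by simp⟩, 2, rfl⟩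
    · obtain ⟨i, k, e⟩ := ih h
      exact ⟨⟨i + 1, by simp⟩, k, by simpa using e⟩

/-- A list of base triples covers `D` and `P` if the bit masks of its differences and of its points
contain the codes of all elements of `D` and `P`. -/
theorem covers_of_mask {G : Type} [Group G] [Coded G] (j : G) (D P : G → Prop)
    (L : List (G × G × G))
    (hD : ∀ d, D d → (mask Coded.code (diffs (fun x y => x * y⁻¹) L)).testBit (Coded.code d))
    (hP : ∀ p, P p → (mask Coded.code (points L)).testBit (Coded.code p) ∨
      (mask Coded.code (points L)).testBit (Coded.code (p * j))) (hj : j * j = 1) :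
    Covers j {g | D g} {g | P g} L.length := by
  refine ⟨Fin L.length, inferInstance, fun i => nth L[i], by simp, ?_, ?_⟩
  · intro d hd
    obtain ⟨i, k, l, hkl, e⟩ := exists_of_mem_diffs
      (mem_of_testBit_mask Coded.code_inj (hD d hd))
    exact ⟨i, k, l, hkl, e⟩
  · intro p hp
    rcases hP p hp with h | h
    · obtain ⟨i, k, e⟩ := exists_of_mem_points (mem_of_testBit_mask Coded.code_inj h)
      exact ⟨i, k, Or.inl e⟩
    · obtain ⟨i, k, e⟩ := exists_of_mem_points (mem_of_testBit_mask Coded.code_inj h)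
      refine ⟨i, k, Or.inr ?_⟩
      simp only
      rw [e, mul_assoc, hj, mul_one]

theorem starter_of_mask {G : Type} [Group G] [Coded G] [Fintype G] (j a : G)
    (x : Fin 3 → G) (L : List (G × G × G)) (hcard : Nat.card G = 6 * L.length + 6)
    (hj : j * j = 1 ∧ j ≠ 1) (ha : a * a * a = 1 ∧ a ≠ 1)
    (hx : ∀ l m, x l * j * (x l)⁻¹ = x m * j * (x m)⁻¹ → l = m)
    (hinv : ∀ g : G, g * g = 1 → g ≠ 1 → ∃ l, g = x l * j * (x l)⁻¹)
    (hD : ∀ d, (d ≠ a ∧ d ≠ a * a ∧ d * d ≠ 1) →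
      (mask Coded.code (diffs (fun x y => x * y⁻¹) L)).testBit (Coded.code d))
    (hP : ∀ p, (∀ l, p ≠ x l ∧ p ≠ x l * j) → (mask Coded.code (points L)).testBit (Coded.code p) ∨
      (mask Coded.code (points L)).testBit (Coded.code (p * j))) : Starter G j :=
  ⟨inferInstance, hj.1, hj.2, a, x, L.length, ha.1, ha.2, fun l m h => hx l m h, hinv, hcard,
    covers_of_mask j _ _ L hD hP hj.1⟩

/-- The semidirect product `ℤ[ω]/(q) ⋊ (ℤ/m × ℤ/m')`, in which `ℤ/m` acts through `ω`. -/
abbrev Grp (q m m' : ℕ) : Type := Sd (ZMod q) (ZMod m × ZMod m')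

/-- The element whose coordinates are the four last decimal digits of `n`. -/
def el {q m m' : ℕ} (n : ℕ) : Grp q m m' :=
  ⟨(((n / 1000 % 10 : ℕ) : ZMod q), ((n / 100 % 10 : ℕ) : ZMod q)),
    (((n / 10 % 10 : ℕ) : ZMod m), ((n % 10 : ℕ) : ZMod m'))⟩

/-- Apply a function to all entries of a list of triples. -/
def mapTriples {α β : Type} (f : α → β) (L : List (α × α × α)) : List (β × β × β) :=
  L.map fun b => (f b.1, f b.2.1, f b.2.2)

/-! ### Starters in small groups

The entries of the tables are read digit by digit by `el`; the involution `j` is `el 1000` over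
`ℤ[ω]/(2)`, `el 2000` over `ℤ[ω]/(4)` and `el 4000` over `ℤ[ω]/(8)`. -/

theorem starter_2_3_1 : Starter (Grp 2 3 1) (el 1000) :=
  starter_of_mask _ (el 10) ![el 0, el 1010, el 20] (mapTriples el [(10, 100, 120)])
    (by simp [Nat.card_eq_fintype_card]; decide +kernel) (by decide +kernel) (by decide +kernel)
    (by decide +kernel) (by decide +kernel) (by decide +kernel) (by decide +kernel)

theorem starter_2_9_1 : Starter (Grp 2 9 1) (el 1000) :=
  starter_of_mask _ (el 30) ![el 0, el 10, el 20] (mapTriples el [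
    (50, 1170, 1160), (40, 80, 1010), (1040, 1060, 1130), (1020, 100, 150), (180, 170, 30)])
    (by simp [Nat.card_eq_fintype_card]; decide +kernel) (by decide +kernel) (by decide +kernel)
    (by decide +kernel) (by decide +kernel) (by decide +kernel) (by decide +kernel)

theorem starter_2_9_3 : Starter (Grp 2 9 3) (el 1000) :=
  starter_of_mask _ (el 30) ![el 32, el 1070, el 151] (mapTriples el [
    (161, 80, 162), (30, 1040, 1160), (1, 1152, 132), (10, 131, 1130), (0, 112, 1102),
    (180, 1101, 1121), (11, 51, 1100), (82, 1111, 2), (1010, 1062, 1150), (61, 172, 22),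
    (40, 181, 1022), (81, 120, 182), (150, 141, 1012), (31, 170, 60), (20, 1172, 142),
    (152, 1071, 1141), (1042, 71, 121)])
    (by simp [Nat.card_eq_fintype_card]; decide +kernel) (by decide +kernel) (by decide +kernel)
    (by decide +kernel) (by decide +kernel) (by decide +kernel) (by decide +kernel)

theorem starter_4_3_1 : Starter (Grp 4 3 1) (el 2000) :=
  starter_of_mask _ (el 10) ![el 0, el 10, el 20] (mapTriples el [
    (2100, 3210, 1120), (1010, 3110, 2310), (3300, 2210, 220), (320, 3000, 3220),
    (1310, 120, 300), (2200, 110, 3200), (1320, 1100, 1220)])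
    (by simp [Nat.card_eq_fintype_card]; decide +kernel) (by decide +kernel) (by decide +kernel)
    (by decide +kernel) (by decide +kernel) (by decide +kernel) (by decide +kernel)

theorem starter_4_9_1 : Starter (Grp 4 9 1) (el 2000) :=
  starter_of_mask _ (el 30) ![el 0, el 10, el 20] (mapTriples el [
    (30, 1050, 250), (1070, 240, 3220), (1120, 2260, 3130), (2040, 2370, 300), (1100, 1200, 3040),
    (120, 1260, 2270), (1330, 200, 2100), (1040, 2340, 2380), (1010, 170, 2180),
    (110, 1000, 2350), (230, 3310, 340), (1180, 80, 1360), (360, 3170, 3080), (1350, 1220, 3280),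
    (3010, 2120, 1030), (280, 1370, 1140), (1250, 3270, 3060), (1150, 2310, 1310),
    (60, 2330, 2150), (3140, 160, 1320), (220, 3230, 1380), (50, 130, 3160), (2010, 1300, 270)])
    (by simp [Nat.card_eq_fintype_card]; decide +kernel) (by decide +kernel) (by decide +kernel)
    (by decide +kernel) (by decide +kernel) (by decide +kernel) (by decide +kernel)

/-- A family covering the elements of `ℤ[ω]/(8) ⋊ ℤ/3` outside the subgroup `2 ℤ[ω]/(8) ⋊ ℤ/3`. -/
theorem layer_8_3_1 : Covers (G := Grp 8 3 1) (el 4000)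
    {g | ¬(g.t.1.val % 2 = 0 ∧ g.t.2.val % 2 = 0)}
    {g | ¬(g.t.1.val % 2 = 0 ∧ g.t.2.val % 2 = 0)} 24 :=
  covers_of_mask _ _ _ (mapTriples el [
    (6110, 5110, 4120), (110, 7420, 1300), (700, 7100, 7600), (1600, 7500, 1020),
    (1010, 7020, 1520), (7010, 5400, 3110), (3320, 7310, 5010), (1120, 7210, 4100),
    (3310, 120, 3120), (2720, 5200, 500), (1720, 3300, 1620), (1220, 5500, 4110),
    (2520, 7510, 7320), (6310, 6500, 3210), (3220, 6720, 4710), (1100, 2300, 3520),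
    (2310, 7700, 300), (2110, 2700, 1610), (1320, 6520, 5020), (1110, 3010, 3200),
    (1310, 1000, 320), (5310, 710, 5700), (5210, 7000, 6100), (720, 3620, 3400)])
    (by decide +kernel) (by decide +kernel) (by decide +kernel)

/-- A family covering the elements of `ℤ[ω]/(8) ⋊ ℤ/9` outside the subgroup `2 ℤ[ω]/(8) ⋊ ℤ/9`. -/
theorem layer_8_9_1 : Covers (G := Grp 8 9 1) (el 4000)
    {g | ¬(g.t.1.val % 2 = 0 ∧ g.t.2.val % 2 = 0)}
    {g | ¬(g.t.1.val % 2 = 0 ∧ g.t.2.val % 2 = 0)} 72 :=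
  covers_of_mask _ _ _ (mapTriples el [
    (1180, 3700, 4300), (3330, 1340, 6740), (5760, 1570, 6570), (1110, 7320, 320),
    (3500, 2170, 530), (7350, 4330, 4780), (5770, 4550, 6310), (3130, 2510, 4160),
    (1600, 4360, 6320), (3460, 6530, 2580), (3070, 2540, 2100), (5240, 4310, 2360),
    (6540, 5360, 5050), (2780, 7710, 3600), (4120, 3140, 5630), (6160, 5780, 5470),
    (2550, 3680, 4770), (2710, 7040, 2730), (2330, 7060, 6350), (780, 1420, 510),
    (5000, 550, 5540), (5420, 4170, 1560), (7670, 730, 3520), (1200, 2150, 7740),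
    (5530, 6760, 1550), (3770, 4510, 5300), (3710, 540, 1330), (1350, 6580, 7170),
    (6510, 5040, 1310), (6700, 1230, 1100), (4180, 3020, 3380), (170, 3010, 7770),
    (1470, 1750, 2500), (7400, 5170, 4320), (3050, 5130, 370), (1670, 3550, 100),
    (3110, 4350, 5260), (7720, 6560, 3670), (5180, 130, 3440), (3100, 340, 1650),
    (5220, 4340, 4520), (7070, 500, 6770), (1400, 6720, 4700), (5450, 2770, 350),
    (7550, 5650, 3240), (3170, 5670, 7260), (7730, 5430, 5620), (1150, 3250, 1040),
    (5410, 7030, 3740), (1210, 5030, 7140), (7480, 5210, 1720), (3280, 3210, 5120),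
    (5060, 4560, 7210), (1080, 4580, 3630), (7240, 2340, 1680), (1660, 760, 1410),
    (1320, 7160, 3450), (5380, 3530, 7020), (1500, 5340, 7230), (5160, 5310, 3200),
    (5730, 1370, 310), (3760, 5510, 4140), (7110, 3350, 6780), (1140, 7180, 2120),
    (3480, 2520, 7380), (7620, 2350, 3120), (3660, 2300, 3560), (3000, 6130, 3300),
    (1120, 1240, 1280), (7580, 7010, 7250), (5700, 7220, 1460), (7360, 1480, 3430)])
    (by decide +kernel) (by decide +kernel) (by decide +kernel)

/-! ### Relative families from roots of unity -/

/-- Multiplication by `ρ` on `ℤ[ρ]`, where `ρ² = s ρ - 1` and `(a, b)` stands for `a + b ρ`. -/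
def rootMul (s : ℤ) (x : ℤ × ℤ) : ℤ × ℤ := (-x.2, x.1 + s * x.2)

/-- The value of the pair `(a, b)` at `ρ`, namely `a + b ρ`. -/
def ev {F : Type} [Field F] (ρ : F) (x : ℤ × ℤ) : F := x.1 + x.2 * ρ

theorem ev_sub {F : Type} [Field F] (ρ : F) (x y : ℤ × ℤ) : ev ρ (x - y) = ev ρ x - ev ρ y := by
  simp [ev]; ring

theorem ev_rootMul {F : Type} [Field F] {ρ : F} {s : ℤ} (h : ρ * ρ = s * ρ - 1)
    (x : ℤ × ℤ) (n : ℕ) :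
    ev ρ ((rootMul s)^[n] x) = ρ ^ n * ev ρ x := by
  induction n with
  | zero => simp
  | succ n ih =>
    rw [Function.iterate_succ_apply', pow_succ', mul_assoc, ← ih]
    generalize (rootMul s)^[n] x = y
    simp only [ev, rootMul]
    push_cast
    linear_combination (-(y.2 : F)) * h

/-- A numbering of `ℤ × ℤ`. -/
def intCode (x : ℤ × ℤ) : ℕ := Nat.pair (Equiv.intEquivNat x.1) (Equiv.intEquivNat x.2)

theorem intCode_inj : Function.Injective intCode := by
  intro x y h
  have := Nat.pair_eq_pair.1 h
  exact Prod.ext (Equiv.injective _ this.1) (Equiv.injective _ this.2)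

/-- A transversal of the subgroup generated by a root of unity in the multiplicative group of a
finite field. -/
theorem exists_transversal {F : Type} [Field F] [Finite F] {ρ : F} {N : ℕ} (hN : orderOf ρ = N)
    (hN0 : N ≠ 0) : ∃ (κ : Type) (_ : Fintype κ) (c : κ → F), Fintype.card κ * N + 1 = Nat.card F ∧
      ∀ y, y ≠ 0 → ∃ i, ∃ n < N, y = ρ ^ n * c i := by
  classical
  have := Fintype.ofFinite F
  have hρ0 : ρ ≠ 0 := by
    rintro rfl
    apply hN0
    rw [← hN, orderOf_eq_zero_iff']
    intro n hn h
    simp [hn.ne'] at h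
  let u : Fˣ := Units.mk0 ρ hρ0
  have hu : orderOf u = N := by rw [← orderOf_units]; exact hN
  refine ⟨Fˣ ⧸ Subgroup.zpowers u, inferInstance, fun q => (q.out : Fˣ), ?_, ?_⟩
  · have h1 := Subgroup.card_eq_card_quotient_mul_card_subgroup (Subgroup.zpowers u)
    rw [Nat.card_zpowers, hu, Nat.card_units] at h1
    rw [← Nat.card_eq_fintype_card, ← h1]
    have : 0 < Nat.card F := Nat.card_pos
    omega
  · intro y hy
    obtain ⟨⟨z, hz⟩, h⟩ := QuotientGroup.mk_out_eq_mul (Subgroup.zpowers u) (Units.mk0 y hy)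
    have hz' : z⁻¹ ∈ Subgroup.zpowers u := inv_mem hz
    rw [mem_zpowers_iff_mem_range_orderOf, hu] at hz'
    simp only [Finset.mem_image, Finset.mem_range] at hz'
    obtain ⟨n, hn, hnz⟩ := hz'
    refine ⟨QuotientGroup.mk (Units.mk0 y hy), n, hn, ?_⟩
    have h2 : u ^ n * (Units.mk0 y hy * z) = Units.mk0 y hy := by
      rw [hnz, mul_comm _ z, inv_mul_cancel_left]
    have h3 := congrArg (Units.val) h2
    simp only [h]
    simpa [u] using h3.symm

/-- A table of triples with entries in `H × ℤ[ρ]` gives relative families over all fields containing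
a suitable root of unity `ρ` of order `N`, if for each `h : H` the coefficients of the differences,
and of the points, with first component `h` run through the orbit of some `γ` under `ρ`. -/
theorem relFamily_of_root {H : Type} [Group H] [Coded H] [Finite H] (j : H) (s : ℤ) (N : ℕ)
    (γs : List (ℤ × ℤ)) (L : List ((H × ℤ × ℤ) × (H × ℤ × ℤ) × (H × ℤ × ℤ))) (hN0 : N ≠ 0)
    (hcount : 6 * L.length = Nat.card H * N) (hj : j * j = 1)
    (hD : ∀ h : H, ∃ γ ∈ γs, ∀ n < N,
      (mask (pairCode intCode) (diffs (fun x y => (x.1 * y.1⁻¹, x.2 - y.2)) L)).testBit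
        (pairCode intCode (h, (rootMul s)^[n] γ)))
    (hP : ∀ h : H, ∃ γ ∈ γs, ∀ n < N,
      (mask (pairCode intCode) (points L)).testBit (pairCode intCode (h, (rootMul s)^[n] γ)) ∨
      (mask (pairCode intCode) (points L)).testBit (pairCode intCode (h * j, (rootMul s)^[n] γ)))
    {F : Type} [Field F] [Finite F] (ρ : F) (hρ : ρ * ρ = s * ρ - 1) (hN : orderOf ρ = N)
    (hγ : ∀ γ ∈ γs, ev ρ γ ≠ 0) : RelFamily H j F := by
  obtain ⟨κ, _, c, hκ, hc⟩ := exists_transversal hN hN0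
  have hc' : ∀ γ ∈ γs, ∀ y : F, y ≠ 0 → ∃ i, ∃ n < N, y = ev ρ ((rootMul s)^[n] γ) * c i := by
    intro γ h1 y hy
    have h2 := hγ γ h1
    obtain ⟨i, n, hn, e⟩ := hc (y / ev ρ γ) (div_ne_zero hy h2)
    refine ⟨i, n, hn, ?_⟩
    rw [ev_rootMul hρ, mul_right_comm, ← e, div_mul_cancel₀ _ h2]
  refine ⟨Fintype.card κ * L.length, ?_, κ × Fin L.length, inferInstance, fun i k =>
    ((nth L[i.2] k).1, Multiplicative.ofAdd (ev ρ (nth L[i.2] k).2 * c i.1)), ?_, ?_, ?_⟩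
  · rw [← hκ]
    calc 6 * (Fintype.card κ * L.length) + Nat.card H
        = Fintype.card κ * (6 * L.length) + Nat.card H := by ring
      _ = _ := by rw [hcount]; ring
  · simp
  · rintro ⟨h, y⟩ hy
    obtain ⟨γ, hγ1, hγ2⟩ := hD h
    obtain ⟨i, n, hn, e⟩ := hc' γ hγ1 y.toAdd hy
    obtain ⟨i', k, l, hkl, e'⟩ := exists_of_mem_diffs
      (mem_of_testBit_mask (pairCode_inj intCode_inj) (hγ2 n hn))
    refine ⟨(i, i'), k, l, hkl, ?_⟩
    simp only [Prod.mk.injEq] at e'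
    refine Prod.ext e'.1 ?_
    change _ + -_ = y.toAdd
    rw [e, ← e'.2, ev_sub]
    rw [sub_mul, sub_eq_add_neg]
    rfl
  · rintro ⟨h, y⟩ hy
    obtain ⟨γ, hγ1, hγ2⟩ := hP h
    obtain ⟨i, n, hn, e⟩ := hc' γ hγ1 y.toAdd hy
    rcases hγ2 n hn with h1 | h1
    · obtain ⟨i', k, e'⟩ := exists_of_mem_points
        (mem_of_testBit_mask (pairCode_inj intCode_inj) h1)
      refine ⟨(i, i'), k, Or.inl (Prod.ext ?_ ?_)⟩
      · simp only [e']
      · simp only [e', ← e, ofAdd_toAdd]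
    · obtain ⟨i', k, e'⟩ := exists_of_mem_points
        (mem_of_testBit_mask (pairCode_inj intCode_inj) h1)
      refine ⟨(i, i'), k, Or.inr (Prod.ext ?_ ?_)⟩
      · simp only [e', Prod.fst_mul, mul_assoc, hj, mul_one]
      · simp only [e', Prod.snd_mul, ← e, ofAdd_toAdd, mul_one]

/-- The Gaussian integers `1`, `1 + i`, `2`, `2 + 2 i`, which are units at odd places. -/
def gaussUnits : List (ℤ × ℤ) := [(1, 0), (1, 1), (2, 0), (2, 2)]

theorem ev_gaussUnits {F : Type} [Field F] {i : F} (hi : i * i = -1) (h2 : (2 : F) ≠ 0) :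
    ∀ γ ∈ gaussUnits, ev i γ ≠ 0 := by
  have h : (1 + i) ≠ 0 := by
    intro h
    apply h2
    linear_combination (1 - i) * h + hi
  simp only [gaussUnits, List.forall_mem_cons, ev]
  refine ⟨by simp, by simpa using h, by simpa using h2, ?_, by simp⟩
  have : ((2 : ℤ) : F) + ((2 : ℤ) : F) * i = 2 * (1 + i) := by push_cast; ring
  rw [this]
  exact mul_ne_zero h2 h

theorem orderOf_of_sq_eq_neg_one {F : Type} [Field F] {i : F} (hi : i * i = -1) (h2 : (2 : F) ≠ 0) :
    orderOf i = 4 := by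
  have h1 : (-1 : F) ≠ 1 := by
    intro h
    apply h2
    linear_combination -h
  exact orderOf_eq_prime_pow (p := 2) (n := 1) (by simpa [sq, hi] using h1)
    (by linear_combination (i * i - 1) * hi)

/-- The case of a primitive fourth root of unity, that is, `ρ² = -1`. -/
theorem hasI_of_table {H : Type} [Group H] [Coded H] [Finite H] (j : H)
    (L : List ((H × ℤ × ℤ) × (H × ℤ × ℤ) × (H × ℤ × ℤ)))
    (hcount : 6 * L.length = Nat.card H * 4) (hj : j * j = 1)
    (hD : ∀ h : H, ∃ γ ∈ gaussUnits, ∀ n < 4,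
      (mask (pairCode intCode) (diffs (fun x y => (x.1 * y.1⁻¹, x.2 - y.2)) L)).testBit
        (pairCode intCode (h, (rootMul 0)^[n] γ)))
    (hP : ∀ h : H, ∃ γ ∈ gaussUnits, ∀ n < 4,
      (mask (pairCode intCode) (points L)).testBit (pairCode intCode (h, (rootMul 0)^[n] γ)) ∨
      (mask (pairCode intCode) (points L)).testBit (pairCode intCode (h * j, (rootMul 0)^[n] γ))) :
    HasI H j := fun _ _ _ i hi h2 =>
  relFamily_of_root j 0 4 gaussUnits L (by norm_num) hcount hj hD hP i (by simp [hi])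
    (orderOf_of_sq_eq_neg_one hi h2) (ev_gaussUnits hi h2)

/-- Decoding of a table entry: the last two decimal digits are `a + 2` and `b + 2` for the
coefficient `(a, b)`, and the digits before them give the element of the group. -/
def elCoef {q m m' : ℕ} (n : ℕ) : Grp q m m' × ℤ × ℤ :=
  (el (n / 100), ((n / 10 % 10 : ℕ) : ℤ) - 2, ((n % 10 : ℕ) : ℤ) - 2)

instance : Coded (DihedralGroup 3) where
  size := 6
  code
    | .r i => i.val
    | .sr i => 3 + i.val
  code_lt := by decide
  code_inj := by decide

/-- Decoding of a table entry over the dihedral group of order six: the last two digits give the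
coefficient as in `elCoef`, and the digit before them is `n` for the rotation `r n` and `n + 3` for
the reflection `sr n`. -/
def dihCoef (n : ℕ) : DihedralGroup 3 × ℤ × ℤ :=
  (if n / 100 < 3 then .r ((n / 100 : ℕ) : ZMod 3) else .sr ((n / 100 : ℕ) : ZMod 3),
    ((n / 10 % 10 : ℕ) : ℤ) - 2, ((n % 10 : ℕ) : ℤ) - 2)

theorem hasI_dihedral : HasI (DihedralGroup 3) (.sr 0) :=
  hasI_of_table _ (mapTriples dihCoef [
    (32, 423, 12), (232, 123, 121), (132, 412, 221), (23, 512, 321)])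
    (by simp [Nat.card_eq_fintype_card]; decide +kernel) (by decide +kernel) (by decide +kernel)
    (by decide +kernel)

theorem hasI_2_3_1 : HasI (Grp 2 3 1) (el 1000) :=
  hasI_of_table _ (mapTriples elCoef [
    (32, 1023, 110012), (1032, 110023, 1012), (101032, 100023, 10021), (10032, 101023, 101021),
    (2032, 102012, 1021), (102032, 112012, 100021), (2023, 12, 12021), (102023, 101012, 2021)])
    (by simp [Nat.card_eq_fintype_card]; decide +kernel) (by decide +kernel) (by decide +kernel)
    (by decide +kernel)

theorem hasI_2_9_1 : HasI (Grp 2 9 1) (el 1000) :=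
  hasI_of_table _ (mapTriples elCoef [
    (3032, 8012, 2023), (14032, 110012, 3023), (112032, 107012, 1023), (115032, 111012, 104023),
    (117021, 102023, 108032), (21, 14023, 101032), (1021, 115023, 12032),
    (108021, 113023, 100032), (1032, 5012, 4021), (118032, 113012, 2021), (110032, 14012, 13021),
    (107032, 112012, 111021), (13032, 105031, 105033), (104012, 6011, 106013),
    (114032, 116031, 106033), (103012, 105011, 15013), (117023, 102021, 108012),
    (10023, 104021, 11012), (18023, 3021, 100012), (101023, 115021, 102012), (7033, 23, 7013),
    (17031, 110021, 7011), (6031, 118021, 116011), (116033, 118023, 16013)])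
    (by simp [Nat.card_eq_fintype_card]; decide +kernel) (by decide +kernel) (by decide +kernel)
    (by decide +kernel)

theorem hasI_2_9_3 : HasI (Grp 2 9 3) (el 1000) :=
  hasI_of_table _ (mapTriples elCoef [
    (6032, 2012, 5023), (11032, 116012, 23), (15032, 11012, 114023), (1132, 106112, 110123),
    (102012, 105223, 16132), (117212, 101123, 112032), (102112, 15023, 106232),
    (18212, 112123, 13032), (117132, 16023, 13212), (8132, 17023, 104212), (18232, 17123, 114012),
    (115032, 114223, 101112), (7032, 6021, 1023), (4232, 103221, 107223),
    (104032, 103021, 117023), (3232, 112221, 116223), (3132, 2021, 6223), (12132, 1021, 115223),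
    (105232, 104121, 118023), (18132, 17021, 102223), (16123, 13232, 102021),
    (113223, 100032, 108121), (103023, 10132, 18221), (18123, 115232, 114021), (5212, 1232, 4221),
    (106012, 12032, 5021), (106212, 102232, 15221), (118112, 104132, 7121), (6221, 3032, 7112),
    (15021, 112132, 16212), (12221, 8032, 103112), (11221, 107032, 2112),
    (117021, 108112, 114232), (21, 11112, 116232), (110121, 11212, 16032),
    (104221, 115012, 111132), (105113, 13112, 105111), (100233, 117232, 110231),
    (213, 17212, 110211), (115133, 13132, 15131), (211, 7012, 113), (108011, 116112, 118213),
    (131, 17232, 110033), (110031, 17132, 10233), (4133, 2232, 4031), (14113, 12212, 4011),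
    (10213, 107012, 100111), (18033, 6132, 118231), (1223, 2212, 5221), (3223, 14212, 107221),
    (112023, 13012, 116021), (106123, 117112, 101121), (2121, 7223, 8012),
    (118021, 114123, 15212), (8121, 14223, 15012), (17221, 13023, 104112), (108223, 13021, 10112),
    (118123, 113221, 12), (12023, 6121, 103212), (102123, 116221, 103012), (4013, 6023, 4033),
    (14111, 116121, 4131), (115111, 107121, 5131), (115113, 117123, 15133),
    (13121, 111231, 111011), (1123, 118233, 18013), (103123, 111233, 101013),
    (12121, 100231, 10011), (13123, 111213, 111033), (1121, 118211, 18031),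
    (103121, 111211, 101031), (112223, 110013, 133)])
    (by simp [Nat.card_eq_fintype_card]; decide +kernel) (by decide +kernel) (by decide +kernel)
    (by decide +kernel)

/-- Relative families over the fields containing a primitive sixth root of unity. -/
theorem relFamily_of_sixth_root {F : Type} [Field F] [Finite F] (ρ : F) (hρ : ρ * ρ = ρ - 1)
    (h2 : (2 : F) ≠ 0) (h3 : (3 : F) ≠ 0) : RelFamily (Grp 2 3 1) (el 1000) F := by
  have hρ3 : ρ ^ 3 = -1 := by linear_combination (ρ + 1) * hρ
  have hord : orderOf ρ = 6 := by
    have h6 : ρ ^ 6 = 1 := by linear_combination (ρ ^ 3 - 1) * hρ3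
    refine orderOf_eq_of_pow_and_pow_div_prime (by norm_num) h6 ?_
    intro p hp hdvd
    have : p = 2 ∨ p = 3 := by
      rw [show 6 = 2 * 3 by rfl, hp.dvd_mul] at hdvd
      rcases hdvd with h | h
      · exact Or.inl ((Nat.prime_dvd_prime_iff_eq hp Nat.prime_two).1 h)
      · exact Or.inr ((Nat.prime_dvd_prime_iff_eq hp Nat.prime_three).1 h)
    rcases this with rfl | rfl
    · intro h
      apply h2
      norm_num at h
      linear_combination hρ3 - h
    · intro h
      apply h3
      have h' : ρ ^ 2 = 1 := h
      have h4 : ρ = 2 := by linear_combination h' - hρ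
      rw [h4] at hρ
      linear_combination hρ
  refine relFamily_of_root _ 1 6 [(1, 0), (1, 1), (2, 0)] (mapTriples elCoef [
    (32, 112023, 110013), (2032, 102023, 11013), (1032, 112013, 102031), (101032, 111012, 110021),
    (102032, 102021, 1031), (10032, 1021, 101031), (10023, 12013, 21), (23, 12012, 110031),
    (1023, 2012, 2031), (101023, 11012, 100031), (13, 100012, 2021), (101013, 10012, 101021)])
    (by norm_num) (by simp [Nat.card_eq_fintype_card]; decide +kernel) (by decide +kernel)
    (by decide +kernel) (by decide +kernel) ρ (by push_cast; linear_combination hρ) hord ?_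
  simp only [List.forall_mem_cons, ev]
  refine ⟨by simp, ?_, by simpa using h2, by simp⟩
  intro h
  apply h3
  push_cast at h
  linear_combination (2 - ρ) * h + hρ

/-! ### The rings `ℤ[ω]/(2 ^ e)` -/

/-- Doubling, as an injection of `ℤ/2ⁿ` into `ℤ/2ⁿ⁺¹`. -/
def dbl (n : ℕ) : ZMod (2 ^ n) →+ ZMod (2 ^ (n + 1)) :=
  ZMod.lift (2 ^ n) ⟨zmultiplesHom _ (2 : ZMod (2 ^ (n + 1))), by
    have h : ((2 ^ (n + 1) : ℕ) : ZMod (2 ^ (n + 1))) = 0 := ZMod.natCast_self _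
    simp only [zmultiplesHom_apply, natCast_zsmul, nsmul_eq_mul]
    rw [← h]; push_cast; ring⟩

theorem dbl_natCast (n k : ℕ) : dbl n (k : ZMod (2 ^ n)) = ((2 * k : ℕ) : ZMod (2 ^ (n + 1))) := by
  have h : ((k : ℕ) : ZMod (2 ^ n)) = ((k : ℤ) : ZMod (2 ^ n)) := by simp
  rw [h, dbl, ZMod.lift_coe]
  simp [mul_comm]

theorem dbl_injective (n : ℕ) : Function.Injective (dbl n) := by
  rw [injective_iff_map_eq_zero]
  intro x hx
  obtain ⟨k, rfl⟩ := ZMod.natCast_zmod_surjective x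
  rw [dbl_natCast, ZMod.natCast_eq_zero_iff, pow_succ'] at hx
  rw [ZMod.natCast_eq_zero_iff]
  exact Nat.dvd_of_mul_dvd_mul_left two_pos hx

theorem exists_dbl_add (n : ℕ) (x : ZMod (2 ^ (n + 1))) :
    ∃ y, x = dbl n y ∨ x = dbl n y + 1 := by
  obtain ⟨k, rfl⟩ := ZMod.natCast_zmod_surjective x
  refine ⟨((k / 2 : ℕ) : ZMod (2 ^ n)), ?_⟩
  rw [dbl_natCast]
  rcases Nat.mod_two_eq_zero_or_one k with h | h
  · left; congr 1; omega
  · right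
    rw [show (1 : ZMod (2 ^ (n + 1))) = ((1 : ℕ) : ZMod (2 ^ (n + 1))) by simp, ← Nat.cast_add]
    congr 1; omega

/-- The element `2ⁿ` of `ℤ/2ⁿ⁺¹`. -/
def half (n : ℕ) : ZMod (2 ^ (n + 1)) := ((2 ^ n : ℕ) : ZMod (2 ^ (n + 1)))

theorem dbl_half (n : ℕ) : dbl (n + 1) (half n) = half (n + 1) := by
  rw [half, dbl_natCast, half, ← pow_succ']

/-- Multiplication by `2ᵉ`, as an injection of `ℤ/4` into `ℤ/2ᵉ⁺²`. -/
def emb : (e : ℕ) → ZMod 4 →+ ZMod (2 ^ (e + 2))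
  | 0 => AddMonoidHom.id (ZMod 4)
  | e + 1 => (dbl (e + 2)).comp (emb e)

theorem emb_two (e : ℕ) : emb e 2 = half (e + 1) := by
  induction e with
  | zero => rfl
  | succ e ih => rw [emb, AddMonoidHom.comp_apply, ih, dbl_half]

/-- The digits `0, 1, ω, ω²` of an expansion to base two. -/
def digit {A : Type} [Ring A] : Option (ZMod 3) → A × A
  | none => 0
  | some k => rotn k (1, 0)

/-- Expansion to base two: the digits represent `ℤ[ω]` modulo `2`. -/
theorem exists_digit {n : ℕ} (t : ZMod (2 ^ (n + 1)) × ZMod (2 ^ (n + 1))) :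
    ∃ s t', t = digit s + Prod.map (dbl n) (dbl n) t' := by
  have h1 : (1 : ZMod 3) ≠ 0 := by decide
  have h2 : (2 : ZMod 3) ≠ 0 := by decide
  have h3 : (2 : ZMod 3) ≠ 1 := by decide
  have hd : dbl n 1 = 1 + 1 := by
    have := dbl_natCast n 1
    rw [Nat.cast_one] at this
    rw [this]; norm_num
  obtain ⟨a, b⟩ := t
  obtain ⟨y, hy⟩ := exists_dbl_add n a
  obtain ⟨z, hz⟩ := exists_dbl_add n b
  rcases hy with rfl | rfl <;> rcases hz with rfl | rfl
  · exact ⟨none, (y, z), by simp [digit]⟩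
  · exact ⟨some 1, (y, z), by ext <;> simp [digit, rotn, rot, h1, add_comm]⟩
  · exact ⟨some 0, (y, z), by ext <;> simp [digit, rotn, add_comm]⟩
  · exact ⟨some 2, (y + 1, z + 1), by
      ext <;> simp only [digit, rotn, rot, h2, h3, if_false, Prod.map, map_add, hd, Prod.fst_add,
        Prod.snd_add] <;> abel⟩

theorem rot_digit {A : Type} [Ring A] (s : Option (ZMod 3)) :
    ∃ s', digit (A := A) s' = rot (digit s) := by
  rcases s with _ | k
  · exact ⟨none, by ext <;> simp [digit, rot]⟩
  · exact ⟨some (1 + k), by rw [digit, ← rotn_one, digit, rotn_rotn]⟩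

/-- Digit expansions: a system of representatives of `ℤ[ω]/(2ᵉ⁺²)` modulo the image of
`ℤ[ω]/(4)` which is invariant under multiplication by `ω`. -/
theorem exists_representatives (e : ℕ) : ∃ (S : Type) (_ : Fintype S)
    (val : S → ZMod (2 ^ (e + 2)) × ZMod (2 ^ (e + 2))),
    Fintype.card S * 16 = 2 ^ (e + 2) * 2 ^ (e + 2) ∧
    (∀ k σ, ∃ σ', val σ' = rotn k (val σ)) ∧
    ∀ t, ∃ m σ, t = Prod.map (emb e) (emb e) m + val σ := by
  suffices h : ∃ (S : Type) (_ : Fintype S)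
    (val : S → ZMod (2 ^ (e + 2)) × ZMod (2 ^ (e + 2))),
    Fintype.card S * 16 = 2 ^ (e + 2) * 2 ^ (e + 2) ∧
    (∀ σ, ∃ σ', val σ' = rot (val σ)) ∧
    ∀ t, ∃ m σ, t = Prod.map (emb e) (emb e) m + val σ by
    obtain ⟨S, _, val, h1, h2, h3⟩ := h
    refine ⟨S, inferInstance, val, h1, fun k σ => ?_, h3⟩
    unfold rotn
    split_ifs
    · exact ⟨σ, rfl⟩
    · exact h2 σ
    · obtain ⟨σ', h⟩ := h2 σ
      rw [← h]
      exact h2 σ'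
  induction e with
  | zero => exact ⟨Unit, inferInstance, fun _ => 0, by simp, fun _ => ⟨(), by ext <;> simp [rot]⟩,
      fun t => ⟨t, (), by simp [emb]⟩⟩
  | succ e ih =>
    obtain ⟨S, _, val, h1, h2, h3⟩ := ih
    refine ⟨Option (ZMod 3) × S, inferInstance,
      fun x => digit x.1 + Prod.map (dbl _) (dbl _) (val x.2), ?_, ?_, ?_⟩
    · rw [Fintype.card_prod, mul_assoc, h1]
      simp only [Fintype.card_option, ZMod.card]
      ring
    · rintro ⟨s, σ⟩
      obtain ⟨s', hs⟩ := rot_digit (A := ZMod (2 ^ (e + 1 + 2))) s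
      obtain ⟨σ', hσ⟩ := h2 σ
      refine ⟨(s', σ'), ?_⟩
      simp only
      rw [hs, hσ, ← rotn_one, ← rotn_one, ← rotn_one, rotn_add, rotn_prodMap]
    · intro t
      obtain ⟨s, t', ht⟩ := exists_digit t
      obtain ⟨m, σ, h⟩ := h3 t'
      refine ⟨m, (s, σ), ?_⟩
      rw [ht, h, emb]
      ext <;> simp only [Prod.fst_add, Prod.snd_add, Prod.map_fst, Prod.map_snd, map_add,
        AddMonoidHom.comp_apply] <;> abel

/-! ### Splittings and the lifting of difference families -/

/-- A splitting of `A[ω]` with respect to `j₀`: its elements `n` are divided into two halves and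
endowed with shifts `X n` such that for each half `h` and each `k` the elements `ω ^ k n + X n`,
with `n` in the half `h`, meet all cosets of `ω ^ s h * j₀`. -/
def Split (A : Type) [AddCommGroup A] (j₀ : A × A) (s : Bool → ZMod 3) : Prop :=
  ∃ (N : Type) (_ : Fintype N) (val X : N → A × A) (hf : N → Bool),
    Fintype.card N = Nat.card (A × A) ∧ (∀ t, ∃ n, val n = t) ∧
    ∀ h (k : Fin 3) z, ∃ n, hf n = h ∧ (rotn ((k : ℕ) : ZMod 3) (val n) + X n = z ∨
      rotn ((k : ℕ) : ZMod 3) (val n) + X n = z + rotn (s h) j₀)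

theorem Split.rotate {A : Type} [AddCommGroup A] {j₀ : A × A} {s : Bool → ZMod 3}
    (h : Split A j₀ s) (c : ZMod 3) : Split A j₀ fun b => c + s b := by
  obtain ⟨N, _, val, X, hf, h1, h2, h3⟩ := h
  have hc : ∀ t : A × A, rotn c (rotn (-c) t) = t := fun t => by rw [rotn_rotn]; simp
  refine ⟨N, inferInstance, fun n => rotn c (val n), fun n => rotn c (X n), hf, h1, ?_, ?_⟩
  · intro t
    obtain ⟨n, hn⟩ := h2 (rotn (-c) t)
    exact ⟨n, by simp only [hn, hc]⟩
  · intro b k z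
    obtain ⟨n, hn, h⟩ := h3 b k (rotn (-c) z)
    have e : rotn ((k : ℕ) : ZMod 3) (rotn c (val n)) + rotn c (X n) =
        rotn c (rotn ((k : ℕ) : ZMod 3) (val n) + X n) := by
      rw [rotn_rotn, add_comm _ c, ← rotn_rotn, ← rotn_add]
    refine ⟨n, hn, ?_⟩
    simp only [e]
    refine h.imp (fun h => ?_) (fun h => ?_)
    · rw [h, hc]
    · rw [h, rotn_add, hc, rotn_rotn]

/-- The splitting of `ℤ[ω]/(4)` encoded by a list: the `n`-th entry has the two coordinates of the
shift and the half of the element `(n / 4, n % 4)` as decimal digits. -/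
theorem split_four_of_list (δ : ZMod 3) (l : List ℕ)
    (h : ∀ (b : Bool) (k : Fin 3) (z : ZMod 4 × ZMod 4), ∃ n : ZMod 4 × ZMod 4,
      let w := l.getD (n.1.val * 4 + n.2.val) 0
      decide (w % 10 = 1) = b ∧
      (rotn ((k : ℕ) : ZMod 3) n + (((w / 100 : ℕ) : ZMod 4), ((w / 10 % 10 : ℕ) : ZMod 4)) = z ∨
      rotn ((k : ℕ) : ZMod 3) n + (((w / 100 : ℕ) : ZMod 4), ((w / 10 % 10 : ℕ) : ZMod 4)) =
        z + rotn (if b then δ else 0) (2, 0))) :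
    Split (ZMod 4) (2, 0) fun b => if b then δ else 0 :=
  ⟨ZMod 4 × ZMod 4, inferInstance, id,
    fun n => let w := l.getD (n.1.val * 4 + n.2.val) 0
      (((w / 100 : ℕ) : ZMod 4), ((w / 10 % 10 : ℕ) : ZMod 4)),
    fun n => decide (l.getD (n.1.val * 4 + n.2.val) 0 % 10 = 1),
    by simp, fun t => ⟨t, rfl⟩, h⟩

/-- For any two levels there is a splitting of `ℤ[ω]/(4)`; up to multiplication by powers of `ω`
only the difference of the levels matters. -/
theorem split_four (s : Bool → ZMod 3) : Split (ZMod 4) (2, 0) s := by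
  have h : ∀ δ, Split (ZMod 4) (2, 0) fun b => if b then δ else 0 := by
    intro δ
    have : δ = 0 ∨ δ = 1 ∨ δ = 2 := by revert δ; decide
    rcases this with rfl | rfl | rfl
    · exact split_four_of_list 0 [331, 331, 330, 330, 331, 331, 330, 330, 221, 220, 220, 221, 200,
        201, 201, 200] (by decide +kernel)
    · exact split_four_of_list 1 [331, 331, 330, 330, 331, 331, 330, 330, 31, 220, 220, 31, 200,
        231, 231, 200] (by decide +kernel)
    · exact split_four_of_list 2 [10, 221, 21, 10, 10, 221, 300, 11, 11, 120, 300, 11, 11,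
        120, 21, 10] (by decide +kernel)
  convert (h (s true - s false)).rotate (s false) using 2 with b
  cases b <;> simp

/-- Splittings pass from `ℤ[ω]/(4)` to `ℤ[ω]/(2ᵉ⁺²)`: the representatives of the cosets are permuted
by `ω ^ k`, and only the component in `ℤ[ω]/(4)` is shifted. -/
theorem split_two_pow (e : ℕ) (s : Bool → ZMod 3) :
    Split (ZMod (2 ^ (e + 2))) (half (e + 1), 0) s := by
  obtain ⟨N, _, val, X, hf, h1, h2, h3⟩ := split_four s
  obtain ⟨S, _, v, g1, g2, g3⟩ := exists_representatives e
  refine ⟨N × S, inferInstance, fun x => Prod.map (emb e) (emb e) (val x.1) + v x.2,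
    fun x => Prod.map (emb e) (emb e) (X x.1), fun x => hf x.1, ?_, ?_, ?_⟩
  · rw [Fintype.card_prod, h1, Nat.card_prod, Nat.card_prod, Nat.card_zmod, Nat.card_zmod,
      mul_comm, ← g1]
  · intro t
    obtain ⟨m, σ, rfl⟩ := g3 t
    obtain ⟨n, rfl⟩ := h2 m
    exact ⟨(n, σ), rfl⟩
  · intro b k z
    obtain ⟨m, σ, rfl⟩ := g3 z
    obtain ⟨n, hn, h⟩ := h3 b k m
    obtain ⟨σ', hσ⟩ := g2 (-((k : ℕ) : ZMod 3)) σ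
    refine ⟨(n, σ'), hn, ?_⟩
    have e0 : rotn ((k : ℕ) : ZMod 3) (Prod.map (emb e) (emb e) (val n) + v σ') +
        Prod.map (emb e) (emb e) (X n) =
        Prod.map (emb e) (emb e) (rotn ((k : ℕ) : ZMod 3) (val n) + X n) + v σ := by
      have e1 : rotn ((k : ℕ) : ZMod 3) (rotn (-((k : ℕ) : ZMod 3)) (v σ)) = v σ := by
        rw [rotn_rotn]; simp
      rw [rotn_add, hσ, rotn_prodMap, e1]
      ext <;> simp only [Prod.fst_add, Prod.snd_add, Prod.map_fst, Prod.map_snd, map_add] <;> abel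
    have e2 : rotn (s b) (half (e + 1), (0 : ZMod (2 ^ (e + 2)))) =
        Prod.map (emb e) (emb e) (rotn (s b) (2, 0)) := by
      rw [← rotn_prodMap, Prod.map, emb_two, map_zero]
    simp only
    rw [e0, e2]
    refine h.imp (fun h => by rw [h]) fun h => ?_
    rw [h]
    ext <;> simp only [Prod.fst_add, Prod.snd_add, Prod.map_fst, Prod.map_snd, map_add] <;> abel

/-- If multiplication by `3` is surjective, so is multiplication by `ω ^ k - ω ^ l` for `k ≠ l`. -/
theorem exists_rotn_sub {A : Type} [AddCommGroup A] (h3 : ∀ a : A, ∃ b, b + b + b = a)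
    {k l : ZMod 3} (hkl : k ≠ l) (t : A × A) : ∃ n, rotn k n - rotn l n = t := by
  have base : ∀ t : A × A, ∃ n, n - rot n = t := by
    rintro ⟨x, y⟩
    obtain ⟨b, hb⟩ := h3 (x + y)
    refine ⟨(x - b, b), ?_⟩
    ext
    · simp [rot]
    · simp only [rot, Prod.snd_sub]
      rw [show b - (x - b - b) = (b + b + b) - x by abel, hb]; abel
  have hd : ∀ k l : ZMod 3, k ≠ l → l = k + 1 ∨ k = l + 1 := by decide
  rcases hd k l hkl with rfl | rfl
  · obtain ⟨n, hn⟩ := base (rotn (-k) t)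
    refine ⟨n, ?_⟩
    rw [← rotn_rotn, ← rotn_sub, rotn_one, hn, rotn_rotn]; simp
  · obtain ⟨n, hn⟩ := base (-rotn (-l) t)
    refine ⟨n, ?_⟩
    rw [← rotn_rotn, ← rotn_sub, rotn_one, ← neg_sub, hn, neg_neg, rotn_rotn]; simp

theorem three_surjective (e : ℕ) (a : ZMod (2 ^ e)) : ∃ b, b + b + b = a := by
  have h : IsUnit ((3 : ℕ) : ZMod (2 ^ e)) := by
    rw [ZMod.isUnit_iff_coprime]
    exact Nat.Coprime.pow_right e (by norm_num)
  obtain ⟨u, hu⟩ := h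
  refine ⟨↑u⁻¹ * a, ?_⟩
  have : (u : ZMod (2 ^ e)) * (↑u⁻¹ * a) = a := Units.mul_inv_cancel_left u a
  rw [hu] at this
  calc _ = ((3 : ℕ) : ZMod (2 ^ e)) * (↑u⁻¹ * a) := by push_cast; ring
    _ = a := this

theorem fin_cast_ne {k l : Fin 3} (h : k ≠ l) : ((k : ℕ) : ZMod 3) ≠ ((l : ℕ) : ZMod 3) := by
  revert k l; decide

/-- Lifting a family with two translates. Let `ν` embed `A[ω]` as a normal subgroup of `G` with
quotient `Q`, on which `G` acts by powers of `ω`. If the triples `b i` cover the differences in `Q`,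
and their two translates by `s i false` and `s i true` together cover the points in `Q`, then
twisting the triples by `ω ^ k n` for all `n` in `A[ω]`, and translating according to the half of
`n` in a splitting, gives a family in `G`. -/
theorem Covers.lift {G Q A : Type} [Group G] [Group Q] [AddCommGroup A]
    (h3 : ∀ a : A, ∃ b, b + b + b = a) (ν : A × A → G) (hν : ∀ t t', ν (t + t') = ν t * ν t')
    (π : G →* Q) (hπ : Function.Surjective π) (hker : ∀ g, π g = 1 → ∃ t, ν t = g)
    (hconj : ∀ g : G, ∃ c : ZMod 3, ∀ t, g * ν t = ν (rotn c t) * g)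
    (j₀ : A × A) (hj₀ : j₀ + j₀ = 0) (hsplit : ∀ s, Split A j₀ s)
    {E : Type} [Fintype E] (b : E → Fin 3 → Q) (s : E → Bool → Q) (D P : Set G)
    (hD : ∀ d ∈ D, ∃ i k l, k ≠ l ∧ b i k * (b i l)⁻¹ = π d)
    (hP : ∀ p ∈ P, ∃ i k h, b i k * s i h = π p) :
    Covers (ν j₀) D P (Fintype.card E * Nat.card (A × A)) := by
  choose b' hb' using fun i k => hπ (b i k)
  choose s' hs' using fun i h => hπ (s i h)
  choose c hc using hconj
  choose N iN val X hf n1 n2 n3 using fun i => hsplit fun h => c (s' i h)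
  have hν0 : ν 0 = 1 := by have := hν 0 0; simpa using this
  have hνn : ∀ t, (ν t)⁻¹ = ν (-t) := fun t => inv_eq_of_mul_eq_one_right (by rw [← hν]; simp [hν0])
  refine ⟨Σ i, N i, inferInstance, fun x k => b' x.1 k *
    ν (rotn ((k : ℕ) : ZMod 3) (val x.1 x.2) + X x.1 x.2) * s' x.1 (hf x.1 x.2), ?_, ?_, ?_⟩
  · simp [n1]
  · intro d hd
    obtain ⟨i, k, l, hkl, e⟩ := hD d hd
    obtain ⟨t, ht⟩ := hker (d * (b' i k * (b' i l)⁻¹)⁻¹) (by simp [hb', ← e])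
    obtain ⟨n, hn⟩ := exists_rotn_sub h3 (fin_cast_ne hkl) (rotn (-c (b' i k)) t)
    obtain ⟨m, rfl⟩ := n2 i n
    refine ⟨⟨i, m⟩, k, l, hkl, ?_⟩
    have e1 : b' i k * ν (rotn ((k : ℕ) : ZMod 3) (val i m) + X i m) * s' i (hf i m) *
        (b' i l * ν (rotn ((l : ℕ) : ZMod 3) (val i m) + X i m) * s' i (hf i m))⁻¹ =
        b' i k * (ν (rotn ((k : ℕ) : ZMod 3) (val i m) + X i m) *
          (ν (rotn ((l : ℕ) : ZMod 3) (val i m) + X i m))⁻¹) * (b' i l)⁻¹ := by group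
    simp only
    rw [e1, hνn, ← hν]
    have e2 : rotn ((k : ℕ) : ZMod 3) (val i m) + X i m +
        -(rotn ((l : ℕ) : ZMod 3) (val i m) + X i m) = rotn (-c (b' i k)) t := by
      rw [← hn]; abel
    rw [e2, hc, rotn_rotn, add_neg_cancel, rotn_zero, ht]
    group
  · intro p hp
    obtain ⟨i, k, h, e⟩ := hP p hp
    obtain ⟨t, ht⟩ := hker ((b' i k * s' i h)⁻¹ * p) (by simp [hb', hs', ← e])
    obtain ⟨n, hn, hz⟩ := n3 i h k (rotn (c (s' i h)) t)
    refine ⟨⟨i, n⟩, k, hz.imp (fun hz => ?_) fun hz => ?_⟩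
    · simp only
      rw [hz, hn, mul_assoc, ← hc, ht]; group
    · have h0 : ν j₀ * ν j₀ = 1 := by rw [← hν, hj₀, hν0]
      simp only
      rw [hz, hn, mul_assoc _ (ν _) (s' i h), ← rotn_add, ← hc, hν, ht]
      calc _ = p * (ν j₀ * ν j₀) := by group
        _ = p := by rw [h0, mul_one]

/-! ### Families over `ℤ[ω]/(2ᵉ) ⋊ U` obtained by lifting -/

/-- All translates listed in a table of triples with two translators each. -/
def translates {α : Type} (f : α → α → α) : List ((α × α × α) × α × α) → List (α × α × α)
  | [] => []
  | (b, s, s') :: L => (f b.1 s, f b.2.1 s, f b.2.2 s) :: (f b.1 s', f b.2.1 s', f b.2.2 s') ::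
      translates f L

theorem exists_of_mem_translates {α : Type} {f : α → α → α} {L : List ((α × α × α) × α × α)} {v : α}
    (h : v ∈ points (translates f L)) : ∃ i : Fin L.length, ∃ k, ∃ h : Bool,
      f (nth L[i].1 k) (if h then L[i].2.2 else L[i].2.1) = v := by
  induction L with
  | nil => simp [translates, points] at h
  | cons b L ih =>
    obtain ⟨⟨x, y, z⟩, s, s'⟩ := b
    simp only [translates, points, List.mem_cons] at h
    rcases h with rfl | rfl | rfl | rfl | rfl | rfl | h
    · exact ⟨⟨0, by simp⟩, 0, false, rfl⟩
    · exact ⟨⟨0, by simp⟩, 1, false, rfl⟩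
    · exact ⟨⟨0, by simp⟩, 2, false, rfl⟩
    · exact ⟨⟨0, by simp⟩, 0, true, rfl⟩
    · exact ⟨⟨0, by simp⟩, 1, true, rfl⟩
    · exact ⟨⟨0, by simp⟩, 2, true, rfl⟩
    · obtain ⟨i, k, h, e⟩ := ih h
      exact ⟨⟨i + 1, by simp⟩, k, h, by simpa using e⟩

theorem exists_of_mem_diffs_map {α β γ : Type} {d : α → α → β} {L : List ((α × α × α) × γ)} {v : β}
    (h : v ∈ diffs d (L.map Prod.fst)) :
    ∃ i : Fin L.length, ∃ k l, k ≠ l ∧ d (nth L[i].1 k) (nth L[i].1 l) = v := by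
  obtain ⟨⟨i, hi⟩, k, l, hkl, e⟩ := exists_of_mem_diffs h
  refine ⟨⟨i, by simpa using hi⟩, k, l, hkl, ?_⟩
  simpa using e

namespace Sd

variable {A B U : Type} [AddCommGroup A] [AddCommGroup B] [AddCommGroup U] [Level U]

/-- The homomorphism of semidirect products induced by a homomorphism of coefficients. -/
def map (f : A →+ B) : Sd A U →* Sd B U where
  toFun x := ⟨Prod.map f f x.t, x.u⟩
  map_one' := by
    apply Sd.ext
    · ext <;> simp
    · rfl
  map_mul' x y := by
    apply Sd.ext
    · simp only [mul_t, rotn_prodMap]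
      ext <;> simp
    · simp

/-- The projection of a semidirect product to `U`. -/
def proj : Sd A U →* Multiplicative U where
  toFun x := Multiplicative.ofAdd x.u
  map_one' := rfl
  map_mul' _ _ := rfl

@[simp] theorem map_t (f : A →+ B) (x : Sd A U) : (map f x).t = Prod.map f f x.t := rfl
@[simp] theorem map_u (f : A →+ B) (x : Sd A U) : (map f x).u = x.u := rfl

theorem map_injective {f : A →+ B} (hf : Function.Injective f) :
    Function.Injective (map f : Sd A U →* Sd B U) := by
  intro x y h
  have h1 : Prod.map f f x.t = Prod.map f f y.t := congrArg (fun z : Sd B U => z.t) h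
  have h2 : x.u = y.u := congrArg (fun z : Sd B U => z.u) h
  exact Sd.ext (hf.prodMap hf h1) h2

omit [AddCommGroup A] [AddCommGroup U] [Level U] in
theorem card : Nat.card (Sd A U) = Nat.card (A × A) * Nat.card U := by
  rw [← Nat.card_prod]
  exact Nat.card_congr ⟨fun x => (x.t, x.u), fun x => ⟨x.1, x.2⟩, fun _ => rfl, fun _ => rfl⟩

instance [Finite A] [Finite U] : Finite (Sd A U) := by
  refine Finite.of_injective (fun x : Sd A U => (x.t, x.u)) fun x y h => ?_
  simp only [Prod.mk.injEq] at h
  exact Sd.ext h.1 h.2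

end Sd

theorem half_add_half (n : ℕ) : half n + half n = 0 := by
  rw [half, ← Nat.cast_add, ← two_mul, ← pow_succ', ZMod.natCast_self]

/-- The distinguished involution of `ℤ[ω]/(2ⁿ⁺¹) ⋊ U`. -/
def invol (n : ℕ) (U : Type) [AddCommGroup U] : Sd (ZMod (2 ^ (n + 1))) U := ⟨(half n, 0), 0⟩

theorem map_invol (n : ℕ) (U : Type) [AddCommGroup U] [Level U] :
    Sd.map (dbl (n + 1)) (invol n U) = invol (n + 1) U := by
  apply Sd.ext
  · simp [invol, dbl_half]
  · rfl

/-- Relative families over `ℤ[ω]/(2ᵉ⁺²) ⋊ U` from a table over `U` whose triples have two translates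
each. -/
theorem hasI_of_translates {U : Type} [AddCommGroup U] [Level U] [Coded U] [Finite U] (e : ℕ)
    (L : List (((U × ℤ × ℤ) × (U × ℤ × ℤ) × (U × ℤ × ℤ)) × (U × ℤ × ℤ) × (U × ℤ × ℤ)))
    (hcount : 6 * L.length = 4 * Nat.card U)
    (hD : ∀ u : U, ∃ γ ∈ gaussUnits, ∀ n < 4,
      (mask (pairCode intCode) (diffs (fun x y => (x.1 - y.1, x.2 - y.2)) (L.map Prod.fst))).testBit
        (pairCode intCode (u, (rootMul 0)^[n] γ)))
    (hP : ∀ u : U, ∃ γ ∈ gaussUnits, ∀ n < 4,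
      (mask (pairCode intCode) (points (translates (· + ·) L))).testBit
        (pairCode intCode (u, (rootMul 0)^[n] γ))) :
    HasI (Sd (ZMod (2 ^ (e + 2))) U) (invol (e + 1) U) := by
  intro F _ _ ρ hi h2
  have hρ : ρ * ρ = (0 : ℤ) * ρ - 1 := by simp [hi]
  obtain ⟨κ, _, c, hκ, hc⟩ := exists_transversal (orderOf_of_sq_eq_neg_one hi h2) (by norm_num)
  have hc' : ∀ γ ∈ gaussUnits, ∀ y : F, y ≠ 0 →
      ∃ i, ∃ n < 4, y = ev ρ ((rootMul 0)^[n] γ) * c i := by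
    intro γ h1 y hy
    have h2 := ev_gaussUnits hi h2 γ h1
    obtain ⟨i, n, hn, e⟩ := hc (y / ev ρ γ) (div_ne_zero hy h2)
    refine ⟨i, n, hn, ?_⟩
    rw [ev_rootMul hρ, mul_right_comm, ← e, div_mul_cancel₀ _ h2]
  let A := ZMod (2 ^ (e + 2))
  let pt : κ → U × ℤ × ℤ → Multiplicative U × Multiplicative F := fun i x =>
    (Multiplicative.ofAdd x.1, Multiplicative.ofAdd (ev ρ x.2 * c i))
  have key := Covers.lift (G := Sd A U × Multiplicative F) (three_surjective (e + 2))
    (fun t => (⟨t, 0⟩, 1)) (fun t t' => by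
      refine Prod.ext (Sd.ext ?_ ?_) ?_ <;> simp)
    (MonoidHom.prodMap Sd.proj (MonoidHom.id (Multiplicative F)))
    (by
      rintro ⟨u, y⟩
      exact ⟨(⟨0, u.toAdd⟩, y), rfl⟩)
    (by
      rintro ⟨⟨t, u⟩, y⟩ h
      refine ⟨t, ?_⟩
      have h1 : u = 0 := congrArg (fun z : Multiplicative U × Multiplicative F => z.1.toAdd) h
      have h2 : y = 1 := congrArg Prod.snd h
      rw [h1, h2])
    (by
      rintro ⟨⟨t, u⟩, y⟩
      refine ⟨Level.lev u, fun t' => ?_⟩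
      refine Prod.ext (Sd.ext ?_ ?_) ?_ <;> simp [add_comm])
    (half (e + 1), 0) (by ext <;> simp [half_add_half]) (split_two_pow e)
    (E := κ × Fin L.length) (fun i k => pt i.1 (nth L[i.2].1 k))
    (fun i h => pt i.1 (if h then L[i.2].2.2 else L[i.2].2.1))
    {g | g.2 ≠ 1} {g | g.2 ≠ 1}
    (by
      rintro ⟨⟨t, u⟩, y⟩ hy
      obtain ⟨γ, hγ1, hγ2⟩ := hD u
      obtain ⟨i, n, hn, e⟩ := hc' γ hγ1 y.toAdd hy
      obtain ⟨i', k, l, hkl, e'⟩ := exists_of_mem_diffs_map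
        (mem_of_testBit_mask (pairCode_inj intCode_inj) (hγ2 n hn))
      refine ⟨(i, i'), k, l, hkl, ?_⟩
      simp only [Prod.mk.injEq] at e'
      refine Prod.ext ?_ ?_
      · change _ + -_ = u
        rw [← sub_eq_add_neg]
        exact e'.1
      · change _ + -_ = y.toAdd
        rw [e, ← e'.2, ev_sub, sub_mul, sub_eq_add_neg]
        rfl)
    (by
      rintro ⟨⟨t, u⟩, y⟩ hy
      obtain ⟨γ, hγ1, hγ2⟩ := hP u
      obtain ⟨i, n, hn, e⟩ := hc' γ hγ1 y.toAdd hy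
      obtain ⟨i', k, h, e'⟩ := exists_of_mem_translates
        (mem_of_testBit_mask (pairCode_inj intCode_inj) (hγ2 n hn))
      refine ⟨(i, i'), k, h, ?_⟩
      refine Prod.ext ?_ ?_
      · exact (congrArg (fun z : U × ℤ × ℤ => z.1) e' :)
      · have e2 := (congrArg (fun z : U × ℤ × ℤ => z.2) e' :)
        change ev ρ _ * c i + ev ρ _ * c i = y.toAdd
        simp only at e2
        rw [e, ← e2, ← add_mul]
        congr 1
        simp only [ev, Prod.snd_add, Prod.fst_add]
        push_cast
        ring)
  refine ⟨_, ?_, key⟩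
  rw [← hκ, Sd.card, Fintype.card_prod, Fintype.card_fin]
  calc 6 * (Fintype.card κ * L.length * Nat.card (A × A)) + Nat.card (A × A) * Nat.card U
      = Fintype.card κ * Nat.card (A × A) * (6 * L.length) + Nat.card (A × A) * Nat.card U := by
        ring
    _ = _ := by rw [hcount]; ring

/-- The covering of `ℤ[ω]/(2ᵉ⁺⁴) ⋊ U` outside `2 ℤ[ω]/(2ᵉ⁺⁴) ⋊ U` from a table over the quotient
`ℤ[ω]/(4) ⋊ U` whose triples have two translates each. -/
theorem covers_of_translates {U : Type} [AddCommGroup U] [Level U] [Coded U] [Finite U] (e : ℕ)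
    (L : List ((Sd (ZMod 4) U × Sd (ZMod 4) U × Sd (ZMod 4) U) × Sd (ZMod 4) U × Sd (ZMod 4) U))
    (hD : ∀ d : Sd (ZMod 4) U, ¬(d.t.1.val % 2 = 0 ∧ d.t.2.val % 2 = 0) →
      (mask Coded.code (diffs (fun x y => x * y⁻¹) (L.map Prod.fst))).testBit (Coded.code d))
    (hP : ∀ p : Sd (ZMod 4) U, ¬(p.t.1.val % 2 = 0 ∧ p.t.2.val % 2 = 0) →
      (mask Coded.code (points (translates (· * ·) L))).testBit (Coded.code p)) :
    Covers (invol (e + 3) U) (Set.range (Sd.map (U := U) (dbl (e + 3))))ᶜ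
      (Set.range (Sd.map (U := U) (dbl (e + 3))))ᶜ
      (L.length * Nat.card (ZMod (2 ^ (e + 2)) × ZMod (2 ^ (e + 2)))) := by
  have h4 : 4 ∣ 2 ^ (e + 4) := ⟨2 ^ (e + 2), by ring⟩
  let f : ZMod (2 ^ (e + 4)) →+ ZMod 4 := (ZMod.castHom h4 (ZMod 4)).toAddMonoidHom
  have hf : ∀ k : ℕ, f (k : ZMod (2 ^ (e + 4))) = (k : ZMod 4) := fun k =>
    map_natCast (ZMod.castHom h4 (ZMod 4)) k
  let g : ZMod (2 ^ (e + 2)) →+ ZMod (2 ^ (e + 4)) := (dbl (e + 3)).comp (dbl (e + 2))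
  have hfg : ∀ x, f x = 0 → ∃ y, g y = x := by
    intro x hx
    obtain ⟨k, rfl⟩ := ZMod.natCast_zmod_surjective x
    rw [hf, ZMod.natCast_eq_zero_iff] at hx
    obtain ⟨l, rfl⟩ := hx
    refine ⟨(l : ZMod (2 ^ (e + 2))), ?_⟩
    simp only [g, AddMonoidHom.comp_apply, dbl_natCast]
    congr 1; omega
  have heven : ∀ x, (f x).val % 2 = 0 → ∃ y, dbl (e + 3) y = x := by
    intro x hx
    obtain ⟨k, rfl⟩ := ZMod.natCast_zmod_surjective x
    rw [hf, ZMod.val_natCast] at hx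
    refine ⟨((k / 2 : ℕ) : ZMod (2 ^ (e + 3))), ?_⟩
    rw [dbl_natCast]
    congr 1; omega
  have hodd : ∀ d : Sd (ZMod (2 ^ (e + 4))) U, d ∈ (Set.range (Sd.map (U := U) (dbl (e + 3))))ᶜ →
      ¬(((Sd.map f d).t.1.val % 2 = 0) ∧ ((Sd.map f d).t.2.val % 2 = 0)) := by
    rintro d hd ⟨h1, h2⟩
    obtain ⟨y, hy⟩ := heven _ h1
    obtain ⟨z, hz⟩ := heven _ h2
    exact hd ⟨⟨(y, z), d.u⟩, Sd.ext (Prod.ext hy hz) rfl⟩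
  have key := Covers.lift (G := Sd (ZMod (2 ^ (e + 4))) U) (Q := Sd (ZMod 4) U)
    (three_surjective (e + 2)) (fun t => ⟨Prod.map g g t, 0⟩) (fun t t' => by
      refine Sd.ext ?_ ?_
      · ext <;> simp
      · simp)
    (Sd.map f)
    (by
      rintro ⟨⟨a, b⟩, u⟩
      refine ⟨⟨((a.val : ZMod (2 ^ (e + 4))), (b.val : ZMod (2 ^ (e + 4)))), u⟩, ?_⟩
      refine Sd.ext (Prod.ext ?_ ?_) rfl
      · exact (hf _).trans (ZMod.natCast_zmod_val a)
      · exact (hf _).trans (ZMod.natCast_zmod_val b))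
    (by
      rintro ⟨⟨a, b⟩, u⟩ h
      obtain ⟨y, hy⟩ := hfg a (congrArg (fun z => z.t.1) h)
      obtain ⟨z, hz⟩ := hfg b (congrArg (fun z => z.t.2) h)
      exact ⟨(y, z), Sd.ext (Prod.ext hy hz) (congrArg Sd.u h).symm⟩)
    (by
      rintro ⟨t, u⟩
      refine ⟨Level.lev u, fun t' => ?_⟩
      refine Sd.ext ?_ ?_
      · simp [rotn_prodMap, add_comm]
      · simp)
    (half (e + 1), 0) (by ext <;> simp [half_add_half]) (split_two_pow e)
    (E := Fin L.length) (fun i k => nth L[i].1 k)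
    (fun i h => (if h then L[i].2.2 else L[i].2.1)) _ _
    (fun d hd => by
      obtain ⟨i', k, l, hkl, e'⟩ := exists_of_mem_diffs_map
        (mem_of_testBit_mask Coded.code_inj (hD _ (hodd d hd)))
      exact ⟨i', k, l, hkl, e'⟩)
    (fun p hp => by
      obtain ⟨i', k, h, e'⟩ := exists_of_mem_translates
        (mem_of_testBit_mask Coded.code_inj (hP _ (hodd p hp)))
      exact ⟨i', k, h, e'⟩)
  rw [Fintype.card_fin] at key
  convert key using 1
  refine Sd.ext (Prod.ext ?_ ?_) rfl
  · simp only [invol, g, Prod.map, AddMonoidHom.comp_apply, dbl_half]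
  · simp [invol]

/-- If `U` has no involutions, all involutions of `ℤ[ω]/(2ⁿ⁺²) ⋊ U` are even. -/
theorem mem_range_of_mul_self (n : ℕ) {U : Type} [AddCommGroup U] [Level U]
    (hU : ∀ u : U, u + u = 0 → u = 0) (g : Sd (ZMod (2 ^ (n + 2))) U) (hg : g * g = 1) :
    g ∈ Set.range (Sd.map (U := U) (dbl (n + 1))) := by
  obtain ⟨⟨a, b⟩, u⟩ := g
  have hu : u = 0 := hU u (congrArg Sd.u hg)
  subst hu
  have h : ∀ x : ZMod (2 ^ (n + 2)), x + x = 0 → ∃ y, dbl (n + 1) y = x := by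
    intro x hx
    obtain ⟨k, rfl⟩ := ZMod.natCast_zmod_surjective x
    rw [← Nat.cast_add, ← two_mul, ZMod.natCast_eq_zero_iff, pow_succ'] at hx
    have h1 := Nat.dvd_of_mul_dvd_mul_left two_pos hx
    have h2 : 2 ∣ k := (dvd_pow_self 2 (by omega)).trans h1
    obtain ⟨l, rfl⟩ := h2
    exact ⟨l, dbl_natCast _ _⟩
  have ht := congrArg Sd.t hg
  simp only [Sd.mul_t, map_zero, rotn_zero, Sd.one_t] at ht
  obtain ⟨y, hy⟩ := h a (congrArg Prod.fst ht)
  obtain ⟨z, hz⟩ := h b (congrArg Prod.snd ht)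
  exact ⟨⟨(y, z), 0⟩, Sd.ext (Prod.ext hy hz) rfl⟩

/-- Starters in `ℤ[ω]/(2ᵉ⁺²) ⋊ U` for all `e`, from a starter for `e = 0`, the covering needed to
reach `e = 1`, and the coverings of all further layers. -/
theorem starter_two_pow {U : Type} [AddCommGroup U] [Level U] [Finite U]
    (hU : ∀ u : U, u + u = 0 → u = 0) (h0 : Starter (Sd (ZMod (2 ^ (0 + 2))) U) (invol 1 U))
    {n₁ n₂ : ℕ} (hn₁ : n₁ = 8 * Nat.card U) (hn₂ : n₂ = 2 * Nat.card U)
    (h1 : Covers (G := Sd (ZMod (2 ^ (1 + 2))) U) (invol 2 U)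
      (Set.range (Sd.map (U := U) (dbl 2)))ᶜ (Set.range (Sd.map (U := U) (dbl 2)))ᶜ n₁)
    (h2 : ∀ e, Covers (invol (e + 3) U) (Set.range (Sd.map (U := U) (dbl (e + 3))))ᶜ
      (Set.range (Sd.map (U := U) (dbl (e + 3))))ᶜ
      (n₂ * Nat.card (ZMod (2 ^ (e + 2)) × ZMod (2 ^ (e + 2))))) (e : ℕ) :
    Starter (Sd (ZMod (2 ^ (e + 2))) U) (invol (e + 1) U) := by
  induction e with
  | zero => exact h0
  | succ e ih =>
    have hcov : Covers (invol (e + 2) U) (Set.range (Sd.map (U := U) (dbl (e + 2))))ᶜ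
        (Set.range (Sd.map (U := U) (dbl (e + 2))))ᶜ (2 ^ (e + 1) * 2 ^ (e + 2) * Nat.card U) := by
      rcases e with _ | e
      · convert h1 using 1
        rw [hn₁]; norm_num
      · convert h2 e using 1
        rw [hn₂, Nat.card_prod, Nat.card_zmod]
        ring
    rw [← map_invol]
    refine ih.extend (Sd.map (dbl (e + 2))) (Sd.map_injective (dbl_injective _))
      (mem_range_of_mul_self (e + 1) hU) (n := 2 ^ (e + 1) * 2 ^ (e + 2) * Nat.card U) ?_ ?_
    · rw [Sd.card, Sd.card, Nat.card_prod, Nat.card_prod, Nat.card_zmod, Nat.card_zmod]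
      ring
    · rw [map_invol]
      exact hcov

/-! ### Starters and relative families over `ℤ[ω]/(2ᵉ) ⋊ ℤ/3` and `ℤ[ω]/(2ᵉ) ⋊ ℤ/9` -/

/-- Apply a function to all entries of a list of triples with two translators. -/
def mapDouble {α β : Type} (f : α → β) (L : List ((α × α × α) × α × α)) :
    List ((β × β × β) × β × β) :=
  L.map fun x => ((f x.1.1, f x.1.2.1, f x.1.2.2), f x.2.1, f x.2.2)

/-- Decoding of a table entry: the last two decimal digits are `a + 4` and `b + 4` for the
coefficient `(a, b)`, and the digit before them is the element of `ℤ/m`. -/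
def cycCoef {m : ℕ} (n : ℕ) : (ZMod m × ZMod 1) × ℤ × ℤ :=
  ((((n / 100 : ℕ) : ZMod m), 0), ((n / 10 % 10 : ℕ) : ℤ) - 4, ((n % 10 : ℕ) : ℤ) - 4)

theorem hasI_two_pow_three (e : ℕ) :
    HasI (Grp (2 ^ (e + 2)) 3 1) (invol (e + 1) (ZMod 3 × ZMod 1)) :=
  hasI_of_translates e (mapDouble cycCoef [((164, 146, 255), 44, 22), ((64, 42, 253), 44, 26)])
    (by simp [Nat.card_eq_fintype_card]; decide +kernel) (by decide +kernel) (by decide +kernel)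

theorem hasI_two_pow_nine (e : ℕ) :
    HasI (Grp (2 ^ (e + 2)) 9 1) (invol (e + 1) (ZMod 9 × ZMod 1)) :=
  hasI_of_translates e (mapDouble cycCoef [
    ((44, 153, 633), 245, 445), ((44, 155, 446), 143, 343), ((44, 135, 655), 443, 243),
    ((42, 44, 743), 55, 35), ((44, 133, 442), 145, 345), ((24, 44, 234), 655, 653)])
    (by simp [Nat.card_eq_fintype_card]; decide +kernel) (by decide +kernel) (by decide +kernel)

theorem exists_dbl_of_even {n : ℕ} (x : ZMod (2 ^ (n + 1))) (h : x.val % 2 = 0) :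
    ∃ y, dbl n y = x := by
  refine ⟨((x.val / 2 : ℕ) : ZMod (2 ^ n)), ?_⟩
  rw [dbl_natCast, show 2 * (x.val / 2) = x.val by omega, ZMod.natCast_zmod_val]

theorem covers_range_compl {U : Type} [AddCommGroup U] [Level U] {n k : ℕ}
    {j : Sd (ZMod (2 ^ (n + 1))) U}
    (h : Covers j {g | ¬(g.t.1.val % 2 = 0 ∧ g.t.2.val % 2 = 0)}
      {g | ¬(g.t.1.val % 2 = 0 ∧ g.t.2.val % 2 = 0)} k) :
    Covers j (Set.range (Sd.map (U := U) (dbl n)))ᶜ (Set.range (Sd.map (U := U) (dbl n)))ᶜ k := by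
  have : (Set.range (Sd.map (U := U) (dbl n)))ᶜ ⊆
      {g | ¬(g.t.1.val % 2 = 0 ∧ g.t.2.val % 2 = 0)} := by
    rintro g hg ⟨h1, h2⟩
    obtain ⟨y, hy⟩ := exists_dbl_of_even _ h1
    obtain ⟨z, hz⟩ := exists_dbl_of_even _ h2
    exact hg ⟨⟨(y, z), g.u⟩, Sd.ext (Prod.ext hy hz) rfl⟩
  exact h.mono this this

theorem starter_two_pow_three (e : ℕ) :
    Starter (Grp (2 ^ (e + 2)) 3 1) (invol (e + 1) (ZMod 3 × ZMod 1)) :=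
  starter_two_pow (by decide +kernel) starter_4_3_1 (by simp) (by simp; rfl)
    (covers_range_compl layer_8_3_1)
    (fun e => covers_of_translates e (mapDouble el [
    ((0, 120, 3120), 120, 2320), ((0, 1200, 1310), 3300, 1300), ((0, 1300, 3110), 3020, 1220),
    ((0, 310, 3300), 300, 2300), ((0, 110, 2100), 3320, 1120), ((0, 100, 2110), 3110, 3310)])
      (by decide +kernel) (by decide +kernel)) e

theorem starter_two_pow_nine (e : ℕ) :
    Starter (Grp (2 ^ (e + 2)) 9 1) (invol (e + 1) (ZMod 9 × ZMod 1)) :=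
  starter_two_pow (by decide +kernel) starter_4_9_1 (by simp) (by simp; rfl)
    (covers_range_compl layer_8_9_1)
    (fun e => covers_of_translates e (mapDouble el [
    ((0, 310, 1310), 1180, 3330), ((0, 3370, 1030), 3100, 3350), ((0, 3160, 1020), 1200, 3060),
    ((0, 2120, 2310), 2140, 2380), ((0, 1130, 1120), 2150, 2310), ((0, 1250, 1040), 1000, 1020),
    ((0, 1230, 1220), 1130, 3370), ((0, 3330, 3200), 2110, 2300), ((0, 1270, 3220), 1070, 3000),
    ((0, 1140, 3150), 3110, 3320), ((0, 3020, 3300), 1220, 3070), ((0, 2100, 1180), 3150, 3170),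
    ((0, 120, 2330), 1010, 1210), ((0, 3100, 3140), 1060, 1080), ((0, 2340, 2130), 1320, 1380),
    ((0, 140, 3170), 1330, 3360), ((0, 3130, 300), 3080, 3220), ((0, 1320, 160), 1120, 3180)])
      (by decide +kernel) (by decide +kernel)) e

/-! ### Relative families over fields in which `-1` is not a square -/

/-- A family of triples in `H` with signs at their points: the cyclic differences cover `H`, and the
points, taken with their signs, cover `H` modulo `j` twice, once for each sign. No triple has three
equal signs. -/
def SignedFamily (H : Type) [Group H] (j : H) : Prop :=
  ∃ (ι : Type) (_ : Fintype ι) (b : ι → Fin 3 → H) (sg : ι → Fin 3 → Bool),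
    3 * Fintype.card ι = Nat.card H ∧ (∀ i, ∃ k, sg i k ≠ sg i (k + 1)) ∧
    (∀ h, ∃ i k, b i k * (b i (k + 1))⁻¹ = h) ∧
    ∀ h s, ∃ i k, sg i k = s ∧ (b i k = h ∨ b i k * j = h)

/-- In the field `F`, the element `-1` is not a square, and there are two nonzero squares `x`, `y`
and a nonsquare `z` with all of `x - y`, `y - z`, `z - x` nonzero squares. -/
def HasSquareTriple (F : Type) [Field F] : Prop :=
  ¬ IsSquare (-1 : F) ∧ ∃ x y z : F, (x ≠ 0 ∧ IsSquare x) ∧ (y ≠ 0 ∧ IsSquare y) ∧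
    ¬ IsSquare z ∧ (x - y ≠ 0 ∧ IsSquare (x - y)) ∧ (y - z ≠ 0 ∧ IsSquare (y - z)) ∧
    (z - x ≠ 0 ∧ IsSquare (z - x))

section Squares

variable {F : Type} [Field F] [Finite F]

/-- The sign of a nonzero element: `false` for squares, `true` for negatives of squares. -/
def HasSign (s : Bool) (x : F) : Prop := x ≠ 0 ∧ IsSquare (if s then -x else x)

omit [Finite F] in
theorem HasSign.neg {s : Bool} {x : F} (h : HasSign s x) : HasSign (!s) (-x) := by
  cases s <;> simpa [HasSign] using h

theorem exists_hasSign (h1 : ¬ IsSquare (-1 : F)) {x : F} (hx : x ≠ 0) : ∃ s, HasSign s x := by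
  have := Fintype.ofFinite F
  classical
  by_cases h : IsSquare x
  · exact ⟨false, hx, by simpa using h⟩
  · refine ⟨true, hx, ?_⟩
    have hc : quadraticChar F (-x) = 1 := by
      have e1 := quadraticChar_neg_one_iff_not_isSquare.2 h
      have e2 := quadraticChar_neg_one_iff_not_isSquare.2 h1
      rw [neg_eq_neg_one_mul, map_mul, e1, e2]; norm_num
    simpa using (quadraticChar_one_iff_isSquare (neg_ne_zero.2 hx)).1 hc

omit [Finite F] in
theorem HasSign.div {s : Bool} {x y : F} (hx : HasSign s x) (hy : HasSign s y) :
    x / y ≠ 0 ∧ IsSquare (x / y) := by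
  refine ⟨div_ne_zero hx.1 hy.1, ?_⟩
  have h := hx.2.div hy.2
  cases s <;> simpa using h

/-- The nonzero elements are the nonzero squares and their negatives. -/
theorem two_mul_card_squares (h1 : ¬ IsSquare (-1 : F)) :
    2 * Nat.card {c : F // c ≠ 0 ∧ IsSquare c} + 1 = Nat.card F := by
  have e : {c : F // c ≠ 0 ∧ IsSquare c} ⊕ {c : F // c ≠ 0 ∧ IsSquare c} ≃ {x : F // x ≠ 0} := by
    refine Equiv.ofBijective (Sum.elim (fun c => ⟨c.1, c.2.1⟩) fun c => ⟨-c.1, neg_ne_zero.2 c.2.1⟩)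
      ⟨?_, ?_⟩
    · have key : ∀ c d : F, c ≠ 0 → IsSquare c → IsSquare d → c ≠ -d := by
        intro c d hc h2 h3 h4
        apply h1
        have h5 : d ≠ 0 := by rintro rfl; simp at h4; exact hc h4
        rw [show (-1 : F) = c / d by rw [h4, neg_div, div_self h5]]
        exact h2.div h3
      rintro (⟨c, hc⟩ | ⟨c, hc⟩) (⟨d, hd⟩ | ⟨d, hd⟩) h <;>
        simp only [Sum.elim_inl, Sum.elim_inr, Subtype.mk.injEq, neg_inj] at h
      · subst h; rfl
      · exact absurd h (key c d hc.1 hc.2 hd.2)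
      · exact absurd h.symm (key d c hd.1 hd.2 hc.2)
      · subst h; rfl
    · rintro ⟨x, hx⟩
      obtain ⟨s, hs⟩ := exists_hasSign h1 hx
      cases s
      · exact ⟨Sum.inl ⟨x, hx, by simpa using hs.2⟩, rfl⟩
      · exact ⟨Sum.inr ⟨-x, neg_ne_zero.2 hx, by simpa using hs.2⟩, by simp⟩
  have h2 := Nat.card_congr e
  have := Fintype.ofFinite F
  classical
  rw [Nat.card_sum, Nat.card_eq_fintype_card (α := {x : F // x ≠ 0}),
    Fintype.card_subtype_compl, Fintype.card_subtype_eq] at h2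
  have : 0 < Fintype.card F := Fintype.card_pos
  rw [Nat.card_eq_fintype_card (α := F)]
  omega

/-- Every non-constant pattern of signs is realised by a triple with square cyclic differences. -/
theorem HasSquareTriple.exists_pattern (h : HasSquareTriple F) (sg : Fin 3 → Bool)
    (hs : ∃ k, sg k ≠ sg (k + 1)) :
    ∃ w : Fin 3 → F, (∀ k, HasSign (sg k) (w k)) ∧ ∀ k, HasSign false (w k - w (k + 1)) := by
  obtain ⟨h1, x, y, z, hx, hy, hz, hxy, hyz, hzx⟩ := h
  have hz0 : z ≠ 0 := by rintro rfl; exact hz (IsSquare.zero)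
  have sx : HasSign false x := by simpa [HasSign] using hx
  have sy : HasSign false y := by simpa [HasSign] using hy
  have sz : HasSign true z := by
    obtain ⟨s, hs⟩ := exists_hasSign h1 hz0
    cases s
    · exact absurd (by simpa using hs.2) hz
    · exact hs
  have dxy : HasSign false (x - y) := by simpa [HasSign] using hxy
  have dyz : HasSign false (y - z) := by simpa [HasSign] using hyz
  have dzx : HasSign false (z - x) := by simpa [HasSign] using hzx
  have nx : HasSign true (-x) := sx.neg
  have ny : HasSign true (-y) := sy.neg
  have nz : HasSign false (-z) := sz.neg
  have e : ∀ a b : F, -a - -b = b - a := fun a b => by ring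
  obtain ⟨a, b, c, rfl⟩ : ∃ a b c, sg = ![a, b, c] :=
    ⟨sg 0, sg 1, sg 2, by ext k; fin_cases k <;> rfl⟩
  have f2 : (2 : Fin 3) + 1 = 0 := rfl
  have f1 : (1 : Fin 3) + 1 = 2 := rfl
  rcases a with _ | _ <;> rcases b with _ | _ <;> rcases c with _ | _
  · simp [Fin.exists_fin_succ] at hs
  · exact ⟨![x, y, z], by simp [Fin.forall_fin_succ, *], by simp [Fin.forall_fin_succ, *]⟩
  · exact ⟨![y, z, x], by simp [Fin.forall_fin_succ, *], by simp [Fin.forall_fin_succ, *]⟩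
  · exact ⟨![-z, -y, -x], by simp [Fin.forall_fin_succ, *],
      by simp only [Fin.forall_fin_succ]; simp [*]⟩
  · exact ⟨![z, x, y], by simp [Fin.forall_fin_succ, *], by simp [Fin.forall_fin_succ, *]⟩
  · exact ⟨![-x, -z, -y], by simp [Fin.forall_fin_succ, *],
      by simp only [Fin.forall_fin_succ]; simp [*]⟩
  · exact ⟨![-y, -x, -z], by simp [Fin.forall_fin_succ, *],
      by simp only [Fin.forall_fin_succ]; simp [*]⟩
  · simp [Fin.exists_fin_succ] at hs

/-- A signed family gives relative families: the triples are paired with triples of field elements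
of the prescribed signs, and multiplied by all nonzero squares. -/
theorem SignedFamily.relFamily {H : Type} [Group H] [Finite H] {j : H} (h : SignedFamily H j)
    (hF : HasSquareTriple F) : RelFamily H j F := by
  obtain ⟨ι, _, b, sg, hcard, hsg, hD, hP⟩ := h
  choose w hw hww using fun i => hF.exists_pattern (sg i) (hsg i)
  have := Fintype.ofFinite {c : F // c ≠ 0 ∧ IsSquare c}
  have hcF := two_mul_card_squares hF.1
  rw [Nat.card_eq_fintype_card] at hcF
  have hne : ∀ k : Fin 3, k ≠ k + 1 := by decide
  refine ⟨Fintype.card {c : F // c ≠ 0 ∧ IsSquare c} * Fintype.card ι, ?_,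
    {c : F // c ≠ 0 ∧ IsSquare c} × ι, inferInstance,
    fun i k => (b i.2 k, Multiplicative.ofAdd (w i.2 k * i.1.1)), by simp, ?_, ?_⟩
  · rw [← hcF, ← hcard]; ring
  · have key : ∀ (g : H) (y : F), HasSign false y → ∃ (i : {c : F // c ≠ 0 ∧ IsSquare c} × ι)
        (k : Fin 3), b i.2 k * (b i.2 (k + 1))⁻¹ = g ∧
          w i.2 k * i.1.1 - w i.2 (k + 1) * i.1.1 = y := by
      intro g y hy
      obtain ⟨i, k, e⟩ := hD g
      refine ⟨(⟨_, hy.div (hww i k)⟩, i), k, e, ?_⟩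
      rw [← sub_mul, mul_div_cancel₀ _ (hww i k).1]
    rintro ⟨g, y⟩ hy
    obtain ⟨s, hs⟩ := exists_hasSign hF.1 (x := y.toAdd) hy
    cases s
    · obtain ⟨i, k, e1, e2⟩ := key g _ hs
      refine ⟨i, k, k + 1, hne k, Prod.ext e1 ?_⟩
      change _ + -_ = y.toAdd
      rw [← sub_eq_add_neg]
      exact e2
    · obtain ⟨i, k, e1, e2⟩ := key g⁻¹ _ hs.neg
      refine ⟨i, k + 1, k, (hne k).symm, Prod.ext ?_ ?_⟩
      · change b i.2 (k + 1) * (b i.2 k)⁻¹ = g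
        rw [← inv_inj, ← e1, mul_inv_rev, inv_inv]
      · change _ + -_ = y.toAdd
        rw [← neg_inj, ← e2]
        change -(w i.2 (k + 1) * i.1.1 + -(w i.2 k * i.1.1)) = _
        ring
  · rintro ⟨g, y⟩ hy
    obtain ⟨s, hs⟩ := exists_hasSign hF.1 (x := y.toAdd) hy
    obtain ⟨i, k, e, h⟩ := hP g s
    have hwk := hw i k
    rw [e] at hwk
    refine ⟨(⟨_, hs.div hwk⟩, i), k, h.imp (fun h => Prod.ext h ?_) fun h => Prod.ext h ?_⟩
    · change _ = y.toAdd
      exact mul_div_cancel₀ _ hwk.1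
    · change _ + 0 = y.toAdd
      rw [add_zero]
      exact mul_div_cancel₀ _ hwk.1

end Squares

/-- The cyclic differences of a list of triples with signs. -/
def cycDiffs {H : Type} [Group H] : List ((H × Bool) × (H × Bool) × (H × Bool)) → List H
  | [] => []
  | (x, y, z) :: L => x.1 * y.1⁻¹ :: y.1 * z.1⁻¹ :: z.1 * x.1⁻¹ :: cycDiffs L

theorem exists_of_mem_cycDiffs {H : Type} [Group H]
    {L : List ((H × Bool) × (H × Bool) × (H × Bool))} {v : H} (h : v ∈ cycDiffs L) :
    ∃ i : Fin L.length, ∃ k, (nth L[i] k).1 * (nth L[i] (k + 1)).1⁻¹ = v := by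
  induction L with
  | nil => simp [cycDiffs] at h
  | cons b L ih =>
    obtain ⟨x, y, z⟩ := b
    simp only [cycDiffs, List.mem_cons] at h
    rcases h with rfl | rfl | rfl | h
    · exact ⟨⟨0, by simp⟩, 0, rfl⟩
    · exact ⟨⟨0, by simp⟩, 1, rfl⟩
    · exact ⟨⟨0, by simp⟩, 2, rfl⟩
    · obtain ⟨i, k, e⟩ := ih h
      exact ⟨⟨i + 1, by simp⟩, k, by simpa using e⟩

/-- A list of triples with signs is a signed family if the bit masks of its cyclic differences and
of its points contain all required codes. -/
theorem signedFamily_of_mask {H : Type} [Group H] [Coded H] (j : H) (hj : j * j = 1)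
    (L : List ((H × Bool) × (H × Bool) × (H × Bool))) (hcard : 3 * L.length = Nat.card H)
    (hsg : ∀ b ∈ L, ∃ k, (nth b k).2 ≠ (nth b (k + 1)).2)
    (hD : ∀ h : H, (mask Coded.code (cycDiffs L)).testBit (Coded.code h))
    (hP : ∀ (h : H) (s : Bool), (mask Coded.code (points L)).testBit (Coded.code (h, s)) ∨
      (mask Coded.code (points L)).testBit (Coded.code (h * j, s))) : SignedFamily H j := by
  refine ⟨Fin L.length, inferInstance, fun i k => (nth L[i] k).1, fun i k => (nth L[i] k).2,
    by simpa using hcard, fun i => hsg _ (List.getElem_mem _), fun h => ?_, fun h s => ?_⟩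
  · exact exists_of_mem_cycDiffs
      (mem_of_testBit_mask (f := (Coded.code : H → ℕ)) Coded.code_inj (hD h))
  · rcases hP h s with h1 | h1
    · obtain ⟨i, k, e⟩ := exists_of_mem_points (mem_of_testBit_mask Coded.code_inj h1)
      exact ⟨i, k, congrArg Prod.snd e, Or.inl (congrArg Prod.fst e)⟩
    · obtain ⟨i, k, e⟩ := exists_of_mem_points (mem_of_testBit_mask Coded.code_inj h1)
      exact ⟨i, k, congrArg Prod.snd e, Or.inr (by
        change (nth L[i] k).1 * j = h
        rw [e, mul_assoc, hj, mul_one])⟩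

/-- Signed families lift from `ℤ[ω]/(4) ⋊ U` to `ℤ[ω]/(2ᵉ⁺²) ⋊ U`. -/
theorem SignedFamily.lift {U : Type} [AddCommGroup U] [Level U] [Finite U] (e : ℕ)
    (h : SignedFamily (Sd (ZMod 4) U) (invol 1 U)) :
    SignedFamily (Sd (ZMod (2 ^ (e + 2))) U) (invol (e + 1) U) := by
  obtain ⟨ι, _, b, sg, hcard, hsg, hD, hP⟩ := h
  obtain ⟨S, _, val, g1, g2, g3⟩ := exists_representatives e
  let φ : Sd (ZMod 4) U →* Sd (ZMod (2 ^ (e + 2))) U := Sd.map (emb e)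
  let ν : ZMod (2 ^ (e + 2)) × ZMod (2 ^ (e + 2)) → Sd (ZMod (2 ^ (e + 2))) U := fun t => ⟨t, 0⟩
  have hν : ∀ t t', ν (t + t') = ν t * ν t' := fun t t' => by refine Sd.ext ?_ ?_ <;> simp [ν]
  have hconj : ∀ g t, g * ν t = ν (rotn (Level.lev g.u) t) * g := fun g t => by
    refine Sd.ext ?_ ?_ <;> simp [ν, add_comm]
  have hdec : ∀ g : Sd (ZMod (2 ^ (e + 2))) U, ∀ m σ, g.t = Prod.map (emb e) (emb e) m + val σ →
      g = ν (val σ) * φ ⟨m, g.u⟩ := by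
    intro g m σ h
    refine Sd.ext ?_ ?_
    · simp [ν, φ, h, add_comm]
    · simp [ν, φ]
  have hφj : φ (invol 1 U) = invol (e + 1) U := by
    refine Sd.ext (Prod.ext ?_ ?_) rfl
    · exact emb_two e
    · exact map_zero (emb e)
  refine ⟨ι × S, inferInstance, fun x k => φ (b x.1 k) * ν (rotn ((k : ℕ) : ZMod 3) (val x.2)),
    fun x => sg x.1, ?_, fun x => hsg x.1, ?_, ?_⟩
  · rw [Fintype.card_prod, ← mul_assoc, hcard, Sd.card, Sd.card, Nat.card_prod, Nat.card_prod,
      Nat.card_zmod, Nat.card_zmod, ← g1]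
    ring
  · intro g
    -- `ω ^ k n - ω ^ (k + 1) n = ω ^ k (1 - ω) n`, and `1 - ω` is invertible
    have h01 : (0 : ZMod 3) ≠ 1 := by decide
    obtain ⟨t, ht⟩ := exists_rotn_sub (three_surjective (e + 2)) h01 g.t
    obtain ⟨m, σ, hm⟩ := g3 t
    obtain ⟨i, k, hik⟩ := hD ⟨rotn 0 m - rotn 1 m, g.u⟩
    obtain ⟨σ', hσ⟩ := g2 (-(Level.lev (b i k).u + ((k : ℕ) : ZMod 3))) σ
    refine ⟨(i, σ'), k, ?_⟩
    have hk : (((k + 1 : Fin 3) : ℕ) : ZMod 3) = ((k : ℕ) : ZMod 3) + 1 := by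
      have : ∀ k : Fin 3, (((k + 1 : Fin 3) : ℕ) : ZMod 3) = ((k : ℕ) : ZMod 3) + 1 := by decide
      exact this k
    have hνn : ∀ t, (ν t)⁻¹ = ν (-t) := fun t => inv_eq_of_mul_eq_one_right (by
      rw [← hν]; simp [ν]; rfl)
    simp only
    rw [mul_inv_rev, hνn, mul_assoc, ← mul_assoc (ν _), ← hν, ← mul_assoc, hconj, mul_assoc,
      ← map_inv, ← map_mul, hik, hσ, hk, rotn_rotn, rotn_rotn, ← sub_eq_add_neg, rotn_sub,
      rotn_rotn, rotn_rotn]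
    refine Sd.ext ?_ ?_
    · have e1 : (φ (b i k)).u = (b i k).u := rfl
      have e2 : ∀ x y : ZMod 3, x + (y + -(x + y)) = 0 := by decide
      have e3 : ∀ x y : ZMod 3, x + (y + 1 + -(x + y)) = 1 := by decide
      simp only [Sd.mul_t, ν, φ, map_zero, rotn_zero, Sd.map_t, Sd.map_u, e2, e3]
      rw [← ht, hm, rotn_zero, rotn_add, rotn_prodMap]
      ext <;> simp <;> abel
    · simp [ν, φ]
  · intro g s
    obtain ⟨m, σ, hm⟩ := g3 g.t
    obtain ⟨i, k, hs, hik⟩ := hP ⟨m, g.u⟩ s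
    obtain ⟨σ', hσ⟩ := g2 (-(Level.lev (b i k).u + ((k : ℕ) : ZMod 3))) σ
    have e0 : φ (b i k) * ν (rotn ((k : ℕ) : ZMod 3) (val σ')) = ν (val σ) * φ (b i k) := by
      have e1 : (φ (b i k)).u = (b i k).u := rfl
      have e2 : ∀ x y : ZMod 3, x + (y + -(x + y)) = 0 := by decide
      rw [hσ, hconj, rotn_rotn, rotn_rotn, e1, add_assoc, e2, rotn_zero]
    refine ⟨(i, σ'), k, hs, ?_⟩
    simp only
    rw [e0, hdec g m σ hm, ← hφj, mul_assoc, ← map_mul]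
    exact hik.imp (fun h => by rw [h]) fun h => by rw [h]

/-! ### Signed families in small groups -/

/-- Decoding of a table entry: the last decimal digit is the sign, and the digits before it give the
element of the group. -/
def elSign {q m m' : ℕ} (n : ℕ) : Grp q m m' × Bool := (el (n / 10), n % 10 == 1)

theorem signedFamily_2_9_1 : SignedFamily (Grp 2 9 1) (el 1000) :=
  signedFamily_of_mask _ (by decide +kernel) (mapTriples elSign [
    (1600, 1801, 201), (11500, 11401, 1701), (11801, 600, 1400), (10200, 10300, 10201),
    (11601, 10601, 10400), (1101, 11700, 10800), (10301, 1000, 10100), (501, 11101, 200),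
    (1100, 10001, 10501), (10701, 11301, 700), (1500, 1401, 800), (1300, 1001, 10000)])
    (by simp [Nat.card_eq_fintype_card]; decide +kernel) (by decide +kernel) (by decide +kernel)
    (by decide +kernel)

theorem signedFamily_2_9_3 : SignedFamily (Grp 2 9 3) (el 1000) :=
  signedFamily_of_mask _ (by decide +kernel) (mapTriples elSign [
    (11821, 10120, 11421), (11201, 10410, 11720), (11400, 10620, 11011), (300, 10201, 501),
    (701, 10610, 20), (11300, 11221, 1510), (11110, 811, 1610), (11021, 700, 1511),
    (11521, 311, 1100), (1620, 720, 1621), (10010, 10100, 10021), (1400, 511, 1420),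
    (11010, 10011, 10710), (1101, 111, 11820), (11510, 10500, 10321), (10721, 421, 520),
    (210, 10820, 1001), (1711, 11401, 10520), (10001, 1600, 10701), (500, 11211, 11321),
    (10221, 1810, 10000), (601, 11200, 301), (11320, 10811, 11000), (10501, 110, 10220),
    (10411, 11311, 810), (1721, 10600, 10210), (10711, 11601, 220), (11800, 1401, 1800),
    (1120, 10611, 11101), (11801, 1410, 1821), (1411, 1310, 710), (1020, 1801, 310),
    (10700, 621, 11111), (11420, 11121, 121), (1611, 1301, 10320), (1521, 1200, 10211)])
    (by simp [Nat.card_eq_fintype_card]; decide +kernel) (by decide +kernel) (by decide +kernel)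
    (by decide +kernel)

theorem signedFamily_4_3_1 : SignedFamily (Grp 4 3 1) (el 2000) :=
  signedFamily_of_mask _ (by decide +kernel) (mapTriples elSign [
    (13000, 2000, 101), (11000, 2001, 200), (3000, 33001, 201), (3001, 20000, 33100),
    (20001, 31001, 33200), (31101, 1100, 10000), (10001, 32000, 100), (22100, 22101, 33201),
    (20201, 12200, 21001), (20200, 3201, 12001), (30201, 31200, 11100), (12100, 11101, 10201),
    (10101, 23101, 1000), (30101, 32100, 10200), (1200, 13201, 1101), (23201, 3200, 21100)])
    (by simp [Nat.card_eq_fintype_card]; decide +kernel) (by decide +kernel) (by decide +kernel)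
    (by decide +kernel)

theorem signedFamily_4_9_1 : SignedFamily (Grp 4 9 1) (el 2000) :=
  signedFamily_of_mask _ (by decide +kernel) (mapTriples elSign [
    (32401, 22600, 21000), (23501, 1701, 22100), (13500, 32701, 11100), (30501, 22700, 23101),
    (23400, 300, 12601), (1400, 22301, 32600), (2401, 10300, 601), (21100, 2000, 30301),
    (32800, 11601, 31401), (33001, 22701, 23500), (33200, 20000, 21701), (1401, 21201, 12000),
    (33500, 23600, 33501), (32101, 12200, 12100), (501, 33600, 2500), (21800, 2001, 3801),
    (30000, 11001, 3700), (12300, 11300, 1101), (30601, 31600, 23401), (22300, 1300, 22101),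
    (30801, 22500, 20600), (21601, 33301, 32400), (12401, 2100, 2201), (32100, 2701, 20801),
    (23801, 10500, 22601), (31200, 801, 23001), (10801, 21500, 30600), (200, 33801, 11000),
    (3601, 23201, 3300), (11400, 12001, 31101), (10700, 20301, 12400), (11401, 10001, 33100),
    (31301, 21200, 13700), (31201, 3100, 33601), (20501, 2400, 21001), (11701, 1600, 33201),
    (33300, 1800, 23301), (12201, 31700, 20200), (33000, 21501, 3000), (20800, 20401, 12800),
    (10501, 20400, 13800), (33400, 12301, 12701), (20001, 11800, 21301), (32200, 101, 13501),
    (201, 800, 13801), (12101, 30700, 23700), (13101, 33701, 700), (30500, 32201, 23200)])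
    (by simp [Nat.card_eq_fintype_card]; decide +kernel) (by decide +kernel) (by decide +kernel)
    (by decide +kernel)

theorem signedFamily_two_pow_three (e : ℕ) :
    SignedFamily (Grp (2 ^ (e + 2)) 3 1) (invol (e + 1) (ZMod 3 × ZMod 1)) :=
  SignedFamily.lift e signedFamily_4_3_1

theorem signedFamily_two_pow_nine (e : ℕ) :
    SignedFamily (Grp (2 ^ (e + 2)) 9 1) (invol (e + 1) (ZMod 9 × ZMod 1)) :=
  SignedFamily.lift e signedFamily_4_9_1

/-- The field `ℤ/p` has a square triple when `p ≥ 7` is a prime congruent to `3` modulo `4`. -/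
theorem hasSquareTriple_zmod {p : ℕ} [Fact p.Prime] (hp : p % 4 = 3) (h7 : 7 ≤ p) :
    HasSquareTriple (ZMod p) := by
  have h1 : ¬ IsSquare (-1 : ZMod p) := by
    rw [ZMod.exists_sq_eq_neg_one_iff]
    simpa using hp
  have hsmall : ∀ n : ℕ, 0 < n → n < p → (n : ZMod p) ≠ 0 := by
    intro n h0 hn h
    rw [ZMod.natCast_eq_zero_iff] at h
    exact absurd (Nat.le_of_dvd h0 h) (by omega)
  have hneg : ∀ x : ZMod p, x ≠ 0 → ¬ IsSquare x → IsSquare (-x) := by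
    intro x hx hs
    obtain ⟨s, h⟩ := exists_hasSign h1 hx
    cases s
    · exact absurd (by simpa using h.2) hs
    · simpa using h.2
  have h2 : (2 : ZMod p) ≠ 0 := by exact_mod_cast hsmall 2 (by norm_num) (by omega)
  have h3 : (3 : ZMod p) ≠ 0 := by exact_mod_cast hsmall 3 (by norm_num) (by omega)
  have h4 : (4 : ZMod p) ≠ 0 := by exact_mod_cast hsmall 4 (by norm_num) (by omega)
  have s4 : IsSquare (4 : ZMod p) := ⟨2, by norm_num⟩
  refine ⟨h1, ?_⟩
  by_cases s2 : IsSquare (2 : ZMod p)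
  · -- `N` is the least nonsquare
    have hex : ∃ n : ℕ, 0 < n ∧ ¬ IsSquare (n : ZMod p) :=
      ⟨p - 1, by omega, by rw [Nat.cast_sub (by omega)]; simpa using h1⟩
    classical
    obtain ⟨N, hN, hmin⟩ : ∃ N : ℕ, (0 < N ∧ ¬ IsSquare (N : ZMod p)) ∧
        ∀ n < N, 0 < n → IsSquare (n : ZMod p) :=
      ⟨Nat.find hex, Nat.find_spec hex, fun n hn h0 => by
        have := Nat.find_min hex hn
        tauto⟩
    have hNp : N ≤ p - 1 := by
      by_contra h
      have := hmin (p - 1) (by omega) (by omega)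
      rw [Nat.cast_sub (by omega)] at this
      exact h1 (by simpa using this)
    have hN3 : 3 ≤ N := by
      by_contra h
      have : N = 1 ∨ N = 2 := by omega
      rcases this with rfl | rfl
      · exact hN.2 (by simp)
      · exact hN.2 (by simpa using s2)
    have e1 : ((N - 1 : ℕ) : ZMod p) = N - 1 := by rw [Nat.cast_sub (by omega)]; simp
    have e2 : ((N - 2 : ℕ) : ZMod p) = N - 2 := by rw [Nat.cast_sub (by omega)]; simp
    have n0 := hsmall N (by omega) (by omega)
    have n1 := hsmall (N - 1) (by omega) (by omega)
    have n2 := hsmall (N - 2) (by omega) (by omega)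
    have t1 := hmin (N - 1) (by omega) (by omega)
    have t2 := hmin (N - 2) (by omega) (by omega)
    rw [e1] at n1 t1
    rw [e2] at n2 t2
    refine ⟨N - 1, 1, -1, ⟨n1, t1⟩, ⟨one_ne_zero, ⟨1, by simp⟩⟩, h1, ?_, ?_, ?_⟩
    · rw [show (N - 1 - 1 : ZMod p) = N - 2 by ring]; exact ⟨n2, t2⟩
    · rw [show (1 - -1 : ZMod p) = 2 by ring]; exact ⟨h2, s2⟩
    · rw [show (-1 - (N - 1) : ZMod p) = -N by ring]
      exact ⟨neg_ne_zero.2 n0, hneg _ n0 hN.2⟩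
  · have s2' := hneg 2 h2 s2
    by_cases s3 : IsSquare (3 : ZMod p)
    · refine ⟨1, 3, -1, ⟨one_ne_zero, ⟨1, by simp⟩⟩, ⟨h3, s3⟩, h1, ?_, ?_, ?_⟩
      · rw [show (1 - 3 : ZMod p) = -2 by ring]; exact ⟨neg_ne_zero.2 h2, s2'⟩
      · rw [show (3 - -1 : ZMod p) = 4 by ring]; exact ⟨h4, s4⟩
      · rw [show (-1 - 1 : ZMod p) = -2 by ring]; exact ⟨neg_ne_zero.2 h2, s2'⟩
    · refine ⟨1, -3, -1, ⟨one_ne_zero, ⟨1, by simp⟩⟩, ⟨neg_ne_zero.2 h3, hneg 3 h3 s3⟩, h1,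
        ?_, ?_, ?_⟩
      · rw [show (1 - -3 : ZMod p) = 4 by ring]; exact ⟨h4, s4⟩
      · rw [show (-3 - -1 : ZMod p) = -2 by ring]; exact ⟨neg_ne_zero.2 h2, s2'⟩
      · rw [show (-1 - 1 : ZMod p) = -2 by ring]; exact ⟨neg_ne_zero.2 h2, s2'⟩

/-! ### Existence of 3-pyramidal Kirkman triple systems -/

/-- In the group of order six no base triples are needed. -/
theorem starter_dihedral : Starter (DihedralGroup 3) (.sr 0) := by
  refine ⟨inferInstance, by decide, by decide, .r 1, fun l => .r ((l : ℕ) : ZMod 3), 0, by decide,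
    by decide, by decide, by decide, by simp [Nat.card_eq_fintype_card, DihedralGroup.card],
    Empty, inferInstance, Empty.elim, rfl, ?_, ?_⟩
  · have : ∀ g : DihedralGroup 3, ¬(g ≠ .r 1 ∧ g ≠ .r 1 * .r 1 ∧ g * g ≠ 1) := by decide
    exact fun d hd => absurd hd (this d)
  · have : ∀ g : DihedralGroup 3, ¬∀ l : Fin 3,
        g ≠ .r ((l : ℕ) : ZMod 3) ∧ g ≠ .r ((l : ℕ) : ZMod 3) * .sr 0 := by decide
    exact fun d hd => absurd hd (this d)

theorem mod_four_of_odd_prime {p N : ℕ} (hN : Odd N) (ho : Odd (N.factorization p)) :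
    p % 4 = 1 ∨ p % 4 = 3 := by
  have h1 : p ∣ N := by
    by_contra h
    rw [Nat.factorization_eq_zero_of_not_dvd h] at ho
    simp at ho
  have h2 := hN.of_dvd_nat h1
  rw [Nat.odd_iff] at h2
  omega

/-- With both kinds of relative families available, the exponent of `3` is the only obstruction. -/
theorem Starter.reach {H : Type} [Group H] {j : H} (h1 : Starter H j) (hI : HasI H j)
    (hS : SignedFamily H j) {N : ℕ} (hN : Odd N) (h3 : Even (N.factorization 3)) : Reach H j N := by
  have := h1.1
  refine reach_of_factorization h1 hI (fun p => 5 ≤ p ∧ (p % 4 = 1 ∨ p % 4 = 3)) ?_ N hN ?_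
  · rintro p _ ⟨h5, hp | hp⟩
    · exact ⟨h5, hI.rel (by rwa [Nat.card_zmod])⟩
    · exact ⟨h5, hS.relFamily (hasSquareTriple_zmod hp (by omega))⟩
  · intro p hp ho
    have h4 := mod_four_of_odd_prime hN ho
    have : p ≠ 3 := by
      rintro rfl
      exact (Nat.not_even_iff_odd.2 ho) h3
    have := hp.two_le
    exact ⟨by omega, h4⟩

theorem odd_factorization_three_div {N M : ℕ} (hN : Odd N) (h : N = 3 * M) :
    Odd M ∧ N.factorization 3 = M.factorization 3 + 1 := by
  subst h
  have h2 := (Nat.odd_mul.1 hN).2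
  refine ⟨h2, ?_⟩
  have : M ≠ 0 := by rintro rfl; simp at h2
  rw [Nat.factorization_mul (by norm_num) this, Nat.Prime.factorization Nat.prime_three]
  simp [add_comm]

/-- The negative of an element of order three, which exists if `3` divides `p - 1`. -/
theorem exists_sixth_root {p : ℕ} [Fact p.Prime] (hp : p % 3 = 1) :
    ∃ ρ : ZMod p, ρ * ρ = ρ - 1 := by
  have h3 : Fact (Nat.Prime 3) := ⟨Nat.prime_three⟩
  obtain ⟨u, hu⟩ := exists_prime_orderOf_dvd_card' (G := (ZMod p)ˣ) 3 (by
    rw [Nat.card_eq_fintype_card, ZMod.card_units]; omega)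
  have h1 : (u : ZMod p) ^ 3 = 1 := by
    rw [← Units.val_pow_eq_pow_val, ← hu, pow_orderOf_eq_one, Units.val_one]
  have h2 : (u : ZMod p) - 1 ≠ 0 := by
    intro h
    have : u = 1 := Units.ext (by simpa [sub_eq_zero] using h)
    rw [this, orderOf_one] at hu
    norm_num at hu
  refine ⟨-u, mul_left_cancel₀ h2 ?_⟩
  linear_combination h1

/-- The primes congruent to `3` modulo `4` have even exponent in a sum of two squares, so only
fields of order `1` modulo `4` are needed over the dihedral group of order six. -/
theorem exists_24n_add_9 (n : ℕ) (h : ∃ a b : ℤ, 4 * (n : ℤ) + 1 = a ^ 2 + b ^ 2) :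
    ExistsPyramidalKTS 3 (24 * n + 9) := by
  have h1 : ∃ x y : ℕ, 4 * n + 1 = x ^ 2 + y ^ 2 := by
    obtain ⟨a, b, h⟩ := h
    refine ⟨a.natAbs, b.natAbs, ?_⟩
    zify
    simpa using h
  have hN : Odd (4 * n + 1) := ⟨2 * n, by ring⟩
  have hr : Reach (DihedralGroup 3) (.sr 0) (4 * n + 1) := by
    refine reach_of_factorization starter_dihedral hasI_dihedral (fun p => 5 ≤ p ∧ p % 4 = 1)
      ?_ _ hN ?_
    · rintro p _ ⟨h5, hp⟩
      exact ⟨h5, hasI_dihedral.rel (by rwa [Nat.card_zmod])⟩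
    · intro p hp ho
      have h4 := mod_four_of_odd_prime hN ho
      have h5 : p % 4 ≠ 3 := by
        intro h3
        have hd : p ∣ 4 * n + 1 := by
          by_contra h
          rw [Nat.factorization_eq_zero_of_not_dvd h] at ho
          simp at ho
        have := Nat.eq_sq_add_sq_iff.1 h1 p (Nat.mem_primeFactors.2 ⟨hp, hd, by omega⟩) h3
        rw [← Nat.factorization_def _ hp] at this
        exact (Nat.not_even_iff_odd.2 ho) this
      have := hp.two_le
      omega
  have := hr.existsPyramidalKTS
  rw [Nat.card_eq_fintype_card, DihedralGroup.card] at this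
  rwa [show 24 * n + 9 = 2 * 3 * (4 * n + 1) + 3 by ring]

/-- The group `H` has order `12`, `36` or `108` according as the exponent of `3` in `2 n + 1` is
zero, odd, or even and positive. In the last two cases every prime is available; in the first case
the primes of odd exponent must be `1` modulo `4` or modulo `3`. -/
theorem exists_24n_add_15 (n : ℕ) (h : 3 ∣ 2 * n + 1 ∨
    ∀ p : ℕ, p.Prime → p ∣ squarefreePart (2 * n + 1) → ¬ p ≡ 11 [MOD 12]) :
    ExistsPyramidalKTS 3 (24 * n + 15) := by
  have hN : Odd (2 * n + 1) := ⟨n, rfl⟩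
  by_cases h3 : 3 ∣ 2 * n + 1
  · obtain ⟨M, hM⟩ := h3
    obtain ⟨hMo, hf⟩ := odd_factorization_three_div hN hM
    by_cases he : Even (M.factorization 3)
    · have := (starter_2_9_1.reach hasI_2_9_1 signedFamily_2_9_1 hMo he).existsPyramidalKTS
      rw [Sd.card, Nat.card_prod, Nat.card_prod, Nat.card_zmod, Nat.card_zmod,
        Nat.card_zmod] at this
      rwa [show 24 * n + 15 = 2 * 2 * (9 * 1) * M + 3 by omega]
    · have hd : 3 ∣ M := by
        by_contra h
        rw [Nat.factorization_eq_zero_of_not_dvd h] at he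
        simp at he
      obtain ⟨M', hM'⟩ := hd
      obtain ⟨hMo', hf'⟩ := odd_factorization_three_div hMo hM'
      have he' : Even (M'.factorization 3) := by
        rw [hf', Nat.even_add_one, not_not] at he
        exact he
      have := (starter_2_9_3.reach hasI_2_9_3 signedFamily_2_9_3 hMo' he').existsPyramidalKTS
      rw [Sd.card, Nat.card_prod, Nat.card_prod, Nat.card_zmod, Nat.card_zmod,
        Nat.card_zmod] at this
      rwa [show 24 * n + 15 = 2 * 2 * (9 * 3) * M' + 3 by omega]
  · have hr : Reach (Grp 2 3 1) (el 1000) (2 * n + 1) := by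
      refine reach_of_factorization starter_2_3_1 hasI_2_3_1
        (fun p => 5 ≤ p ∧ (p % 4 = 1 ∨ p % 3 = 1)) ?_ _ hN ?_
      · rintro p _ ⟨h5, hp | hp⟩
        · exact ⟨h5, hasI_2_3_1.rel (by rwa [Nat.card_zmod])⟩
        · obtain ⟨ρ, hρ⟩ := exists_sixth_root hp
          refine ⟨h5, relFamily_of_sixth_root ρ hρ ?_ ?_⟩
          · intro h
            have := (ZMod.natCast_eq_zero_iff 2 p).1 (by exact_mod_cast h)
            exact absurd (Nat.le_of_dvd (by norm_num) this) (by omega)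
          · intro h
            have := (ZMod.natCast_eq_zero_iff 3 p).1 (by exact_mod_cast h)
            exact absurd (Nat.le_of_dvd (by norm_num) this) (by omega)
      · intro p hp ho
        have h4 := mod_four_of_odd_prime hN ho
        have hd : p ∣ 2 * n + 1 := by
          by_contra h
          rw [Nat.factorization_eq_zero_of_not_dvd h] at ho
          simp at ho
        have h11 : ¬ p % 12 = 11 := h.resolve_left h3 p hp (Finset.dvd_prod_of_mem (fun p => p)
          (Finset.mem_filter.2 ⟨Nat.mem_primeFactors.2 ⟨hp, hd, by omega⟩, ho⟩))
        have hp3 : p ≠ 3 := by rintro rfl; exact h3 hd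
        have hp3' : ¬ 3 ∣ p := fun h =>
          hp3 ((Nat.prime_dvd_prime_iff_eq Nat.prime_three hp).1 h).symm
        have := hp.two_le
        omega
    have := hr.existsPyramidalKTS
    rw [Sd.card, Nat.card_prod, Nat.card_prod, Nat.card_zmod, Nat.card_zmod, Nat.card_zmod] at this
    rwa [show 24 * n + 15 = 2 * 2 * (3 * 1) * (2 * n + 1) + 3 by ring]

/-- The group `H` is `ℤ[ω]/(2ᵉ⁺²) ⋊ ℤ/3` or `ℤ[ω]/(2ᵉ⁺²) ⋊ ℤ/9`, according to the parity of the
exponent of `3` in `m`. -/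
theorem exists_48n_add_3 (n : ℕ) (h : ∃ e m : ℕ, n = 4 ^ e * m ∧ Odd m) :
    ExistsPyramidalKTS 3 (48 * n + 3) := by
  obtain ⟨e, m, rfl, hm⟩ := h
  have h4 : 2 ^ (e + 2) * 2 ^ (e + 2) = 16 * 4 ^ e := by
    rw [← mul_pow, pow_add]; norm_num [mul_comm]
  by_cases he : Even (m.factorization 3)
  · have := ((starter_two_pow_three e).reach (hasI_two_pow_three e)
      (signedFamily_two_pow_three e) hm he).existsPyramidalKTS
    rw [Sd.card, Nat.card_prod, Nat.card_prod, Nat.card_zmod, Nat.card_zmod, Nat.card_zmod,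
      h4] at this
    rwa [show 48 * (4 ^ e * m) + 3 = 16 * 4 ^ e * (3 * 1) * m + 3 by ring]
  · have hd : 3 ∣ m := by
      by_contra h
      rw [Nat.factorization_eq_zero_of_not_dvd h] at he
      simp at he
    obtain ⟨m', hm'⟩ := hd
    obtain ⟨hmo', hf'⟩ := odd_factorization_three_div hm hm'
    have he' : Even (m'.factorization 3) := by
      rw [hf', Nat.even_add_one, not_not] at he
      exact he
    have := ((starter_two_pow_nine e).reach (hasI_two_pow_nine e)
      (signedFamily_two_pow_nine e) hmo' he').existsPyramidalKTS
    rw [Sd.card, Nat.card_prod, Nat.card_prod, Nat.card_zmod, Nat.card_zmod, Nat.card_zmod,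
      h4] at this
    rwa [hm', show 48 * (4 ^ e * (3 * m')) + 3 = 16 * 4 ^ e * (9 * 1) * m' + 3 by ring]

/-! ### The group of a 3-pyramidal Kirkman triple system -/

namespace KirkmanTripleSystem

variable {V : Type} (K : KirkmanTripleSystem V)

/-- The points `x`, `y`, `z` are distinct and form a block. -/
def IsTriple (x y z : V) : Prop :=
  x ≠ y ∧ x ≠ z ∧ y ≠ z ∧ ∃ b ∈ K.blocks, x ∈ b ∧ y ∈ b ∧ z ∈ b

variable {K}

theorem IsTriple.swap {x y z : V} (h : K.IsTriple x y z) : K.IsTriple y x z := by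
  obtain ⟨h1, h2, h3, b, hb, hx, hy, hz⟩ := h
  exact ⟨h1.symm, h3, h2, b, hb, hy, hx, hz⟩

theorem IsTriple.rotate {x y z : V} (h : K.IsTriple x y z) : K.IsTriple y z x := by
  obtain ⟨h1, h2, h3, b, hb, hx, hy, hz⟩ := h
  exact ⟨h3, h1.symm, h2.symm, b, hb, hy, hz, hx⟩

theorem IsTriple.swap_right {x y z : V} (h : K.IsTriple x y z) : K.IsTriple x z y :=
  h.swap.rotate

theorem block_unique {b b' : Finset V} (hb : b ∈ K.blocks) (hb' : b' ∈ K.blocks) {x y : V}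
    (h : x ≠ y) (hx : x ∈ b) (hy : y ∈ b) (hx' : x ∈ b') (hy' : y ∈ b') : b = b' :=
  (K.existsUnique_block x y h).unique ⟨hb, hx, hy⟩ ⟨hb', hx', hy'⟩

theorem exists_third {b : Finset V} (hb : b ∈ K.blocks) {x y : V} (h : x ≠ y) (hx : x ∈ b)
    (hy : y ∈ b) : ∃ z, K.IsTriple x y z ∧ z ∈ b := by
  classical
  obtain ⟨z, hz, h1⟩ := Finset.exists_mem_notMem_of_card_lt_card (s := {x, y}) (t := b) (by
    rw [K.card_eq_three b hb, Finset.card_pair h]; norm_num)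
  simp only [Finset.mem_insert, Finset.mem_singleton, not_or] at h1
  exact ⟨z, ⟨h, Ne.symm h1.1, Ne.symm h1.2, b, hb, hx, hy, hz⟩, hz⟩

theorem exists_isTriple {x y : V} (h : x ≠ y) : ∃ z, K.IsTriple x y z := by
  obtain ⟨b, ⟨hb, hx, hy⟩, -⟩ := K.existsUnique_block x y h
  obtain ⟨z, hz, -⟩ := exists_third hb h hx hy
  exact ⟨z, hz⟩

theorem eq_of_mem {b : Finset V} (hb : b ∈ K.blocks) {x y z t : V} (h1 : x ≠ y) (h2 : x ≠ z)
    (h3 : y ≠ z) (hx : x ∈ b) (hy : y ∈ b) (hz : z ∈ b) (ht : t ∈ b) : t = x ∨ t = y ∨ t = z := by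
  classical
  have : ({x, y, z} : Finset V) = b := Finset.eq_of_subset_of_card_le
    (by intro u; simp only [Finset.mem_insert, Finset.mem_singleton]
        rintro (rfl | rfl | rfl) <;> assumption)
    (by rw [K.card_eq_three b hb, Finset.card_eq_three.2 ⟨x, y, z, h1, h2, h3, rfl⟩])
  rw [← this] at ht
  simpa using ht

theorem IsTriple.eq {x y z t : V} (h : K.IsTriple x y z) (h' : K.IsTriple x y t) : z = t := by
  obtain ⟨h1, h2, h3, b, hb, hx, hy, hz⟩ := h
  obtain ⟨-, h2', h3', b', hb', hx', hy', ht⟩ := h'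
  rw [← block_unique hb hb' h1 hx hy hx' hy'] at ht
  rcases eq_of_mem hb h1 h2 h3 hx hy hz ht with rfl | rfl | rfl
  · exact absurd rfl h2'
  · exact absurd rfl h3'
  · rfl

theorem IsAutomorphism.mapClass_mem {σ : Equiv.Perm V} (hσ : K.IsAutomorphism σ)
    {P : Set (Finset V)} (hP : P ∈ K.resolution) : mapClass σ P ∈ K.resolution := by
  have : mapClass σ P ∈ mapClass σ '' K.resolution := ⟨P, hP, rfl⟩
  rwa [hσ] at this

theorem IsAutomorphism.map_mem {σ : Equiv.Perm V} (hσ : K.IsAutomorphism σ) {b : Finset V}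
    (hb : b ∈ K.blocks) : b.map σ.toEmbedding ∈ K.blocks := by
  obtain ⟨P, ⟨hP, hbP⟩, -⟩ := K.existsUnique_class b hb
  exact K.subset_blocks _ (hσ.mapClass_mem hP) ⟨b, hbP, rfl⟩

theorem IsAutomorphism.isTriple {σ : Equiv.Perm V} (hσ : K.IsAutomorphism σ) {x y z : V}
    (h : K.IsTriple x y z) : K.IsTriple (σ x) (σ y) (σ z) := by
  obtain ⟨h1, h2, h3, b, hb, hx, hy, hz⟩ := h
  refine ⟨σ.injective.ne h1, σ.injective.ne h2, σ.injective.ne h3, _, hσ.map_mem hb, ?_, ?_, ?_⟩ <;>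
    exact Finset.mem_map_of_mem σ.toEmbedding (by assumption)

/-- The points are partitioned by any class of the resolution. -/
theorem three_dvd_card [Fintype V] (h : 2 ≤ Fintype.card V) (K : KirkmanTripleSystem V) :
    3 ∣ Fintype.card V := by
  classical
  have : Nontrivial V := Fintype.one_lt_card_iff_nontrivial.1 h
  obtain ⟨x, y, hxy⟩ := exists_pair_ne V
  obtain ⟨b, ⟨hb, -⟩, -⟩ := K.existsUnique_block x y hxy
  obtain ⟨P, ⟨hP, -⟩, -⟩ := K.existsUnique_class b hb
  choose f hf hu using fun x => K.parallel P hP x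
  have h1 := Finset.card_eq_sum_card_fiberwise (s := (Finset.univ : Finset V))
    (t := Finset.univ.image f) (f := f)
    (fun x hx => Finset.mem_coe.2 (Finset.mem_image_of_mem f hx))
  rw [← Finset.card_univ, h1]
  refine Finset.dvd_sum fun c hc => ?_
  obtain ⟨z, -, rfl⟩ := Finset.mem_image.1 hc
  have : Finset.univ.filter (fun a => f a = f z) = f z := by
    ext a
    simp only [Finset.mem_filter, Finset.mem_univ, true_and]
    constructor
    · intro h
      rw [← h]
      exact (hf a).2
    · intro h
      exact (hu a _ ⟨(hf z).1, h⟩).symm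
  rw [this, K.card_eq_three _ (K.subset_blocks P hP (hf z).1)]

end KirkmanTripleSystem

/-- What is needed of the group of a 3-pyramidal Kirkman triple system: it has exactly three
involutions `x l`, they are conjugate, and there is a map `t` on the other nontrivial elements such
that `{1, g, t g}` is (in an identification of the moved points with `G`) the block through `1`
and `g`. -/
def PyramidalGroup (G : Type) [Group G] : Prop :=
  Finite G ∧ 3 ∣ Nat.card G ∧ (∃ x : Fin 3 → G, Function.Injective x ∧
    (∀ g, (g * g = 1 ∧ g ≠ 1) ↔ ∃ l, x l = g) ∧ ∀ l m, ∃ g, g * x l * g⁻¹ = x m) ∧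
  ∃ t : G → G, ∀ g, g * g ≠ 1 →
    t g ≠ g ∧ t g * t g ≠ 1 ∧ t (t g) = g ∧ t g⁻¹ = g⁻¹ * t g

namespace KirkmanTripleSystem

/-- The block through a fixed point `i` and a moved point `x` is `{i, x, σ x}` for an involution
`σ`, and every involution occurs in this way for each `x`. The class containing this block is
invariant under `σ`, so its blocks through the other fixed points `i'` have the form `{i', x', σ
x'}` with the same `σ`; translating `x'` to `x` shows that the involutions are conjugate. -/
theorem IsPyramidal.exists_group {V : Type} [Fintype V] {K : KirkmanTripleSystem V}
    (hK : K.IsPyramidal 3) (hV : 3 < Fintype.card V) :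
    ∃ (G : Type) (_ : Group G), PyramidalGroup G ∧ Fintype.card V = Nat.card G + 3 := by
  classical
  obtain ⟨G, hG, F, hF, hfix, htr⟩ := hK
  obtain ⟨x₀, hx₀⟩ : ∃ x₀, x₀ ∉ F := by
    by_contra! h
    have := Finset.card_le_card (fun x _ => h x : (Finset.univ : Finset V) ⊆ F)
    rw [Finset.card_univ] at this
    omega
  have hG' : ∀ σ : G, K.IsAutomorphism σ := fun σ => hG σ.1 σ.2
  have hfix' : ∀ σ : G, ∀ x ∈ F, σ.1 x = x := fun σ => hfix σ.1 σ.2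
  have hmov : ∀ (σ : G) x, x ∉ F → σ.1 x ∉ F := fun σ x hx h =>
    hx (by rwa [σ.1.injective (hfix' σ _ h)] at h)
  have hsharp : ∀ (σ τ : G) x, x ∉ F → σ.1 x = τ.1 x → σ = τ := fun σ τ x hx h =>
    Subtype.ext ((htr x (τ.1 x) hx (hmov τ x hx)).unique ⟨σ.2, h⟩ ⟨τ.2, rfl⟩)
  have hex : ∀ x y, x ∉ F → y ∉ F → ∃ σ : G, σ.1 x = y := fun x y hx hy => by
    obtain ⟨σ, ⟨h1, h2⟩, -⟩ := htr x y hx hy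
    exact ⟨⟨σ, h1⟩, h2⟩
  have hfree : ∀ (σ : G) x, σ ≠ 1 → x ∉ F → σ.1 x ≠ x := fun σ x h hx h' =>
    h (hsharp σ 1 x hx h')
  have hcard : Fintype.card V = Nat.card G + 3 := by
    have e : G ≃ {x // x ∉ F} := Equiv.ofBijective (fun σ => ⟨σ.1 x₀, hmov σ x₀ hx₀⟩)
      ⟨fun σ τ h => hsharp σ τ x₀ hx₀ (congrArg Subtype.val h), fun ⟨y, hy⟩ => by
        obtain ⟨σ, h⟩ := hex x₀ y hx₀ hy
        exact ⟨σ, Subtype.ext h⟩⟩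
    rw [Nat.card_congr e, Nat.card_eq_fintype_card, Fintype.card_subtype_compl,
      Fintype.card_coe, hF]
    omega
  have h3 : 3 ∣ Fintype.card V := three_dvd_card (by omega) K
  -- `F` is a block
  have hFblock : ∀ i j k, i ∈ F → j ∈ F → K.IsTriple i j k → k ∈ F := by
    intro i j k hi hj h
    by_contra hk
    have h1 : ∀ σ : G, σ.1 k = k := by
      intro σ
      have := (hG' σ).isTriple h
      rw [hfix' σ i hi, hfix' σ j hj] at this
      exact this.eq h
    have h2 : Nat.card G = 1 := by
      have : Subsingleton G := ⟨fun σ τ => hsharp σ τ k hk (by rw [h1, h1])⟩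
      exact Nat.card_unique
    omega
  -- the block through a fixed point and a moved point comes from an involution
  have hinv : ∀ i x, i ∈ F → x ∉ F → ∃ σ : G, σ * σ = 1 ∧ σ ≠ 1 ∧ K.IsTriple i x (σ.1 x) := by
    intro i x hi hx
    have hix : i ≠ x := by rintro rfl; exact hx hi
    obtain ⟨y, hy⟩ := exists_isTriple (K := K) hix
    have hyF : y ∉ F := fun h => hx (hFblock i y x hi h hy.swap_right)
    obtain ⟨σ, rfl⟩ := hex x y hx hyF
    have h1 := (hG' σ).isTriple hy
    rw [hfix' σ i hi] at h1
    have h2 : K.IsTriple i (σ.1 x) x := hy.swap_right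
    have h4 := h1.eq h2
    refine ⟨σ, hsharp _ _ x hx h4, ?_, hy⟩
    rintro rfl
    exact hy.2.2.1 rfl
  have hinv' : ∀ (σ : G) x k, σ * σ = 1 → x ∉ F → K.IsTriple x (σ.1 x) k → k ∈ F := by
    intro σ x k h1 hx h
    by_contra hk
    have h2 := ((hG' σ).isTriple h).swap
    have h4 : σ.1 (σ.1 x) = x := by
      change (σ * σ).1 x = x
      rw [h1]; rfl
    rw [h4] at h2
    refine hfree σ k ?_ hk (h2.eq h)
    rintro rfl
    exact h.1 rfl
  let f : Fin 3 → V := fun l => (F.equivFinOfCardEq hF).symm l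
  have hfF : ∀ l, f l ∈ F := fun l => ((F.equivFinOfCardEq hF).symm l).2
  have hfs : ∀ k ∈ F, ∃ l, f l = k := fun k hk =>
    ⟨F.equivFinOfCardEq hF ⟨k, hk⟩, by simp [f]⟩
  have hfi : Function.Injective f := fun l m h => by
    simpa [f, Subtype.ext_iff] using h
  choose s hs1 hs2 hs3 using fun l => hinv (f l) x₀ (hfF l) hx₀
  have hfin : Finite G := inferInstance
  refine ⟨G, inferInstance, ⟨hfin, by omega, ⟨s, ?_, ?_, ?_⟩, ?_⟩, hcard⟩
  · intro l m h
    have h1 := hs3 l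
    rw [h] at h1
    exact hfi (h1.rotate.eq (hs3 m).rotate)
  · intro g
    constructor
    · rintro ⟨h1, h2⟩
      obtain ⟨k, hk⟩ := exists_isTriple (K := K) (hfree g x₀ h2 hx₀).symm
      obtain ⟨l, rfl⟩ := hfs k (hinv' g x₀ k h1 hx₀ hk)
      exact ⟨l, hsharp _ _ x₀ hx₀ ((hs3 l).eq hk.rotate.rotate)⟩
    · rintro ⟨l, rfl⟩
      exact ⟨hs1 l, hs2 l⟩
  · intro l m
    by_cases hlm : l = m
    · exact ⟨1, by simp [hlm]⟩
    -- the class of the block through `f l` and `x₀` is invariant under `s l`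
    obtain ⟨-, -, -, b, hb, hb1, hb2, hb3⟩ := hs3 l
    have hmapb : b.map (s l).1.toEmbedding = b := by
      refine block_unique ((hG' (s l)).map_mem hb) hb (hs3 l).2.1 ?_ ?_ hb1 hb3
      · exact Finset.mem_map.2 ⟨f l, hb1, hfix' _ _ (hfF l)⟩
      · exact Finset.mem_map_of_mem _ hb2
    obtain ⟨P, ⟨hP, hbP⟩, hPu⟩ := K.existsUnique_class b hb
    have hPs : mapClass (s l).1 P = P :=
      hPu _ ⟨(hG' (s l)).mapClass_mem hP, b, hbP, hmapb⟩
    obtain ⟨c, ⟨hcP, hmc⟩, hcu⟩ := K.parallel P hP (f m)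
    have hc := K.subset_blocks P hP hcP
    have hmapc : c.map (s l).1.toEmbedding = c := by
      refine hcu _ ⟨?_, Finset.mem_map.2 ⟨f m, hmc, hfix' _ _ (hfF m)⟩⟩
      rw [← hPs]
      exact ⟨c, hcP, rfl⟩
    have hcF : ∃ x' ∈ c, x' ∉ F := by
      by_contra! h
      have hcF : c = F := Finset.eq_of_subset_of_card_le h (by rw [hF, K.card_eq_three c hc])
      have hbc : b = c := (K.parallel P hP (f l)).unique ⟨hbP, hb1⟩ ⟨hcP, hcF ▸ hfF l⟩
      exact hx₀ (hcF ▸ hbc ▸ hb2)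
    obtain ⟨x', hx'c, hx'⟩ := hcF
    have hsx : (s l).1 x' ∈ c := by
      rw [← hmapc]; exact Finset.mem_map_of_mem _ hx'c
    have ht : K.IsTriple (f m) x' ((s l).1 x') :=
      ⟨fun h => hx' (h ▸ hfF m), fun h => hmov (s l) x' hx' (h ▸ hfF m),
        (hfree _ _ (hs2 l) hx').symm, c, hc, hmc, hx'c, hsx⟩
    obtain ⟨g, hg⟩ := hex x' x₀ hx' hx₀
    refine ⟨g, hsharp _ _ x₀ hx₀ ?_⟩
    have h1 := (hG' g).isTriple ht
    rw [hfix' g _ (hfF m), hg] at h1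
    have h2 : (g * s l * g⁻¹).1 x₀ = g.1 ((s l).1 x') := by
      rw [← hg]; simp
    rw [h2]
    exact h1.eq (hs3 m)
  · have hthird : ∀ g : G, ∃ h : G, g * g ≠ 1 → K.IsTriple x₀ (g.1 x₀) (h.1 x₀) := by
      intro g
      by_cases hg : g * g = 1
      · exact ⟨1, fun h => absurd hg h⟩
      have hg1 : g ≠ 1 := by rintro rfl; simp at hg
      obtain ⟨z, hz⟩ := exists_isTriple (K := K) (hfree g x₀ hg1 hx₀).symm
      have hzF : z ∉ F := by
        intro h
        obtain ⟨σ, h1, -, h2⟩ := hinv z x₀ h hx₀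
        exact hg (by rw [hsharp g σ x₀ hx₀ (hz.rotate.rotate.eq h2), h1])
      obtain ⟨h, rfl⟩ := hex x₀ z hx₀ hzF
      exact ⟨h, fun _ => hz⟩
    choose t ht using hthird
    refine ⟨t, fun g hg => ?_⟩
    have h2 : t g * t g ≠ 1 := fun h => hmov g x₀ hx₀ (hinv' (t g) x₀ _ h hx₀ (ht g hg).swap_right)
    refine ⟨?_, h2, hsharp _ _ x₀ hx₀ ((ht _ h2).eq (ht g hg).swap_right), ?_⟩
    · intro h
      exact (ht g hg).2.2.1 (by rw [h])
    · have hg' : g⁻¹ * g⁻¹ ≠ 1 := by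
        rw [← mul_inv_rev, ne_eq, inv_eq_one]; exact hg
      refine hsharp _ _ x₀ hx₀ ((ht _ hg').eq ?_)
      have h4 := ((hG' g⁻¹).isTriple (ht g hg)).swap
      have h5 : (g⁻¹).1 (g.1 x₀) = x₀ := by simp
      rw [h5] at h4
      exact h4

end KirkmanTripleSystem

/-! ### Groups with three conjugate involutions -/

/-- The elements `x 0`, `x 1`, `x 2` are the involutions of `G`, and they are conjugate. -/
structure ThreeInvolutions {G : Type} [Group G] (x : Fin 3 → G) : Prop where
  injective : Function.Injective x
  iff : ∀ g, (g * g = 1 ∧ g ≠ 1) ↔ ∃ l, x l = g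
  conj : ∀ l m, ∃ g, g * x l * g⁻¹ = x m

/-- An element of even order has a power which is an involution. -/
theorem exists_involution_pow {G : Type} [Group G] [Finite G] {g : G} (h : 2 ∣ orderOf g) :
    ∃ n : ℕ, g ^ n * g ^ n = 1 ∧ g ^ n ≠ 1 := by
  obtain ⟨n, hn⟩ := h
  have hpos := orderOf_pos g
  refine ⟨n, ?_, ?_⟩
  · rw [← pow_add, ← two_mul, ← hn, pow_orderOf_eq_one]
  · exact pow_ne_one_of_lt_orderOf (by omega) (by omega)

theorem units_int_eq_one {u : ℤˣ} {n : ℕ} (hn : Odd n) (h : u ^ n = 1) : u = 1 := by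
  rcases Int.units_eq_one_or u with rfl | rfl
  · rfl
  · rw [hn.neg_one_pow] at h
    exact absurd h (by decide)

namespace ThreeInvolutions

open Equiv.Perm

variable {G : Type} [Group G] {x : Fin 3 → G} (hx : ThreeInvolutions x)

include hx

theorem sq (l : Fin 3) : x l * x l = 1 := ((hx.iff _).2 ⟨l, rfl⟩).1

theorem ne_one (l : Fin 3) : x l ≠ 1 := ((hx.iff _).2 ⟨l, rfl⟩).2

/-- The action of the group on its involutions by conjugation. -/
theorem exists_conjHom : ∃ φ : G →* Equiv.Perm (Fin 3), ∀ g l, x (φ g l) = g * x l * g⁻¹ := by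
  choose f hf using fun (g : G) l => (hx.iff (g * x l * g⁻¹)).1 ⟨by
    rw [show g * x l * g⁻¹ * (g * x l * g⁻¹) = g * (x l * x l) * g⁻¹ by group, hx.sq]; simp, by
    rw [ne_eq, conj_eq_one_iff]; exact hx.ne_one l⟩
  let A : MulAction G (Fin 3) :=
    { smul := f
      one_smul := fun l => hx.injective ((hf 1 l).trans (by simp))
      mul_smul := fun g h l => hx.injective (by
        refine (hf (g * h) l).trans ?_
        refine Eq.trans ?_ (hf g (f h l)).symm
        rw [hf h l]; group) }
  exact ⟨MulAction.toPermHom G (Fin 3), fun g l => hf g l⟩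

end ThreeInvolutions

/-- Three conjugate involutions, together with the action `φ` of the group on them. -/
structure ThreeInvolutionsHom {G : Type} [Group G] (x : Fin 3 → G)
    (φ : G →* Equiv.Perm (Fin 3)) : Prop extends ThreeInvolutions x where
  apply : ∀ g l, x (φ g l) = g * x l * g⁻¹

namespace ThreeInvolutionsHom

open Equiv.Perm

variable {G : Type} [Group G] {x : Fin 3 → G} {φ : G →* Equiv.Perm (Fin 3)}
  (hx : ThreeInvolutionsHom x φ)

include hx

theorem transitive (l m : Fin 3) : ∃ g, φ g l = m := by
  obtain ⟨g, hg⟩ := hx.conj l m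
  exact ⟨g, hx.injective (by rw [hx.apply, hg])⟩

theorem apply_self (l : Fin 3) : φ (x l) l = l :=
  hx.injective (by rw [hx.apply]; simp)

theorem eq_one_of_eq_one {l : Fin 3} (h : φ (x l) = 1) (m : Fin 3) : φ (x m) = 1 := by
  obtain ⟨g, hg⟩ := hx.conj l m
  rw [← hg, map_mul, map_mul, h]
  simp

/-- If the involutions do not commute, each of them acts as a transposition on the three; the odd
elements other than the involutions come in quadruples. -/
theorem card_of_ne_one [Finite G] (h0 : φ (x 0) ≠ 1) (t : G → G)
    (ht : ∀ g, g * g ≠ 1 → t g ≠ g ∧ t g * t g ≠ 1 ∧ t (t g) = g ∧ t g⁻¹ = g⁻¹ * t g) :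
    ∃ k, Nat.card G = 8 * k + 6 := by
  classical
  have := Fintype.ofFinite G
  have hs : ∀ σ : Equiv.Perm (Fin 3), ∀ l, σ l = l → σ ≠ 1 → sign σ = -1 := by decide
  let ε : G →* ℤˣ := sign.comp φ
  have hε : ∀ l, ε (x l) = -1 := fun l =>
    hs _ l (hx.apply_self l) fun h => h0 (hx.eq_one_of_eq_one h 0)
  have hε1 : ∀ g, ε g ≠ -1 ↔ ε g = 1 := fun g => by
    rcases Int.units_eq_one_or (ε g) with h | h <;> rw [h] <;> decide
  have hinv : ∀ g, ε g⁻¹ = ε g := fun g => by rw [map_inv, Int.units_inv_eq_self]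
  have hsq : ∀ g : G, g⁻¹ * g⁻¹ = 1 ↔ g * g = 1 := fun g => by
    rw [← mul_inv_rev, inv_eq_one]
  have hno : ∀ g : G, g * g ≠ 1 → g⁻¹ * g⁻¹ ≠ 1 := fun g h h' => h ((hsq g).1 h')
  let U : Finset G := Finset.univ
  have c1 : (U.filter fun g => ε g = -1).card = (U.filter fun g => ¬ ε g = -1).card := by
    refine Finset.card_nbij' (fun g => g * x 0) (fun g => g * x 0) ?_ ?_ ?_ ?_
    · intro g; simp [U, hε]
      intro h; rw [h]; decide
    · intro g; simp [U, hε]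
      intro h; rw [(hε1 g).1 h]
    · intro g _; simp [mul_assoc, hx.sq]
    · intro g _; simp [mul_assoc, hx.sq]
  have c2 := Finset.card_filter_add_card_filter_not (s := U) (fun g => ε g = -1)
  have c3 := Finset.card_filter_add_card_filter_not (s := U.filter fun g => ε g = -1)
    (fun g => g * g = 1)
  have c4 : ((U.filter fun g => ε g = -1).filter fun g => g * g = 1).card = 3 := by
    have : ((U.filter fun g => ε g = -1).filter fun g => g * g = 1) =
        Finset.univ.image x := by
      ext g
      simp only [U, Finset.mem_filter, Finset.mem_univ, true_and, Finset.mem_image]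
      rw [← hx.iff]
      constructor
      · rintro ⟨h1, h2⟩
        refine ⟨h2, ?_⟩
        rintro rfl
        rw [map_one] at h1
        exact absurd h1 (by decide)
      · intro h
        obtain ⟨l, rfl⟩ := (hx.iff g).1 h
        exact ⟨hε l, h.1⟩
    rw [this, Finset.card_image_of_injective _ hx.injective]
    rfl
  -- the odd elements `g` with `t g` odd, and the inverses of these
  have c5 := Finset.card_filter_add_card_filter_not
    (s := (U.filter fun g => ε g = -1).filter fun g => ¬ g * g = 1) (fun g => ε (t g) = -1)
  have c6 : (((U.filter fun g => ε g = -1).filter fun g => ¬ g * g = 1).filter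
      fun g => ε (t g) = -1).card = (((U.filter fun g => ε g = -1).filter
      fun g => ¬ g * g = 1).filter fun g => ¬ ε (t g) = -1).card := by
    refine Finset.card_nbij' (fun g => g⁻¹) (fun g => g⁻¹) ?_ ?_ ?_ ?_
    · intro g
      simp only [U, Finset.coe_filter, Finset.mem_filter, Finset.mem_univ, true_and,
        Set.mem_ofPred_eq, hinv]
      rintro ⟨⟨h1, h2⟩, h3⟩
      refine ⟨⟨h1, hno g h2⟩, ?_⟩
      rw [(ht g h2).2.2.2, map_mul, hinv, h1, h3]
      decide
    · intro g
      simp only [U, Finset.coe_filter, Finset.mem_filter, Finset.mem_univ, true_and,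
        Set.mem_ofPred_eq, hinv]
      rintro ⟨⟨h1, h2⟩, h3⟩
      refine ⟨⟨h1, hno g h2⟩, ?_⟩
      rw [(ht g h2).2.2.2, map_mul, hinv, h1, (hε1 _).1 h3]
      decide
    · intro g _; simp
    · intro g _; simp
  have c7 : Even (((U.filter fun g => ε g = -1).filter fun g => ¬ g * g = 1).filter
      fun g => ε (t g) = -1).card := by
    have key : ∑ g ∈ ((U.filter fun g => ε g = -1).filter fun g => ¬ g * g = 1).filter
        (fun g => ε (t g) = -1), (1 : ZMod 2) = 0 := by
      refine Finset.sum_involution (fun g _ => t g) (fun _ _ => by decide) ?_ ?_ ?_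
      · intro g hg _
        simp only [Finset.mem_filter] at hg
        exact (ht g hg.1.2).1
      · intro g hg
        simp only [U, Finset.mem_filter, Finset.mem_univ, true_and] at hg ⊢
        have := ht g hg.1.2
        exact ⟨⟨hg.2, this.2.1⟩, by rw [this.2.2.1]; exact hg.1.1⟩
      · intro g hg
        simp only [Finset.mem_filter] at hg
        exact (ht g hg.1.2).2.2.1
    rw [Finset.sum_const, nsmul_one, ZMod.natCast_eq_zero_iff] at key
    exact even_iff_two_dvd.2 key
  obtain ⟨k, hk⟩ := c7
  refine ⟨k, ?_⟩
  rw [Nat.card_eq_fintype_card, ← Finset.card_univ]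
  change U.card = _
  omega

omit hx in
/-- A subgroup permuting the involutions transitively contains an element of `3`-power order that
moves them. -/
theorem exists_pow_three [Finite G] (X : Subgroup G) (hX : ∀ l m, ∃ g ∈ X, φ g l = m) :
    ∃ y ∈ X, ∃ k, y ^ 3 ^ k = 1 ∧ φ y ≠ 1 := by
  have key : ∃ g ∈ X, φ g ^ 3 = 1 ∧ φ g ≠ 1 := by
    obtain ⟨g, hg, h1⟩ := hX 0 1
    obtain ⟨h, hh, h2⟩ := hX 0 2
    have hd : ∀ σ τ : Equiv.Perm (Fin 3), σ 0 = 1 → τ 0 = 2 → (σ ^ 3 = 1 ∧ σ ≠ 1) ∨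
        (τ ^ 3 = 1 ∧ τ ≠ 1) ∨ ((σ * τ) ^ 3 = 1 ∧ σ * τ ≠ 1) := by decide +kernel
    rcases hd _ _ h1 h2 with h | h | h
    · exact ⟨g, hg, h⟩
    · exact ⟨_, hh, h⟩
    · rw [← map_mul] at h
      exact ⟨_, mul_mem hg hh, h⟩
  obtain ⟨g, hg, h3, h1⟩ := key
  obtain ⟨k, m, hm, e⟩ := Nat.exists_eq_pow_mul_and_not_dvd (orderOf_pos g).ne' 3 (by norm_num)
  refine ⟨g ^ m, pow_mem hg m, k, ?_, ?_⟩
  · rw [← pow_mul, mul_comm, ← e, pow_orderOf_eq_one]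
  · rw [map_pow]
    intro h
    have h4 : Fact (Nat.Prime 3) := ⟨Nat.prime_three⟩
    rw [← orderOf_dvd_iff_pow_eq_one, orderOf_eq_prime h3 h1] at h
    exact hm h

omit hx in
theorem sign_eq_one {y : G} {k : ℕ} (hy : y ^ 3 ^ k = 1) : sign (φ y) = 1 :=
  units_int_eq_one (n := 3 ^ k) (Odd.pow (by decide)) (by rw [← map_pow, ← map_pow, hy]; simp)

omit hx in
/-- An even permutation of three letters other than the identity has no fixed points. -/
theorem apply_ne {y : G} {k : ℕ} (hy : y ^ 3 ^ k = 1) (h : φ y ≠ 1) (l : Fin 3) : φ y l ≠ l := by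
  have hd : ∀ σ : Equiv.Perm (Fin 3), sign σ = 1 → σ ≠ 1 → ∀ l, σ l ≠ l := by decide
  exact hd _ (sign_eq_one hy) h l

/-- If the involutions commute, no involution normalizes a `3`-group that moves the involutions. -/
theorem not_normalizes (h0 : φ (x 0) = 1) {Q : Subgroup G} (hQ : IsPGroup 3 Q) {y : G}
    (hy : y ∈ Q) (hy1 : φ y ≠ 1) {z : G} (hz : z ∈ Subgroup.normalizer (Q : Set G))
    (hz1 : z * z = 1) : z = 1 := by
  by_contra hz2
  obtain ⟨l, rfl⟩ := (hx.iff z).1 ⟨hz1, hz2⟩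
  obtain ⟨k, hk⟩ := hQ ⟨y, hy⟩
  have hk' : y ^ 3 ^ k = 1 := congrArg Subtype.val hk
  have hcomm : x l * x (φ y l) = x (φ y l) * x l := by
    have := hx.apply (x l) (φ y l)
    rw [hx.eq_one_of_eq_one h0 l] at this
    exact (mul_inv_eq_iff_eq_mul.1 this.symm)
  have hinv : ∀ m, (x m)⁻¹ = x m := fun m => inv_eq_of_mul_eq_one_left (hx.sq m)
  -- the commutator of the involution and `y`
  have hc : x l * x (φ y l) ∈ Q := by
    have e : x l * x (φ y l) = x l * y * (x l)⁻¹ * y⁻¹ := by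
      rw [hx.apply, hinv l]
      simp only [mul_assoc]
    rw [e]
    exact mul_mem ((Subgroup.mem_normalizer_iff.1 hz y).1 hy) (inv_mem hy)
  have hc2 : (x l * x (φ y l)) ^ 2 = 1 := by
    rw [pow_two]
    nth_rw 2 [hcomm]
    rw [mul_assoc, ← mul_assoc (x (φ y l)), hx.sq, one_mul, hx.sq]
  obtain ⟨n, hn⟩ := hQ ⟨_, hc⟩
  have hn' : (x l * x (φ y l)) ^ 3 ^ n = 1 := congrArg Subtype.val hn
  have h1 : x l * x (φ y l) = 1 := by
    rw [← orderOf_eq_one_iff]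
    exact Nat.eq_one_of_dvd_coprimes (Nat.Coprime.pow_right n (by norm_num : Nat.Coprime 2 3))
      (orderOf_dvd_of_pow_eq_one hc2) (orderOf_dvd_of_pow_eq_one hn')
  refine apply_ne hk' hy1 l (hx.injective ?_)
  rw [← hinv (φ y l)]
  exact (eq_inv_of_mul_eq_one_left h1).symm

/-- If the involutions commute, the group permutes them evenly: otherwise, by the Frattini argument,
an odd permutation would come from the normalizer of a Sylow `3`-subgroup, which has odd order. -/
theorem sign_eq_one_of_comm [Finite G] (h0 : φ (x 0) = 1) (g : G) : sign (φ g) = 1 := by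
  have h3 : Fact (Nat.Prime 3) := ⟨Nat.prime_three⟩
  obtain ⟨y, -, k, hyk, hy1⟩ := exists_pow_three ⊤ fun l m => by
    obtain ⟨g, hg⟩ := hx.transitive l m
    exact ⟨g, trivial, hg⟩
  let A : Subgroup G := (sign.comp φ).ker
  have hyA : y ∈ A := sign_eq_one hyk
  have hyp : IsPGroup 3 (Subgroup.zpowers (⟨y, hyA⟩ : A)) := by
    rintro ⟨_, n, rfl⟩
    refine ⟨k, Subtype.ext (Subtype.ext ?_)⟩
    change (y ^ n) ^ 3 ^ k = 1
    rw [← zpow_natCast, zpow_comm, zpow_natCast, hyk, one_zpow]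
  obtain ⟨R, hR⟩ := hyp.exists_le_sylow
  have hyR : y ∈ R.map A.subtype := ⟨⟨y, hyA⟩, hR (Subgroup.mem_zpowers _), rfl⟩
  have hRp : IsPGroup 3 (R.map A.subtype) := R.2.map _
  have hle : Subgroup.normalizer (R.map A.subtype : Set G) ≤ A := by
    intro g hg
    have hodd : Odd (orderOf g) := by
      rw [← Nat.not_even_iff_odd, even_iff_two_dvd]
      intro h
      obtain ⟨n, h1, h2⟩ := exists_involution_pow h
      exact h2 (hx.not_normalizes h0 hRp hyR hy1 (pow_mem hg n) h1)
    refine units_int_eq_one hodd ?_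
    rw [← map_pow, pow_orderOf_eq_one, map_one]
  have htop := Sylow.normalizer_sup_eq_top R
  have hA : A = ⊤ := by
    rw [← htop]
    exact (sup_eq_right.2 hle).symm
  have : g ∈ A := hA ▸ Subgroup.mem_top g
  exact this

/-- If the involutions commute, the exponent of `2` in the order of the group is even: a Sylow
`2`-subgroup is normalized by an element of `3`-power order fixing only its identity. -/
theorem card_of_eq_one [Finite G] (h0 : φ (x 0) = 1) :
    ∃ s u, Nat.card G = 2 ^ s * u ∧ Even s ∧ s ≠ 0 ∧ Odd u := by
  have h2 : Fact (Nat.Prime 2) := ⟨Nat.prime_two⟩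
  have h3 : Fact (Nat.Prime 3) := ⟨Nat.prime_three⟩
  have hindex : Odd φ.ker.index := by
    rw [Subgroup.index_ker, ← Nat.not_even_iff_odd, even_iff_two_dvd]
    intro h
    obtain ⟨⟨_, g, rfl⟩, hg⟩ := exists_prime_orderOf_dvd_card' 2 h
    have hd : ∀ σ : Equiv.Perm (Fin 3), sign σ = 1 → σ ^ 2 = 1 → σ = 1 := by decide
    replace hg : orderOf (φ g) = 2 := (Subgroup.orderOf_coe _).trans hg
    have := hd _ (hx.sign_eq_one_of_comm h0 g) (by rw [← hg, pow_orderOf_eq_one])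
    rw [this, orderOf_one] at hg
    norm_num at hg
  let T : Sylow 2 φ.ker := default
  have hTodd : Odd T.index := by
    rw [← Nat.not_even_iff_odd, even_iff_two_dvd]
    exact T.not_dvd_index
  obtain ⟨s, hs⟩ := IsPGroup.iff_card.1 T.2
  have htop := Sylow.normalizer_sup_eq_top T
  obtain ⟨y, hyN, k, hyk, hy1⟩ := exists_pow_three
      (Subgroup.normalizer (T.map φ.ker.subtype : Set G)) fun l m => by
    obtain ⟨g, hg⟩ := hx.transitive l m
    have : g ∈ Subgroup.normalizer (T.map φ.ker.subtype : Set G) ⊔ φ.ker :=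
      htop ▸ Subgroup.mem_top g
    obtain ⟨n, hn, c, hc, rfl⟩ := Subgroup.mem_sup_of_normal_right.1 this
    refine ⟨n, hn, ?_⟩
    rw [map_mul, MonoidHom.mem_ker.1 hc, mul_one] at hg
    exact hg
  have hcard : Nat.card (T.map φ.ker.subtype) = 2 ^ s := by
    rw [← hs]
    exact Subgroup.card_map_of_injective φ.ker.subtype_injective
  have hmod : 2 ^ s ≡ 1 [MOD 3] := by
    classical
    have := Fintype.ofFinite (T.map φ.ker.subtype)
    let f : Function.End (T.map φ.ker.subtype) := fun q =>
      ⟨y * q * y⁻¹, (Subgroup.mem_normalizer_iff.1 hyN q).1 q.2⟩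
    have hf : ∀ n : ℕ, ∀ q, (((f ^ n) q : T.map φ.ker.subtype) : G) = y ^ n * q * (y ^ n)⁻¹ := by
      intro n
      induction n with
      | zero =>
        intro q
        change (q : G) = _
        simp
      | succ n ih =>
        intro q
        rw [pow_succ']
        change y * ((f ^ n) q : T.map φ.ker.subtype) * y⁻¹ = _
        rw [ih, pow_succ']
        group
    have h1 := Equiv.Perm.card_fixedPoints_modEq (p := 3) (n := k) (f := f) (by
      funext q
      refine Subtype.ext ?_
      rw [hf, hyk]
      change _ = (q : G)
      simp)
    rw [← Nat.card_eq_fintype_card, hcard] at h1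
    refine h1.trans ?_
    have : Fintype.card (Function.fixedPoints f) = 1 := by
      rw [Fintype.card_eq_one_iff]
      refine ⟨⟨1, Subtype.ext (by simp [f])⟩, ?_⟩
      rintro ⟨q, hq⟩
      refine Subtype.ext (Subtype.ext ?_)
      change (q : G) = 1
      by_contra hq1
      have hyq : y * q * y⁻¹ = q := congrArg Subtype.val hq
      obtain ⟨n, hn⟩ := T.2.map φ.ker.subtype q
      have hn' : (q : G) ^ 2 ^ n = 1 := congrArg Subtype.val hn
      obtain ⟨m, -, hm⟩ := (Nat.dvd_prime_pow Nat.prime_two).1 (orderOf_dvd_of_pow_eq_one hn')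
      have hm0 : m ≠ 0 := by
        rintro rfl
        exact hq1 (orderOf_eq_one_iff.1 (by simpa using hm))
      obtain ⟨r, hr⟩ := exists_involution_pow (g := (q : G)) (hm ▸ dvd_pow_self 2 hm0)
      obtain ⟨l, hl⟩ := (hx.iff _).1 hr
      refine apply_ne hyk hy1 l (hx.injective ?_)
      rw [hx.apply, hl, ← conj_pow, hyq]
    rw [this]
  refine ⟨s, T.index * φ.ker.index, ?_, ?_, ?_, hTodd.mul hindex⟩
  · rw [← φ.ker.card_mul_index, ← T.card_mul_index, ← hs, mul_assoc]
  · by_contra h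
    rw [Nat.not_even_iff_odd] at h
    obtain ⟨r, rfl⟩ := h
    have h4 : 2 ^ (2 * r + 1) ≡ 2 [MOD 3] := by
      rw [pow_succ, pow_mul]
      have : 4 ^ r ≡ 1 ^ r [MOD 3] := Nat.ModEq.pow r (by decide)
      simpa using this.mul_right 2
    exact absurd (h4.symm.trans hmod) (by decide)
  · rintro rfl
    have hx0 : (⟨x 0, h0⟩ : φ.ker) ≠ 1 := fun h => hx.ne_one 0 (congrArg Subtype.val h)
    have h4 : orderOf (⟨x 0, h0⟩ : φ.ker) = 2 :=
      orderOf_eq_prime (Subtype.ext (by rw [pow_two]; exact hx.sq 0)) hx0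
    have h5 : 2 ∣ Nat.card φ.ker := h4 ▸ orderOf_dvd_natCard _
    have h6 : Nat.card T = 1 := by simpa using hs
    have h7 : Nat.card φ.ker = T.index := by
      rw [← T.card_mul_index]
      rw [h6, one_mul]
    rw [h7] at h5
    exact (Nat.not_even_iff_odd.2 hTodd) (even_iff_two_dvd.2 h5)

end ThreeInvolutionsHom

/-- The order of the group, according to whether the involutions commute. -/
theorem PyramidalGroup.card {G : Type} [Group G] (hG : PyramidalGroup G) :
    (∃ n, Nat.card G = 24 * n + 6) ∨ (∃ n, Nat.card G = 24 * n + 12) ∨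
      ∃ e m, Nat.card G = 48 * (4 ^ e * m) ∧ Odd m := by
  obtain ⟨_, hdvd, ⟨x, h1, h2, h3⟩, t, ht⟩ := hG
  have hx : ThreeInvolutions x := ⟨h1, h2, h3⟩
  obtain ⟨φ, hφ⟩ := hx.exists_conjHom
  have hx' : ThreeInvolutionsHom x φ := ⟨hx, hφ⟩
  by_cases h0 : φ (x 0) = 1
  · right
    obtain ⟨s, u, hc, ⟨r, rfl⟩, hs, hu⟩ := hx'.card_of_eq_one h0
    have h3u : 3 ∣ u := by
      rw [hc] at hdvd
      exact (Nat.Coprime.pow_right _ (by norm_num : Nat.Coprime 3 2)).dvd_of_dvd_mul_left hdvd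
    obtain ⟨m, rfl⟩ := h3u
    have hm : Odd m := (Nat.odd_mul.1 hu).2
    rw [← two_mul, pow_mul] at hc
    obtain ⟨r, rfl⟩ := Nat.exists_eq_succ_of_ne_zero (n := r) (by omega)
    rcases r with _ | e
    · obtain ⟨n, rfl⟩ := hm
      exact Or.inl ⟨n, by rw [hc]; norm_num; ring⟩
    · refine Or.inr ⟨e, m, ?_, hm⟩
      rw [hc, Nat.succ_eq_add_one, pow_succ, pow_succ]
      norm_num
      ring
  · left
    obtain ⟨k, hk⟩ := hx'.card_of_ne_one h0 t ht
    exact ⟨k / 3, by omega⟩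

/-- The orders of 3-pyramidal Kirkman triple systems. -/
theorem card_of_existsPyramidalKTS {v : ℕ} (hv : 3 < v) (h : ExistsPyramidalKTS 3 v) :
    (∃ n : ℕ, v = 24 * n + 9) ∨ (∃ n : ℕ, v = 24 * n + 15) ∨
      (∃ n : ℕ, v = 48 * n + 3 ∧ ∃ e m : ℕ, n = 4 ^ e * m ∧ Odd m) := by
  obtain ⟨V, _, K, rfl, hK⟩ := h
  obtain ⟨G, _, hG, hc⟩ := hK.exists_group hv
  rw [hc]
  rcases hG.card with ⟨n, hn⟩ | ⟨n, hn⟩ | ⟨e, m, hn, hm⟩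
  · exact Or.inl ⟨n, by rw [hn]⟩
  · exact Or.inr (Or.inl ⟨n, by rw [hn]⟩)
  · exact Or.inr (Or.inr ⟨4 ^ e * m, by rw [hn], e, m, rfl, hm⟩)

theorem theorem1p1 :
    (∀ v : ℕ, 3 < v → ExistsPyramidalKTS 3 v →
      (∃ n : ℕ, v = 24 * n + 9) ∨ (∃ n : ℕ, v = 24 * n + 15) ∨
        (∃ n : ℕ, v = 48 * n + 3 ∧ ∃ e m : ℕ, n = 4 ^ e * m ∧ Odd m)) ∧
    (∀ n : ℕ, (∃ a b : ℤ, 4 * (n : ℤ) + 1 = a ^ 2 + b ^ 2) →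
      ExistsPyramidalKTS 3 (24 * n + 9)) ∧
    (∀ n : ℕ, (3 ∣ 2 * n + 1 ∨
        ∀ p : ℕ, p.Prime → p ∣ squarefreePart (2 * n + 1) → ¬ p ≡ 11 [MOD 12]) →
      ExistsPyramidalKTS 3 (24 * n + 15)) ∧
    (∀ n : ℕ, (∃ e m : ℕ, n = 4 ^ e * m ∧ Odd m) → ExistsPyramidalKTS 3 (48 * n + 3)) :=
  ⟨fun _ => card_of_existsPyramidalKTS, exists_24n_add_9, exists_24n_add_15, exists_48n_add_3⟩
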